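/- **Setting.** Let $V\subseteq\mathbb C^r$ be a connected open neighbourhood of $q=0$ and let $K$ be a $\mathbb C$-algebra of holomorphic functions of $q=(q_1,\dots,q_r)\in V$ that contains $q_1,\dots,q_r$ and is closed under $\partial_i=q_i\,\partial/\partial q_i=\partial/\partial t_i$, where $q_i=e^{t_i}$. Fix degrees $|b_i|=|h|=2$, $|\partial_i|=0$ and integers $|q_i|\ge 0$. Let $\mathcal A=K[b_1,\dots,b_r]/(\mathcal R_1,\dots,\mathcal R_u)$ with homogeneous relations $\mathcal R_l$ be free of rank $s+1$ over $K$, and let $\mathcal A_0=\mathbb C[b_1,\dots,b_r]/(R_1,\dots,R_u)$, $R_l=\mathcal R_l|_{q=0}$, have dimension $s+1$, with $b_1,\dots,b_r$ linearly independent in $\mathcal A_0$ (in the geometric case $\mathcal A_0=H^*M$ and $b_1,\dots,b_r$ is a basis of $H^2M$). Let $D^h$ be the ring of differential operators generated by $h\partial_1,\dots,h\partial_r$ with coefficients in $K[h]$, and let $M^h=D^h/(D^h_1,\dots,D^h_u)$ (quotient by the left ideal) be a quantization of $\mathcal A$: $M^h$ is free over $K[h]$ of rank $s+1$, and setting $h\partial_i\mapsto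 b_i$ and then $h=0$ in $D_l^h$ gives $\mathcal R_l$. Assume that each $D^h_l$ is homogeneous in $h,q_1,\dots,q_r,\partial_1,\dots,\partial_r$, and that the left ideal $(D^h_1,\dots,D^h_u)$ has a finite Gröbner basis over $K[h]$ (graded reverse lexicographic order, $\partial_1>\dots>\partial_r$, invertible leading coefficients) in which the zero-th order term of every second order element is independent of $h$. Let $P_0,\dots,P_s$ be the corresponding standard monomials in $h\partial_1,\dots,h\partial_r$, in any order, and let $c_j$ be the monomial in $b_1,\dots,b_r$ obtained from $P_j$. Define $\Omega^h=\sum_i\Omega^h_i\,dt_i$ by $[\partial_iP_j]=\sum_k(\Omega_i^h)_{kj}[P_k]$ in $M^h$, and assume $\Omega^h=\frac1h\omega+\theta$ with $\omega,\theta$ independent of $h$ (with coefficient matrices over $K$). **Theorem 5.3.** The classes $[[c_0]],\dots,[[c_s]]$ form a basis of $\mathcal A_0$, and $1,h\partial_1,\dots,h\partial_r$ are among the $P_j$. For every $t_0\in\mathbb C^r$ with $(e^{t_{0,1}},\dots,e^{t_{0,r}})\in V$ there are holomorphic local coordinates $\hat t=(\hat t_1,\dots,\hat t_r)$ on a neighbourhood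 $U$ of $t_0$ and a holomorphic gauge transformation $Q:U\to GL_{s+1}(\mathbb C)$ (independent of $h$) such that: 1. For all $h\ne0$, $\;Q\,\Omega^hQ^{-1}+Q\,d(Q^{-1})=\frac1h\hat\omega$ with $\hat\omega=\sum_j\hat\omega_j\,d\hat t_j$, where the $\hat\omega_j$ are holomorphic functions of $\hat t\in\hat t(U)$ and $\hat d\hat\omega=\hat\omega\wedge\hat\omega=0$, i.e. $\partial\hat\omega_j/\partial\hat t_i=\partial\hat\omega_i/\partial\hat t_j$ and $\hat\omega_i\hat\omega_j=\hat\omega_j\hat\omega_i$. The column of $Q$ belonging to $P=1$ is the corresponding standard basis vector, and the column belonging to $h\partial_i$ is $\partial\hat t_j/\partial t_i$ in the row of $h\partial_j$ $(1\le j\le r)$ and $0$ in all other rows. 2. For $t\in U$, let $\hat{\mathcal A}_t$ be the algebra over $\mathbb C$ generated by $\hat b_1,\dots,\hat b_r$ with the relations $\mathcal R_l|_{q=e^t}$ in which $b_i=\sum_j(\partial\hat t_j/\partial t_i)\hat b_j$. There is a linear isomorphism $\delta_t:\hat{\mathcal A}_t\to\mathcal A_0$ with $\delta_t\big(\sum_k(Q^{-1})_{kj}[c_k]\big)=[[c_j]]$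 for $0\le j\le s$, and it satisfies $\delta_t(1)=1$, $\delta_t([\hat b_i])=[[b_i]]$. Hence $x\circ_{\hat t}y=\delta_t\big(\delta_t^{-1}(x)\,\delta_t^{-1}(y)\big)$ is a commutative associative product on $\mathcal A_0$ with unit $1$ (the "quantum product"), and the matrix of $b_i\,\circ_{\hat t}$ in the basis $[[c_j]]$ is $\hat\omega_i$. Moreover, suppose that on some neighbourhood of $q=0$ in $V$ there is a holomorphic matrix function $Q_0$ with $Q_0|_{q=0}=I$ and $Q_0^{-1}dQ_0=\theta$, that is, $q_i\,\partial Q_0/\partial q_i=Q_0\theta_i$ for all $i$. Then for some $\rho>0$ all of the above holds on $U=\{t: |e^{t_i}|<\rho\text{ for all }i\}$ with $Q(t)=Q_0(e^{t})$ and coordinates of the form $\hat t=t+g(e^{t})$, with $g$ holomorphic for $|q_i|<\rho$ and $g(0)=0$; and, with respect to $\hat q_i=e^{\hat t_i}$, for all $x,y\in\mathcal A_0$ the product $x\circ_{\hat t}y$ is given by a holomorphic function on an open neighbourhood of $\hat q=0$ containing all $\hat q$ with $t\in U$, whose value at $\hat q=0$ is the original product $x\cdot y$ of $\mathcal A_0$.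 -/

import Mathlib

open scoped Polynomial

noncomputable section

namespace QDM

/-! ### Functions of `q`, and the derivations `∂ᵢ = qᵢ ∂/∂qᵢ = ∂/∂tᵢ`, where `qᵢ = exp tᵢ` -/

/-- Extension by zero of a function on an open set. Only its values (and germs) at points of the
open set are ever used. -/
def zeroExt {r : ℕ} {V : TopologicalSpace.Opens (Fin r → ℂ)} (f : V → ℂ) : (Fin r → ℂ) → ℂ :=
  Function.extend Subtype.val f 0

theorem zeroExt_apply {r : ℕ} {V : TopologicalSpace.Opens (Fin r → ℂ)} (f : V → ℂ) (q : V) :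
    zeroExt f q.1 = f q :=
  Subtype.val_injective.extend_apply f 0 q

theorem zeroExt_add {r : ℕ} {V : TopologicalSpace.Opens (Fin r → ℂ)} (f g : V → ℂ) :
    zeroExt (f + g) = zeroExt f + zeroExt g := by
  funext q
  by_cases h : q ∈ V
  · simpa using (zeroExt_apply (f + g) ⟨q, h⟩).trans
      (congrArg₂ (· + ·) (zeroExt_apply f ⟨q, h⟩) (zeroExt_apply g ⟨q, h⟩)).symm
  · have hq : ¬ ∃ a : V, a.1 = q := by rintro ⟨a, rfl⟩; exact h a.2
    simp [zeroExt, Function.extend_apply' _ _ _ hq]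

theorem zeroExt_smul {r : ℕ} {V : TopologicalSpace.Opens (Fin r → ℂ)} (c : ℂ) (f : V → ℂ) :
    zeroExt (c • f) = c • zeroExt f := by
  funext q
  by_cases h : q ∈ V
  · simpa using (zeroExt_apply (c • f) ⟨q, h⟩).trans
      (congrArg (c * ·) (zeroExt_apply f ⟨q, h⟩)).symm
  · have hq : ¬ ∃ a : V, a.1 = q := by rintro ⟨a, rfl⟩; exact h a.2
    simp [zeroExt, Function.extend_apply' _ _ _ hq]

/-- The `i`-th partial derivative of a function on `ℂ^r`. -/
def pd {r : ℕ} (i : Fin r) (f : (Fin r → ℂ) → ℂ) (t : Fin r → ℂ) : ℂ :=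
  fderiv ℂ f t (Pi.single i 1)

/-- `qᵢ ∂f/∂qᵢ` for a function `f` on `V`. -/
def logDerivFun {r : ℕ} {V : TopologicalSpace.Opens (Fin r → ℂ)} (i : Fin r) (f : V → ℂ) :
    V → ℂ :=
  fun q => q.1 i * pd i (zeroExt f) q.1

/-- An algebra `K` of functions of `q₁, …, q_r`: a subalgebra of the algebra of holomorphic
functions on a connected open neighbourhood `V` of `q = 0`, which contains the coordinate functions
`qᵢ` and is closed under `∂ᵢ = qᵢ ∂/∂qᵢ`. -/
structure CoeffAlgebra (r : ℕ) where
  V : TopologicalSpace.Opens (Fin r → ℂ)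
  zero_mem : (0 : Fin r → ℂ) ∈ V
  connected : IsPreconnected (V : Set (Fin r → ℂ))
  alg : Subalgebra ℂ (V → ℂ)
  holo : ∀ f ∈ alg, DifferentiableOn ℂ (zeroExt f) V
  coord_mem : ∀ i : Fin r, (fun q : V => q.1 i) ∈ alg
  logDeriv_mem : ∀ i : Fin r, ∀ f ∈ alg, logDerivFun i f ∈ alg

variable {r : ℕ}

namespace CoeffAlgebra

/-- The elements of `K`. -/
def Elem (K : CoeffAlgebra r) : Type := ↥K.alg

instance (K : CoeffAlgebra r) : CommRing K.Elem := Subalgebra.toCommRing K.alg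

instance (K : CoeffAlgebra r) : Algebra ℂ K.Elem := Subalgebra.algebra K.alg

/-- The elements of `K` as functions on `V`. -/
def toFun (K : CoeffAlgebra r) : K.Elem →ₐ[ℂ] (K.V → ℂ) := K.alg.val

theorem toFun_mem (K : CoeffAlgebra r) (f : K.Elem) : K.toFun f ∈ K.alg := Subtype.property f

theorem toFun_injective (K : CoeffAlgebra r) : Function.Injective K.toFun :=
  Subtype.val_injective

/-- The element of `K` given by a function which belongs to the subalgebra. -/
def elemMk (K : CoeffAlgebra r) (f : K.V → ℂ) (hf : f ∈ K.alg) : K.Elem := ⟨f, hf⟩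

/-- The point `q = 0`. -/
def origin (K : CoeffAlgebra r) : K.V := ⟨0, K.zero_mem⟩

/-- Evaluation of the elements of `K` at a point of `V`. -/
def eval (K : CoeffAlgebra r) (q : K.V) : K.Elem →+* ℂ :=
  (Pi.evalRingHom (fun _ : K.V => ℂ) q).comp K.toFun.toRingHom

/-- The derivation `∂ᵢ = qᵢ ∂/∂qᵢ` of `K`. -/
def del (K : CoeffAlgebra r) (i : Fin r) : K.Elem →ₗ[ℂ] K.Elem where
  toFun f := K.elemMk (logDerivFun i (K.toFun f)) (K.logDeriv_mem i _ (K.toFun_mem f))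
  map_add' f g := by
    apply K.toFun_injective
    funext q
    have hf := (K.holo _ (K.toFun_mem f)).differentiableAt (K.V.isOpen.mem_nhds q.2)
    have hg := (K.holo _ (K.toFun_mem g)).differentiableAt (K.V.isOpen.mem_nhds q.2)
    change q.1 i * pd i (zeroExt (K.toFun f + K.toFun g)) q.1
      = q.1 i * pd i (zeroExt (K.toFun f)) q.1 + q.1 i * pd i (zeroExt (K.toFun g)) q.1
    rw [zeroExt_add, pd, fderiv_add hf hg, ← mul_add]
    rfl
  map_smul' c f := by
    apply K.toFun_injective
    funext q
    have hf := (K.holo _ (K.toFun_mem f)).differentiableAt (K.V.isOpen.mem_nhds q.2)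
    change q.1 i * pd i (zeroExt (c • K.toFun f)) q.1 = c * (q.1 i * pd i (zeroExt (K.toFun f)) q.1)
    rw [zeroExt_smul, pd, fderiv_const_smul hf c, mul_left_comm]
    rfl

/-- `f` is (weighted) homogeneous of degree `n` when `qᵢ` has degree `wᵢ`, expressed by Euler's
identity `∑ᵢ wᵢ qᵢ ∂f/∂qᵢ = n f`. -/
def IsHomog (K : CoeffAlgebra r) (w : Fin r → ℕ) (f : K.Elem) (n : ℤ) : Prop :=
  ∑ i, (w i : ℂ) • K.del i f = (n : ℂ) • f

end CoeffAlgebra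

/-! ### The commutative algebras `𝒜` and `𝒜₀` -/

/-- The ideal `(𝓡₁, …, 𝓡_u)` of `K[b₁, …, b_r]`. -/
def relIdeal (K : CoeffAlgebra r) {u : ℕ} (R : Fin u → MvPolynomial (Fin r) K.Elem) :
    Ideal (MvPolynomial (Fin r) K.Elem) :=
  Ideal.span (Set.range R)

/-- The algebra `𝒜 = K[b₁, …, b_r]/(𝓡₁, …, 𝓡_u)`. -/
abbrev AlgA (K : CoeffAlgebra r) {u : ℕ} (R : Fin u → MvPolynomial (Fin r) K.Elem) : Type :=
  MvPolynomial (Fin r) K.Elem ⧸ relIdeal K R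

/-- The ideal `(R₁, …, R_u)` of `ℂ[b₁, …, b_r]`, where `R_l = 𝓡_l|_{q=0}`. -/
def relIdeal₀ (K : CoeffAlgebra r) {u : ℕ} (R : Fin u → MvPolynomial (Fin r) K.Elem) :
    Ideal (MvPolynomial (Fin r) ℂ) :=
  Ideal.span (Set.range fun l => MvPolynomial.map (K.eval K.origin) (R l))

/-- The algebra `𝒜₀ = ℂ[b₁, …, b_r]/(R₁, …, R_u)`. -/
abbrev AlgA₀ (K : CoeffAlgebra r) {u : ℕ} (R : Fin u → MvPolynomial (Fin r) K.Elem) : Type :=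
  MvPolynomial (Fin r) ℂ ⧸ relIdeal₀ K R

/-- The class `[[c]]` in `𝒜₀` of a polynomial `c` in `b₁, …, b_r`. -/
def cls₀ (K : CoeffAlgebra r) {u : ℕ} (R : Fin u → MvPolynomial (Fin r) K.Elem)
    (c : MvPolynomial (Fin r) ℂ) : AlgA₀ K R :=
  Ideal.Quotient.mk (relIdeal₀ K R) c

/-- The standing assumptions on `𝒜`: the relations are homogeneous for `|bᵢ| = 2`, `|qᵢ| = wᵢ`;
`𝒜` is free of rank `s + 1` over `K`; `dim 𝒜₀ = s + 1`; and `b₁, …, b_r` are linearly independent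
in `𝒜₀` (they form a basis of `H²M` when `𝒜₀ = H^*M`). -/
structure IsDeformation (K : CoeffAlgebra r) (w : Fin r → ℕ) (s : ℕ) {u : ℕ}
    (R : Fin u → MvPolynomial (Fin r) K.Elem) : Prop where
  homog : ∀ l, ∃ N : ℤ, ∀ m, K.IsHomog w ((R l).coeff m) (N - 2 * (m.degree : ℤ))
  free : Nonempty (Module.Basis (Fin (s + 1)) K.Elem (AlgA K R))
  free₀ : Nonempty (Module.Basis (Fin (s + 1)) ℂ (AlgA₀ K R))
  indep : LinearIndependent ℂ fun i : Fin r => cls₀ K R (MvPolynomial.X i)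

/-! ### Differential operators -/

/-- The operator `h∂ᵢ` on `K[h]`; the polynomial variable `X` is `h`. -/
def hdel (K : CoeffAlgebra r) (i : Fin r) : Module.End ℂ K.Elem[X] :=
  LinearMap.mulLeft ℂ (Polynomial.X : K.Elem[X]) *
    Polynomial.lsum fun k =>
      ((Polynomial.monomial k : K.Elem →ₗ[K.Elem] K.Elem[X]).restrictScalars ℂ) ∘ₗ K.del i

/-- The ring `D^h` of differential operators generated by `h∂₁, …, h∂_r` with coefficients in
`K[h]`, as a ring of operators on `K[h]`. -/
def Dh (K : CoeffAlgebra r) : Subalgebra ℂ (Module.End ℂ K.Elem[X]) :=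
  Algebra.adjoin ℂ
    (Set.range (fun a : K.Elem[X] => LinearMap.mulLeft ℂ a) ∪ Set.range (hdel K))

theorem mulLeft_mem_Dh (K : CoeffAlgebra r) (a : K.Elem[X]) : LinearMap.mulLeft ℂ a ∈ Dh K :=
  Algebra.subset_adjoin (Or.inl ⟨a, rfl⟩)

/-- Symbols: polynomials in `r` commuting variables `b₁, …, b_r` with coefficients in `K[h]`. -/
abbrev Sym (K : CoeffAlgebra r) : Type := MvPolynomial (Fin r) K.Elem[X]

/-- The differential operator `∑_m a_m (h∂)^m` with the symbol `∑_m a_m b^m`. Every element of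
`D^h` is of this form for exactly one symbol, so that `D^h` and the symbols are identified as
`K[h]`-modules; the inverse of `op` is the map `S` which replaces `h∂ᵢ` by `bᵢ`. -/
def op (K : CoeffAlgebra r) : Sym K →ₗ[K.Elem[X]] Module.End ℂ K.Elem[X] :=
  (MvPolynomial.basisMonomials (Fin r) K.Elem[X]).constr ℕ fun m =>
    (List.ofFn fun i => hdel K i ^ m i).prod

/-- The left ideal `(D₁^h, …, D_u^h)` of `D^h` generated by the operators with symbols `d_l`,
as a `K[h]`-submodule of the module of symbols. -/
def leftIdeal (K : CoeffAlgebra r) {u : ℕ} (d : Fin u → Sym K) : Submodule K.Elem[X] (Sym K) where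
  carrier := {p | op K p ∈ Submodule.span ↥(Dh K) (Set.range fun l => op K (d l))}
  add_mem' {p p'} hp hp' := by
    simp only [Set.mem_ofPred_eq, map_add] at *
    exact Submodule.add_mem _ hp hp'
  zero_mem' := by
    simp only [Set.mem_ofPred_eq, map_zero]
    exact Submodule.zero_mem _
  smul_mem' a p hp := by
    simp only [Set.mem_ofPred_eq, map_smul] at *
    exact Submodule.smul_mem _ (⟨LinearMap.mulLeft ℂ a, mulLeft_mem_Dh K a⟩ : ↥(Dh K)) hp

/-- The D-module `M^h = D^h/(D₁^h, …, D_u^h)`, as a `K[h]`-module. -/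
abbrev Mh (K : CoeffAlgebra r) {u : ℕ} (d : Fin u → Sym K) : Type := Sym K ⧸ leftIdeal K d

/-- The class in `M^h` of the operator with symbol `p`. -/
def clsM (K : CoeffAlgebra r) {u : ℕ} (d : Fin u → Sym K) (p : Sym K) : Mh K d :=
  (leftIdeal K d).mkQ p

/-- `M^h = D^h/(D₁^h, …, D_u^h)` is a quantization of `𝒜 = K[b]/(𝓡₁, …, 𝓡_u)`: it is free of rank
`s + 1` over `K[h]`, and `lim_{h → 0} S(D_l^h) = 𝓡_l`. -/
structure IsQuantization (K : CoeffAlgebra r) (s : ℕ) {u : ℕ}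
    (R : Fin u → MvPolynomial (Fin r) K.Elem) (d : Fin u → Sym K) : Prop where
  free : Nonempty (Module.Basis (Fin (s + 1)) K.Elem[X] (Mh K d))
  limit : ∀ l, MvPolynomial.map (Polynomial.evalRingHom 0) (d l) = R l

/-- The operator with symbol `p` is homogeneous in `h, q₁, …, q_r, ∂₁, …, ∂_r`, where `h` has degree
`2`, `qᵢ` has degree `wᵢ` and `∂ᵢ` has degree `0` (so that `h∂ᵢ` has degree `2`). -/
def IsHomogOp (K : CoeffAlgebra r) (w : Fin r → ℕ) (p : Sym K) : Prop :=
  ∃ N : ℤ, ∀ (m : Fin r →₀ ℕ) (k : ℕ),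
    K.IsHomog w ((p.coeff m).coeff k) (N - 2 * (k : ℤ) - 2 * (m.degree : ℤ))

/-! ### Groebner bases and standard monomials -/

/-- The strict graded reverse lexicographic order with `∂₁ > ⋯ > ∂_r`, all of weight one. -/
def GrevlexLT (m n : Fin r →₀ ℕ) : Prop :=
  m.degree < n.degree ∨ (m.degree = n.degree ∧ ∃ i, n i < m i ∧ ∀ j, i < j → m j = n j)

/-- `m` is the exponent of the leading monomial of `p`. -/
def IsLeading (K : CoeffAlgebra r) (p : Sym K) (m : Fin r →₀ ℕ) : Prop :=
  m ∈ p.support ∧ ∀ n ∈ p.support, n ≠ m → GrevlexLT n m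

/-- `G` is a (finite) Groebner basis over `K[h]` of the left ideal `I`: its elements lie in `I` and
have invertible leading coefficients (so that one can divide by them), and the leading monomial of
every nonzero element of `I` is divisible by the leading monomial of an element of `G`. -/
structure IsGroebner (K : CoeffAlgebra r) (I : Submodule K.Elem[X] (Sym K)) (G : Set (Sym K)) :
    Prop where
  finite : G.Finite
  subset : ∀ g ∈ G, g ∈ I
  unit : ∀ g ∈ G, ∃ m, IsLeading K g m ∧ IsUnit (g.coeff m)
  lead : ∀ p ∈ I, p ≠ 0 → ∃ g ∈ G, ∃ m n, IsLeading K g m ∧ IsLeading K p n ∧ m ≤ n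

/-- Exponents of the standard monomials: those not divisible by a leading monomial of `G`. -/
def standardExps (K : CoeffAlgebra r) (G : Set (Sym K)) : Set (Fin r →₀ ℕ) :=
  {n | ∀ g ∈ G, ∀ m, IsLeading K g m → ¬ m ≤ n}

/-- The zero-th order term of each second order element of `G` is independent of `h`. -/
def ZerothTermsConstant (K : CoeffAlgebra r) (G : Set (Sym K)) : Prop :=
  ∀ g ∈ G, g.totalDegree = 2 → ∃ a : K.Elem, g.coeff 0 = Polynomial.C a

/-- With `P_j = (h∂)^{e_j}`, the matrix `Ω^h_i` of the action of `∂ᵢ` on `M^h`, defined by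
`[∂ᵢ P_j] = ∑_k (Ω^h_i)_{kj} [P_k]`, is `(1/h) ωᵢ + θᵢ`. This is stated after multiplication
by `h`; note that `h∂ᵢ P_j` has the symbol `bᵢ b^{e_j}`. -/
def HasConnectionForm (K : CoeffAlgebra r) {s u : ℕ} (d : Fin u → Sym K)
    (e : Fin (s + 1) → Fin r →₀ ℕ)
    (ω θ : Fin r → Matrix (Fin (s + 1)) (Fin (s + 1)) K.Elem) : Prop :=
  ∀ i j, clsM K d (MvPolynomial.X i * MvPolynomial.monomial (e j) 1) =
    ∑ k, (Polynomial.C (ω i k j) + Polynomial.X * Polynomial.C (θ i k j)) •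
      clsM K d (MvPolynomial.monomial (e k) 1)

/-! ### Connections, changes of variable and gauge transformations -/

/-- `t ↦ q`, `qᵢ = exp tᵢ`. -/
def expMap (t : Fin r → ℂ) : Fin r → ℂ := fun i => Complex.exp (t i)

/-- Entrywise partial derivative of a matrix valued function. -/
def matPd {n : ℕ} (i : Fin r) (M : (Fin r → ℂ) → Matrix (Fin n) (Fin n) ℂ) (t : Fin r → ℂ) :
    Matrix (Fin n) (Fin n) ℂ :=
  Matrix.of fun k j => pd i (fun x => M x k j) t

/-- Matrix valued functions that are holomorphic on `S`. -/
def HolMatOn {n : ℕ} (M : (Fin r → ℂ) → Matrix (Fin n) (Fin n) ℂ) (S : Set (Fin r → ℂ)) : Prop :=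
  ∀ k j, DifferentiableOn ℂ (fun x => M x k j) S

/-- The value at `q` of a matrix over `K`. -/
def evalMat (K : CoeffAlgebra r) {n : ℕ} (M : Matrix (Fin n) (Fin n) K.Elem) (q : Fin r → ℂ) :
    Matrix (Fin n) (Fin n) ℂ :=
  M.map fun f => zeroExt (K.toFun f) q

/-- The components of the connection form `Ω^h = (1/h) ω + θ` with respect to `dt₁, …, dt_r`. -/
def connForm (K : CoeffAlgebra r) {n : ℕ} (ω θ : Fin r → Matrix (Fin n) (Fin n) K.Elem) (h : ℂ)
    (i : Fin r) (t : Fin r → ℂ) : Matrix (Fin n) (Fin n) ℂ :=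
  h⁻¹ • evalMat K (ω i) (expMap t) + evalMat K (θ i) (expMap t)

/-- The gauge transform `Q Ω Q⁻¹ + Q d(Q⁻¹)` of a connection form by `Q`. -/
def gauge {n : ℕ} (Q : (Fin r → ℂ) → Matrix (Fin n) (Fin n) ℂ)
    (Ω : Fin r → (Fin r → ℂ) → Matrix (Fin n) (Fin n) ℂ) (i : Fin r) (t : Fin r → ℂ) :
    Matrix (Fin n) (Fin n) ℂ :=
  Q t * Ω i t * (Q t)⁻¹ + Q t * matPd i (fun x => (Q x)⁻¹) t

/-- The Jacobian matrix, with `(j, i)` entry `∂t̂_j/∂tᵢ`. -/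
def jac (φ : (Fin r → ℂ) → Fin r → ℂ) (t : Fin r → ℂ) : Matrix (Fin r) (Fin r) ℂ :=
  Matrix.of fun j i => pd i (fun x => φ x j) t

/-- The change of variable and the gauge transformation: `φ = t̂` is a system of local holomorphic
coordinates, `Q` is an invertible holomorphic gauge transformation, and the connection form `Ω^h`
becomes `(1/h) ∑_j ω̂_j dt̂_j`, with `ω̂_j` holomorphic in `t̂`, `d̂ω̂ = 0` and `ω̂ ∧ ω̂ = 0`.
The indices `k₀` and `κ i` are those of `P = 1` and `P = h∂ᵢ`; the corresponding columns of `Q` are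
those of a matrix with upper left blocks `1` and `T`, `T` being the Jacobian matrix of `t̂`. -/
structure IsMirrorGauge (K : CoeffAlgebra r) {s : ℕ}
    (ω θ : Fin r → Matrix (Fin (s + 1)) (Fin (s + 1)) K.Elem)
    (k₀ : Fin (s + 1)) (κ : Fin r → Fin (s + 1))
    (φ : OpenPartialHomeomorph (Fin r → ℂ) (Fin r → ℂ))
    (Q : (Fin r → ℂ) → Matrix (Fin (s + 1)) (Fin (s + 1)) ℂ)
    (ωhat : Fin r → (Fin r → ℂ) → Matrix (Fin (s + 1)) (Fin (s + 1)) ℂ) : Prop where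
  mem_V : ∀ t ∈ φ.source, expMap t ∈ K.V
  holo : DifferentiableOn ℂ φ φ.source
  holo_symm : DifferentiableOn ℂ φ.symm φ.target
  holo_Q : HolMatOn Q φ.source
  det_Q : ∀ t ∈ φ.source, (Q t).det ≠ 0
  col_one : ∀ t ∈ φ.source, ∀ k, Q t k k₀ = if k = k₀ then 1 else 0
  col_del : ∀ t ∈ φ.source, ∀ i k,
    Q t k (κ i) = ∑ j, if k = κ j then jac φ t j i else 0
  holo_ωhat : ∀ j, HolMatOn (ωhat j) φ.target
  gauge_eq : ∀ h : ℂ, h ≠ 0 → ∀ t ∈ φ.source, ∀ i,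
    gauge Q (connForm K ω θ h) i t = h⁻¹ • ∑ j, jac φ t j i • ωhat j (φ t)
  closed : ∀ τ ∈ φ.target, ∀ i j, matPd i (ωhat j) τ = matPd j (ωhat i) τ
  wedge : ∀ τ ∈ φ.target, ∀ i j, ωhat i τ * ωhat j τ = ωhat j τ * ωhat i τ

/-! ### The quantum product -/

/-- The substitution `bᵢ = ∑_j J_{ji} b̂_j`; with `J` the Jacobian matrix of `t̂`, it expresses the
symbols `bᵢ` of `h∂ᵢ` by the symbols `b̂_j` of `h ∂/∂t̂_j`. -/
def substHat (J : Matrix (Fin r) (Fin r) ℂ) :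
    MvPolynomial (Fin r) ℂ →ₐ[ℂ] MvPolynomial (Fin r) ℂ :=
  MvPolynomial.aeval fun i => ∑ j, MvPolynomial.C (J j i) * MvPolynomial.X j

/-- The ideal of `ℂ[b̂₁, …, b̂_r]` generated by the relations `𝓡_l`, at the point `q`, rewritten
in the variables `b̂`. -/
def relIdealHat (K : CoeffAlgebra r) {u : ℕ} (R : Fin u → MvPolynomial (Fin r) K.Elem)
    (q : K.V) (J : Matrix (Fin r) (Fin r) ℂ) : Ideal (MvPolynomial (Fin r) ℂ) :=
  Ideal.span (Set.range fun l => substHat J (MvPolynomial.map (K.eval q) (R l)))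

/-- The fibre at the point `q` of the de-quantized algebra `𝒜̂` in the new coordinates. -/
abbrev AlgHat (K : CoeffAlgebra r) {u : ℕ} (R : Fin u → MvPolynomial (Fin r) K.Elem)
    (q : K.V) (J : Matrix (Fin r) (Fin r) ℂ) : Type :=
  MvPolynomial (Fin r) ℂ ⧸ relIdealHat K R q J

/-- The class in `𝒜̂`, at the point `q`, of a polynomial in `b̂₁, …, b̂_r`. -/
def clsHat (K : CoeffAlgebra r) {u : ℕ} (R : Fin u → MvPolynomial (Fin r) K.Elem)
    (q : K.V) (J : Matrix (Fin r) (Fin r) ℂ) (c : MvPolynomial (Fin r) ℂ) : AlgHat K R q J :=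
  Ideal.Quotient.mk (relIdealHat K R q J) c

/-- `prod τ`, for `τ = φ t` in the range of the new coordinates, is the quantum product
`x ∘ y = δ (δ⁻¹ x · δ⁻¹ y)` on `𝒜₀`. Here `δ : 𝒜̂ → 𝒜₀` is the linear isomorphism which sends the
gauge transformed basis `ĉ_j = ∑_k (Q⁻¹)_{kj} c_k` of `𝒜̂` to the basis `[[c_j]]` of `𝒜₀`, where
`c_j = b^{e_j}`; it sends `1` to `[[1]]` and `b̂ᵢ` to `[[bᵢ]]`. The matrix of `bᵢ ∘` is `ω̂ᵢ`, so
that `d + (1/h) ω̂` is the Dubrovin connection of the product. -/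
def IsQuantumProduct (K : CoeffAlgebra r) {s u : ℕ} (R : Fin u → MvPolynomial (Fin r) K.Elem)
    (e : Fin (s + 1) → Fin r →₀ ℕ)
    (φ : OpenPartialHomeomorph (Fin r → ℂ) (Fin r → ℂ))
    (Q : (Fin r → ℂ) → Matrix (Fin (s + 1)) (Fin (s + 1)) ℂ)
    (ωhat : Fin r → (Fin r → ℂ) → Matrix (Fin (s + 1)) (Fin (s + 1)) ℂ)
    (prod : (Fin r → ℂ) → AlgA₀ K R → AlgA₀ K R → AlgA₀ K R) : Prop :=
  ∀ t ∈ φ.source, ∃ q : K.V, q.1 = expMap t ∧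
    ∃ δ : AlgHat K R q (jac φ t) ≃ₗ[ℂ] AlgA₀ K R,
      (∀ x y, prod (φ t) x y = δ (δ.symm x * δ.symm y)) ∧
      δ 1 = 1 ∧
      (∀ i, δ (clsHat K R q (jac φ t) (MvPolynomial.X i)) = cls₀ K R (MvPolynomial.X i)) ∧
      (∀ j, δ (∑ k, (Q t)⁻¹ k j •
          clsHat K R q (jac φ t) (substHat (jac φ t) (MvPolynomial.monomial (e k) 1))) =
        cls₀ K R (MvPolynomial.monomial (e j) 1)) ∧
      (∀ i j, prod (φ t) (cls₀ K R (MvPolynomial.X i))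
          (cls₀ K R (MvPolynomial.monomial (e j) 1)) =
        ∑ k, ωhat i (φ t) k j • cls₀ K R (MvPolynomial.monomial (e k) 1))

end QDM

end

/-! The proof has three layers: algebra over K[h], analysis of a flat connection, and transport of a
product.

Algebra. The leading coefficients of the Gröbner basis are units, so division works and the standard
monomials form a basis of M^h over K[h] (`standardBasis`). At h = 0, left multiplication by h∂ᵢ
becomes multiplication by bᵢ; hence the same monomials span 𝒜, form a basis of it by comparison of
ranks (`classicalBasis`), and specialise to a basis of every fibre, in particular of 𝒜₀. At q = 0
the relations are homogeneous, 𝒜₀ ≠ 0 and the bᵢ are independent, so leading monomials have degree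
at least 2 and 1, h∂ᵢ are standard (`two_le_degree_of_isLeading`).

Since h∂ᵢ and h∂ⱼ commute on M^h, the coefficients of h⁰, h¹, h² show that the ωᵢ commute, that ω is
closed with respect to d + θ, and that d + θ is flat. Moreover, the entry of θᵢ in the column of h∂ⱼ
and the row of P_k is weighted homogeneous of degree 2 − 2|P_k|. This is negative when P_k has order
at least 2, and then the entry is zero, because the weights are nonnegative and the functions are
holomorphic at 0. In the row of P = 1 the degree is 2; the hypothesis on zeroth order terms exhibits
the entry as a combination of functions of degree 4, and the contracting flow of the weighted Euler
field forces it to vanish (`coeff_one_coordM_eq_zero`). All this is collected in `isFlatConnection`.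

Analysis. The Frobenius theorem (`exists_flat_frame`) solves dQ = Qθ with Q(t₀) = 1. The gauge
transformation by Q removes θ for all h and leaves (1/h) QωQ⁻¹ (`isMirrorGauge_gaugedForm`). As θ
kills the column of 1, that column of Q is constant; the columns of the h∂ᵢ stay in their span; and
the symmetry of θ makes every row of the resulting r × r block a closed 1-form. The primitives of
these forms are the coordinates t̂, so that the block is their Jacobian matrix
(`exists_mirrorGauge`).

Product. δ takes coordinates in the fibre of 𝒜, applies Q, and reads the result in the basis
[[c_j]]. The columns of Q give δ(1) = 1 and δ(b̂ᵢ) = [[bᵢ]], and multiplication by b̂ᵢ becomes the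
corresponding component of QωQ⁻¹ (`isQuantumProduct_transportedMul`).

Near q = 0 the block T of Q₀ satisfies qᵢ∂T_lj/∂qᵢ = q_j∂T_li/∂q_j. Therefore T_lj − δ_lj is
divisible by q_j and the quotients form closed 1-forms in q, with primitives g
(`exists_log_primitive`). The map t + g(e^t) is a small perturbation of the identity where all
e^{tᵢ} are small, hence injective there, and q̂ = q e^{g(q)} is a coordinate system at 0 in which
the product is holomorphic (`exists_mirrorGauge_near_zero`). -/

noncomputable section

namespace QDM

section
open Set Metric Filter Topology MeasureTheory

/-! ### Holomorphic functions of several variables -/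

section Holomorphic

variable {E F : Type*} [NormedAddCommGroup E] [NormedSpace ℂ E] [NormedAddCommGroup F]
  [NormedSpace ℂ F]

/-- Cauchy's estimate. The factor 2 appears because the target ball is centred at f x and not at 0.
-/
theorem norm_fderiv_le_of_norm_le {f : E → F} {x : E} {R C : ℝ} (hR : 0 < R)
    (hd : DifferentiableOn ℂ f (ball x R)) (hC : ∀ y ∈ ball x R, ‖f y‖ ≤ C) :
    ‖fderiv ℂ f x‖ ≤ 2 * C / R := by
  refine Complex.norm_fderiv_le_div_of_mapsTo_ball hd (fun y hy => ?_) hR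
  rw [mem_closedBall, dist_eq_norm]
  have h1 := hC y hy
  have h2 := hC x (mem_ball_self hR)
  linarith [norm_sub_le (f y) (f x)]

theorem exists_closedBall_two_mul_subset {E : Type*} [SeminormedAddCommGroup E] {U : Set E} (hU : IsOpen U) {x : E} (hx : x ∈ U) :
    ∃ R : ℝ, 0 < R ∧ closedBall x (2 * R) ⊆ U := by
  obtain ⟨ε, hε, h⟩ := Metric.isOpen_iff.1 hU x hx
  refine ⟨ε / 4, by positivity, (closedBall_subset_ball ?_).trans h⟩
  linarith

/-- Joint continuity suffices: Cauchy's estimate on balls of radius R inside the closed ball of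
radius 2R yields both the dominating bound for the derivatives and their continuity in the
parameter. -/
theorem differentiableOn_intervalIntegral [ProperSpace E] [CompleteSpace F] {f : ℝ → E → F}
    {a b : ℝ} (hab : a ≤ b) {U : Set E} (hU : IsOpen U)
    (hc : ContinuousOn (Function.uncurry f) (Icc a b ×ˢ U))
    (hd : ∀ t ∈ Icc a b, DifferentiableOn ℂ (f t) U) :
    DifferentiableOn ℂ (fun x => ∫ t in a..b, f t x) U := by
  intro x hx
  obtain ⟨R, hR, hRU⟩ := exists_closedBall_two_mul_subset hU hx
  have hcomp : IsCompact (Icc a b ×ˢ closedBall x (2 * R)) :=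
    isCompact_Icc.prod (isCompact_closedBall _ _)
  have hcK := hc.mono (prod_mono_right (s := Icc a b) hRU)
  obtain ⟨M, hM⟩ := hcomp.exists_bound_of_continuousOn hcK
  have huc := hcomp.uniformContinuousOn_of_continuous hcK
  have hsub : ∀ y ∈ ball x R, ball y R ⊆ closedBall x (2 * R) := fun y hy z hz => by
    rw [mem_ball] at hy hz
    rw [mem_closedBall]
    linarith [dist_triangle z y x]
  have hsl : ∀ y ∈ U, ContinuousOn (fun t => f t y) (Icc a b) := fun y hy =>
    hc.comp (f := fun t => (t, y)) (by fun_prop) fun t ht => ⟨ht, hy⟩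
  have hballU : ball x R ⊆ U := fun y hy => hRU (hsub x (mem_ball_self hR) hy)
  have hder : ContinuousOn (fun t => fderiv ℂ (f t) x) (Icc a b) := by
    rw [Metric.continuousOn_iff]
    intro t₀ ht₀ ε hε
    -- Slices that are ε R / 4 apart on the ball have derivatives at most ε / 2 apart, by Cauchy's
    -- estimate for their difference.
    obtain ⟨δ, hδ, H⟩ := Metric.uniformContinuousOn_iff.1 huc (ε * R / 4) (by positivity)
    refine ⟨δ, hδ, fun t ht htd => ?_⟩
    have hxd : ∀ s ∈ Icc a b, DifferentiableAt ℂ (f s) x := fun s hs =>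
      (hd s hs).differentiableAt (hU.mem_nhds hx)
    rw [dist_eq_norm, ← fderiv_sub (hxd t ht) (hxd t₀ ht₀)]
    have := norm_fderiv_le_of_norm_le (f := f t - f t₀) (C := ε * R / 4) hR
      (((hd t ht).sub (hd t₀ ht₀)).mono hballU) (fun y hy => ?_)
    · have h2 : 2 * (ε * R / 4) / R = ε / 2 := by field_simp; norm_num
      rw [h2] at this
      linarith
    · have hy' := hsub x (mem_ball_self hR) hy
      have := H (t, y) ⟨ht, hy'⟩ (t₀, y) ⟨ht₀, hy'⟩ (by simpa [Prod.dist_eq, hδ] using htd)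
      rw [dist_eq_norm] at this
      exact this.le
  have hI : uIoc a b ⊆ Icc a b := by rw [uIoc_of_le hab]; exact Ioc_subset_Icc_self
  have hmem : ∀ᵐ t ∂(volume : Measure ℝ), t ∈ uIoc a b → t ∈ Icc a b := ae_of_all _ fun t h => hI h
  refine (intervalIntegral.hasFDerivAt_integral_of_dominated_of_fderiv_le
    (F := fun x t => f t x) (F' := fun y t => fderiv ℂ (f t) y) (s := ball x R)
    (bound := fun _ => 2 * M / R) (ball_mem_nhds x hR) ?_ ?_ ?_ ?_ ?_ ?_).differentiableAt
    |>.differentiableWithinAt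
  · filter_upwards [ball_mem_nhds x hR] with y hy
    exact ((hsl y (hballU hy)).mono hI).aestronglyMeasurable measurableSet_uIoc
  · exact ((hsl x hx).mono (by rw [uIcc_of_le hab])).intervalIntegrable
  · exact (hder.mono hI).aestronglyMeasurable measurableSet_uIoc
  · filter_upwards [hmem] with t ht htI y hy
    exact norm_fderiv_le_of_norm_le hR ((hd t (ht htI)).mono ((hsub y hy).trans hRU))
      fun z hz => hM (t, z) ⟨ht htI, hsub y hy hz⟩
  · exact intervalIntegrable_const
  · filter_upwards [hmem] with t ht htI y hy
    exact ((hd t (ht htI)).differentiableAt (hU.mem_nhds (hballU hy))).hasFDerivAt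

/-- Cauchy's formula on the complex line through y in the direction v writes the directional
derivative as an integral over a circle of fixed radius, and this integral depends holomorphically
on y. -/
theorem differentiableOn_fderiv_apply [ProperSpace E] [CompleteSpace F] {f : E → F} {U : Set E}
    (hU : IsOpen U) (hf : DifferentiableOn ℂ f U) (v : E) :
    DifferentiableOn ℂ (fun x => fderiv ℂ f x v) U := by
  intro x hx
  obtain ⟨R, hR, hRU⟩ := exists_closedBall_two_mul_subset hU hx
  -- Then ρ‖v‖ ≤ R, also for v = 0, so the circles around the points of the ball of radius R stay in
  -- the closed ball of radius 2R.
  set ρ : ℝ := R / (‖v‖ + 1) with hρ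
  have hρ0 : 0 < ρ := by positivity
  have hsub : ∀ y ∈ ball x R, ∀ z ∈ closedBall (0 : ℂ) ρ, y + z • v ∈ U := by
    intro y hy z hz
    apply hRU
    rw [mem_ball, dist_eq_norm] at hy
    rw [mem_closedBall, dist_zero_right] at hz
    rw [mem_closedBall, dist_eq_norm, add_sub_right_comm]
    have h1 : ‖z • v‖ ≤ R := by
      rw [norm_smul]
      calc ‖z‖ * ‖v‖ ≤ ρ * (‖v‖ + 1) := by gcongr; linarith
        _ = R := by rw [hρ]; field_simp
    linarith [norm_add_le (y - x) (z • v)]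
  have key : ∀ y ∈ ball x R, fderiv ℂ f y v =
      (2 * Real.pi * Complex.I : ℂ)⁻¹ • ∫ θ in (0 : ℝ)..2 * Real.pi,
        deriv (circleMap 0 ρ) θ • ((circleMap 0 ρ θ - 0) ^ 2)⁻¹ • f (y + circleMap 0 ρ θ • v) := by
    intro y hy
    have hV : IsOpen {z : ℂ | y + z • v ∈ U} := hU.preimage (by fun_prop)
    have hline : DifferentiableOn ℂ (fun z : ℂ => f (y + z • v)) {z : ℂ | y + z • v ∈ U} :=
      hf.comp (f := fun z : ℂ => y + z • v) (by fun_prop) fun z hz => hz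
    have h := Complex.two_pi_I_inv_smul_circleIntegral_sub_sq_inv_smul_of_differentiable hV
      (fun z hz => hsub y hy z hz) hline (mem_ball_self hρ0)
    rw [circleIntegral] at h
    rw [h]
    have hyU : y ∈ U := by simpa using hsub y hy 0 (by simp [hρ0.le])
    have hl : HasDerivAt (fun z : ℂ => y + z • v) v 0 := by
      simpa using ((hasDerivAt_id (0 : ℂ)).smul_const v).const_add y
    have hfy : HasFDerivAt f (fderiv ℂ f y) (y + (0 : ℂ) • v) := by
      simpa using (hf.differentiableAt (hU.mem_nhds hyU)).hasFDerivAt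
    exact (hfy.comp_hasDerivAt (0 : ℂ) hl).deriv.symm
  have hcirc : ∀ θ, circleMap 0 ρ θ ∈ closedBall (0 : ℂ) ρ := fun θ =>
    circleMap_mem_closedBall _ hρ0.le θ
  have hdi : DifferentiableOn ℂ (fun y => (2 * Real.pi * Complex.I : ℂ)⁻¹ •
      ∫ θ in (0 : ℝ)..2 * Real.pi,
        deriv (circleMap 0 ρ) θ • ((circleMap 0 ρ θ - 0) ^ 2)⁻¹ • f (y + circleMap 0 ρ θ • v))
      (ball x R) := by
    refine DifferentiableOn.const_smul (differentiableOn_intervalIntegral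
      (by positivity) isOpen_ball ?_ ?_) _
    · have h1 : Continuous fun θ : ℝ => deriv (circleMap 0 ρ) θ := by
        simp only [deriv_circleMap]; fun_prop
      have h2 : Continuous fun θ : ℝ => ((circleMap 0 ρ θ - 0) ^ 2)⁻¹ := by
        refine Continuous.inv₀ (by fun_prop) fun θ => ?_
        simp [circleMap, hρ0.ne']
      refine ContinuousOn.smul (h1.comp continuous_fst).continuousOn
        (ContinuousOn.smul (h2.comp continuous_fst).continuousOn ?_)
      refine hf.continuousOn.comp (f := fun p : ℝ × E => p.2 + circleMap 0 ρ p.1 • v)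
        (by fun_prop) fun p hp => hsub _ hp.2 _ (hcirc _)
    · intro θ _
      refine DifferentiableOn.const_smul (DifferentiableOn.const_smul ?_ _) _
      exact hf.comp (f := fun y => y + circleMap 0 ρ θ • v) (by fun_prop)
        fun y hy => hsub y hy _ (hcirc θ)
  exact ((hdi.congr key).differentiableAt (ball_mem_nhds x hR)).differentiableWithinAt

/-- Finite dimension reduces the regularity of the derivative to that of its values on fixed
vectors, which are again holomorphic. -/
theorem contDiffOn_of_differentiableOn [FiniteDimensional ℂ E] [CompleteSpace F] {f : E → F}
    {U : Set E} (hU : IsOpen U) (hf : DifferentiableOn ℂ f U) (n : ℕ) : ContDiffOn ℂ n f U := by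
  have : ProperSpace E := FiniteDimensional.proper ℂ E
  induction n generalizing f with
  | zero => simpa using hf.continuousOn
  | succ n ih =>
    push_cast
    rw [contDiffOn_succ_iff_fderiv_of_isOpen hU]
    refine ⟨hf, by simp, ?_⟩
    rw [contDiffOn_clm_apply]
    exact fun v => ih (differentiableOn_fderiv_apply hU hf v)

theorem differentiableOn_fderiv [FiniteDimensional ℂ E] [CompleteSpace F] {f : E → F}
    {U : Set E} (hU : IsOpen U) (hf : DifferentiableOn ℂ f U) :
    DifferentiableOn ℂ (fderiv ℂ f) U :=
  ((contDiffOn_succ_iff_fderiv_of_isOpen (n := 1) hU).1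
    (contDiffOn_of_differentiableOn hU hf 2)).2.2.differentiableOn (by norm_num)

theorem fderiv_fderiv_symm [FiniteDimensional ℂ E] [CompleteSpace F] {f : E → F}
    {U : Set E} (hU : IsOpen U) (hf : DifferentiableOn ℂ f U) {x : E} (hx : x ∈ U) (v w : E) :
    fderiv ℂ (fderiv ℂ f) x v w = fderiv ℂ (fderiv ℂ f) x w v := by
  refine second_derivative_symmetric_of_eventually (𝕜 := ℂ) (f := f) (f' := fderiv ℂ f) ?_
    ((differentiableOn_fderiv hU hf).differentiableAt (hU.mem_nhds hx)).hasFDerivAt v w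
  filter_upwards [hU.mem_nhds hx] with y hy
  exact (hf.differentiableAt (hU.mem_nhds hy)).hasFDerivAt

/-- The identity theorem. -/
theorem eqOn_zero_of_eventuallyEq_zero {f : E → F} [CompleteSpace F] {U : Set E} (hU : IsOpen U)
    (hc : IsPreconnected U) (hf : DifferentiableOn ℂ f U) {x₀ : E} (hx₀ : x₀ ∈ U)
    (h0 : f =ᶠ[𝓝 x₀] 0) : EqOn f 0 U := by
  set A : Set E := {x | f =ᶠ[𝓝 x] 0} with hA
  have hAo : IsOpen A := isOpen_setOfPred_eventually_nhds
  have hcl : closure A ∩ U ⊆ A := by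
    rintro x ⟨hxA, hxU⟩
    obtain ⟨R, hR, hRU⟩ := Metric.isOpen_iff.1 hU x hxU
    obtain ⟨y, hyA, hyx⟩ := Metric.mem_closure_iff.1 hxA R hR
    filter_upwards [ball_mem_nhds x hR] with z hz
    -- The one-variable identity theorem is applied on the line from y, near which f vanishes, to z;
    -- the parameters mapped into the ball form a convex, hence connected, set.
    set ℓ : ℂ → E := fun c => y + c • (z - y) with hℓ
    have hℓc : Continuous ℓ := by rw [hℓ]; fun_prop
    have hVo : IsOpen (ℓ ⁻¹' ball x R) := isOpen_ball.preimage hℓc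
    have hVc : IsPreconnected (ℓ ⁻¹' ball x R) := by
      refine Convex.isPreconnected ?_
      intro c hc d hd a b ha hb hab
      have h := convex_ball x R hc hd ha hb hab
      have he : a • ℓ c + b • ℓ d = ℓ (a • c + b • d) := by
        simp only [hℓ, smul_add, add_smul]
        rw [smul_assoc, smul_assoc, add_add_add_comm, ← add_smul, hab, one_smul]
      rwa [he] at h
    have hdl : DifferentiableOn ℂ (f ∘ ℓ) (ℓ ⁻¹' ball x R) :=
      hf.comp (f := ℓ) (by rw [hℓ]; fun_prop) fun c hc => hRU hc
    have h0' : f ∘ ℓ =ᶠ[𝓝 0] 0 := by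
      have : Tendsto ℓ (𝓝 0) (𝓝 y) := by simpa [hℓ] using hℓc.tendsto 0
      exact this.eventually hyA
    have hmem0 : (0 : ℂ) ∈ ℓ ⁻¹' ball x R := by
      simp only [hℓ, mem_preimage, zero_smul, add_zero, mem_ball]; rwa [dist_comm]
    have := (hdl.analyticOnNhd hVo).eqOn_zero_of_preconnected_of_eventuallyEq_zero hVc hmem0 h0'
      (x := 1) (by simpa [hℓ] using hz)
    simpa [hℓ] using this
  have hne : (U ∩ A).Nonempty := ⟨x₀, hx₀, h0⟩
  have hsub := hc.subset_of_closure_inter_subset hAo hne hcl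
  exact fun x hx => (hsub hx).self_of_nhds

/-- Uniqueness for linear ordinary differential equations, starting from zero. -/
theorem eq_zero_of_linear_ode {y : ℝ → F} {B : ℝ → F →L[ℂ] F} (hB : ContinuousOn B (Icc 0 1))
    (hy : ∀ s ∈ Icc (0 : ℝ) 1, HasDerivAt y (B s (y s)) s) (h0 : y 0 = 0) : y 1 = 0 := by
  obtain ⟨C, hC⟩ := isCompact_Icc.exists_bound_of_continuousOn hB
  refine eq_zero_of_abs_deriv_le_mul_abs_self_of_eq_zero_right (K := C) (f' := fun s => B s (y s))
    (fun s hs => (hy s hs).continuousAt.continuousWithinAt)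
    (fun s hs => (hy s (Ico_subset_Icc_self hs)).hasDerivWithinAt) h0 (fun s hs => ?_) 1 (by simp)
  exact (B s).le_of_opNorm_le (hC s (Ico_subset_Icc_self hs)) _

end Holomorphic
end

section
open Set Metric Filter Topology MeasureTheory

/-! ### The Poincaré lemma and the Frobenius theorem for linear holomorphic systems. -/

section Frobenius

variable {E F : Type*} [NormedAddCommGroup E] [NormedSpace ℂ E] [NormedAddCommGroup F]
  [NormedSpace ℂ F]

theorem hasDerivAt_comp_ray {f : E → F} {f' : E →L[ℂ] F} {x : E} {s : ℝ}
    (hf : HasFDerivAt f f' (s • x)) : HasDerivAt (fun s : ℝ => f (s • x)) (f' x) s := by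
  have h : HasDerivAt (fun s : ℝ => s • x) x s := by
    simpa using (hasDerivAt_id s).smul_const x
  exact (hf.restrictScalars ℝ).comp_hasDerivAt s h

/-- The Poincaré lemma for closed holomorphic `1`-forms. -/
theorem exists_primitive_of_fderiv_symm {U : Set E} (hU : IsOpen U)
    (hconv : Convex ℝ U) [CompleteSpace F] {Φ : E → E →L[ℂ] F} (hΦ : DifferentiableOn ℂ Φ U)
    (hs : ∀ x ∈ U, ∀ u v, fderiv ℂ Φ x u v = fderiv ℂ Φ x v u) :
    ∃ f : E → F, ∀ x ∈ U, HasFDerivAt f (Φ x) x := by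
  have hR : ∀ x ∈ U, HasFDerivAt Φ ((fderiv ℂ Φ x).restrictScalars ℝ) x := fun x hx =>
    (hΦ.differentiableAt (hU.mem_nhds hx)).hasFDerivAt.restrictScalars ℝ
  refine hconv.exists_forall_hasFDerivAt_of_fderiv_symmetric hU
    (fun x hx => (hR x hx).differentiableAt.differentiableWithinAt) fun x hx u v => ?_
  rw [(hR x hx).fderiv]
  exact hs x hx u v

/-- The terms of the radial Picard series for `f'(x) v = Θ(x)(v) f(x)`, `f(0) = f₀`. -/
def picardTerm (Θ : E → E →L[ℂ] F →L[ℂ] F) (f₀ : F) : ℕ → E → F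
  | 0 => fun _ => f₀
  | n + 1 => fun x => ∫ s in (0 : ℝ)..1, Θ (s • x) x (picardTerm Θ f₀ n (s • x))

variable {Θ : E → E →L[ℂ] F →L[ℂ] F} {f₀ : F}

theorem smul_mem_ball_zero {R : ℝ} {x : E} (hx : x ∈ ball (0 : E) R) {s : ℝ}
    (hs : s ∈ Icc (0 : ℝ) 1) : s • x ∈ ball (0 : E) R := by
  rw [mem_ball_zero_iff] at hx ⊢
  rw [norm_smul, Real.norm_of_nonneg hs.1]
  nlinarith [norm_nonneg x, hs.2, hs.1]

theorem differentiableOn_picardTerm [ProperSpace E] [CompleteSpace F] {R : ℝ}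
    (hΘ : DifferentiableOn ℂ Θ (ball 0 R)) (n : ℕ) :
    DifferentiableOn ℂ (picardTerm Θ f₀ n) (ball 0 R) := by
  induction n with
  | zero => exact differentiableOn_const _
  | succ n ih =>
    refine differentiableOn_intervalIntegral zero_le_one isOpen_ball ?_ ?_
    · have hm : MapsTo (fun p : ℝ × E => p.1 • p.2) (Icc 0 1 ×ˢ ball (0 : E) R) (ball 0 R) :=
        fun p hp => smul_mem_ball_zero hp.2 hp.1
      have hc : ContinuousOn (fun p : ℝ × E => p.1 • p.2) (Icc 0 1 ×ˢ ball (0 : E) R) := by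
        fun_prop
      exact ((hΘ.continuousOn.comp hc hm).clm_apply continuousOn_snd).clm_apply
        (ih.continuousOn.comp hc hm)
    · intro s hs
      have hm : MapsTo (fun x : E => s • x) (ball (0 : E) R) (ball 0 R) :=
        fun x hx => smul_mem_ball_zero hx hs
      have hd : DifferentiableOn ℂ (fun x : E => s • x) (ball (0 : E) R) := by fun_prop
      exact ((hΘ.comp hd hm).clm_apply differentiableOn_id).clm_apply (ih.comp hd hm)

/-- The bound 1/2 concerns Θ z already applied to the displacement x, so each integration halves the
term and the series is dominated by a geometric one. -/
theorem norm_picardTerm_le {R : ℝ} (hM : ∀ z ∈ ball (0 : E) R, ∀ x ∈ ball (0 : E) R,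
    ‖Θ z x‖ ≤ 1 / 2) (n : ℕ) : ∀ x ∈ ball (0 : E) R, ‖picardTerm Θ f₀ n x‖ ≤ (1 / 2) ^ n * ‖f₀‖ := by
  induction n with
  | zero => intro x _; simp [picardTerm]
  | succ n ih =>
    intro x hx
    have h := intervalIntegral.norm_integral_le_of_norm_le_const (a := 0) (b := 1)
      (f := fun s : ℝ => Θ (s • x) x (picardTerm Θ f₀ n (s • x)))
      (C := (1 / 2) ^ (n + 1) * ‖f₀‖) fun s hs => ?_
    · simpa [picardTerm] using h
    · rw [uIoc_of_le zero_le_one] at hs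
      have hsx := smul_mem_ball_zero hx (Ioc_subset_Icc_self hs)
      calc _ ≤ 1 / 2 * ((1 / 2) ^ n * ‖f₀‖) :=
            (ContinuousLinearMap.le_of_opNorm_le _ (hM _ hsx x hx) _).trans
              (by gcongr; exact ih _ hsx)
        _ = _ := by ring

/-- On the ray through z a rescaling of the parameter turns the integral over [0, 1] into one over
[0, s], and the fundamental theorem of calculus gives the radial derivative. -/
theorem fderiv_picardTerm_succ [ProperSpace E] [CompleteSpace F] {R : ℝ}
    (hΘ : DifferentiableOn ℂ Θ (ball 0 R)) (n : ℕ) {z : E} (hz : z ∈ ball 0 R) :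
    fderiv ℂ (picardTerm Θ f₀ (n + 1)) z z = Θ z z (picardTerm Θ f₀ n z) := by
  set k : ℝ → F := fun s => Θ (s • z) z (picardTerm Θ f₀ n (s • z)) with hk
  set S : Set ℝ := {s | s • z ∈ ball (0 : E) R} with hS
  have hSo : IsOpen S := isOpen_ball.preimage (by fun_prop)
  have hkc : ContinuousOn k S := by
    have hc : ContinuousOn (fun s : ℝ => s • z) S := by fun_prop
    exact ((hΘ.continuousOn.comp hc fun s hs => hs).clm_apply continuousOn_const).clm_apply
      ((differentiableOn_picardTerm hΘ n).continuousOn.comp hc fun s hs => hs)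
  have hIS : Icc (0 : ℝ) 1 ⊆ S := fun s hs => smul_mem_ball_zero hz hs
  have h1 : (1 : ℝ) ∈ S := hIS (by simp)
  have hray : ∀ s : ℝ, picardTerm Θ f₀ (n + 1) (s • z) = ∫ μ in (0 : ℝ)..s, k μ := by
    intro s
    have := intervalIntegral.smul_integral_comp_mul_left (a := 0) (b := 1) (f := k) s
    rw [mul_zero, mul_one, ← intervalIntegral.integral_smul] at this
    rw [← this, picardTerm]
    refine intervalIntegral.integral_congr fun μ _ => ?_
    simp [hk, smul_smul, mul_comm]
  have hd1 : HasDerivAt (fun s : ℝ => picardTerm Θ f₀ (n + 1) (s • z))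
      (fderiv ℂ (picardTerm Θ f₀ (n + 1)) z z) 1 := by
    refine hasDerivAt_comp_ray ?_
    rw [one_smul]
    exact ((differentiableOn_picardTerm hΘ (n + 1)).differentiableAt
      (isOpen_ball.mem_nhds hz)).hasFDerivAt
  have hd2 : HasDerivAt (fun s : ℝ => picardTerm Θ f₀ (n + 1) (s • z)) (k 1) 1 := by
    simp_rw [hray]
    refine intervalIntegral.integral_hasDerivAt_right ?_ ?_ (hkc.continuousAt (hSo.mem_nhds h1))
    · exact (hkc.mono (by rwa [uIcc_of_le zero_le_one])).intervalIntegrable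
    · exact hkc.stronglyMeasurableAtFilter hSo 1 h1
  rw [hd1.unique hd2]
  simp [hk]

/-- The solution is the sum of the Picard series. Its derivatives are controlled by Cauchy's
estimate on balls of radius R, which is why Θ is given on the ball of radius 2R. -/
theorem radial_solution [ProperSpace E] [CompleteSpace F] {R : ℝ} (hR : 0 < R)
    (hΘ : DifferentiableOn ℂ Θ (ball 0 (2 * R)))
    (hM : ∀ z ∈ ball (0 : E) (2 * R), ∀ x ∈ ball (0 : E) (2 * R), ‖Θ z x‖ ≤ 1 / 2) (f₀ : F) :
    ∃ f : E → F, f 0 = f₀ ∧ DifferentiableOn ℂ f (ball 0 R) ∧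
      ∀ z ∈ ball (0 : E) R, fderiv ℂ f z z = Θ z z (f z) := by
  set P := picardTerm Θ f₀ with hP
  have hd := differentiableOn_picardTerm (f₀ := f₀) hΘ
  have hb := norm_picardTerm_le (f₀ := f₀) hM
  have hsub : ∀ x ∈ ball (0 : E) R, ball x R ⊆ ball 0 (2 * R) := fun x hx y hy => by
    rw [mem_ball] at *
    linarith [dist_triangle y x 0]
  have hsub' : ball (0 : E) R ⊆ ball 0 (2 * R) := fun x hx => hsub x hx (mem_ball_self hR)
  have hu : Summable fun n : ℕ => 2 * ((1 / 2 : ℝ) ^ n * ‖f₀‖) / R :=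
    ((summable_geometric_two.mul_right _).mul_left 2).div_const R
  have hu' : Summable fun n : ℕ => (1 / 2 : ℝ) ^ n * ‖f₀‖ := summable_geometric_two.mul_right _
  have hfd : ∀ n, ∀ x ∈ ball (0 : E) R, HasFDerivAt (P n) (fderiv ℂ (P n) x) x := fun n x hx =>
    ((hd n).differentiableAt (isOpen_ball.mem_nhds (hsub' hx))).hasFDerivAt
  have hfb : ∀ n, ∀ x ∈ ball (0 : E) R, ‖fderiv ℂ (P n) x‖ ≤ 2 * ((1 / 2 : ℝ) ^ n * ‖f₀‖) / R :=
    fun n x hx => norm_fderiv_le_of_norm_le hR ((hd n).mono (hsub x hx))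
      fun y hy => hb n y (hsub x hx hy)
  have hPs : ∀ x ∈ ball (0 : E) R, Summable fun n => P n x := fun x hx =>
    Summable.of_norm_bounded hu' fun n => hb n x (hsub' hx)
  have hPs' : ∀ x ∈ ball (0 : E) R, Summable fun n => fderiv ℂ (P n) x := fun x hx =>
    Summable.of_norm_bounded hu fun n => hfb n x hx
  have h0 : (0 : E) ∈ ball (0 : E) R := mem_ball_self hR
  have key : ∀ x ∈ ball (0 : E) R,
      HasFDerivAt (fun y => ∑' n, P n y) (∑' n, fderiv ℂ (P n) x) x := fun x hx =>
    hasFDerivAt_tsum_of_isPreconnected hu isOpen_ball (convex_ball 0 R).isPreconnected hfd hfb h0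
      (hPs 0 h0) hx
  refine ⟨fun y => ∑' n, P n y, ?_, fun x hx => (key x hx).differentiableAt.differentiableWithinAt,
    fun z hz => ?_⟩
  · change ∑' n, P n 0 = f₀
    rw [(hPs 0 h0).tsum_eq_zero_add]
    have : ∀ n, P (n + 1) 0 = 0 := fun n => by simp [hP, picardTerm]
    simp [this]; simp [hP, picardTerm]
  · rw [(key z hz).fderiv]
    have e1 : (∑' n, fderiv ℂ (P n) z) z = ∑' n, fderiv ℂ (P n) z z :=
      (ContinuousLinearMap.apply ℂ F z).map_tsum (hPs' z hz)
    have hs2 : Summable fun n => fderiv ℂ (P n) z z :=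
      (ContinuousLinearMap.apply ℂ F z).summable (hPs' z hz)
    rw [e1, hs2.tsum_eq_zero_add, (Θ z z).map_tsum (hPs z hz)]
    have : fderiv ℂ (P 0) z z = 0 := by
      have : P 0 = fun _ => f₀ := rfl
      rw [this]; simp
    rw [this, zero_add]
    exact tsum_congr fun n => fderiv_picardTerm_succ hΘ n (hsub' hz)

/-- Flatness makes a solution along rays a solution in all directions: the defect w(s) = s (f'(sx)v
− Θ(sx)(v) f(sx)) satisfies w' = Θ(sx)(x) w and w(0) = 0, so it vanishes at s = 1. -/
theorem fderiv_eq_of_radial [FiniteDimensional ℂ E] [CompleteSpace F] {R : ℝ}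
    (hΘ : DifferentiableOn ℂ Θ (ball 0 R))
    (hflat : ∀ x ∈ ball (0 : E) R, ∀ u v (y : F), fderiv ℂ Θ x u v y + Θ x v (Θ x u y) =
      fderiv ℂ Θ x v u y + Θ x u (Θ x v y))
    {f : E → F} (hf : DifferentiableOn ℂ f (ball 0 R))
    (hrad : ∀ z ∈ ball (0 : E) R, fderiv ℂ f z z = Θ z z (f z)) {x : E} (hx : x ∈ ball 0 R)
    (v : E) : fderiv ℂ f x v = Θ x v (f x) := by
  have hnh : ∀ z ∈ ball (0 : E) R, ball (0 : E) R ∈ 𝓝 z := fun z hz => isOpen_ball.mem_nhds hz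
  have hfd : ∀ z ∈ ball (0 : E) R, HasFDerivAt f (fderiv ℂ f z) z := fun z hz =>
    (hf.differentiableAt (hnh z hz)).hasFDerivAt
  have hf2 : ∀ z ∈ ball (0 : E) R, HasFDerivAt (fderiv ℂ f) (fderiv ℂ (fderiv ℂ f) z) z :=
    fun z hz => ((differentiableOn_fderiv isOpen_ball hf).differentiableAt (hnh z hz)).hasFDerivAt
  have hΘd : ∀ z ∈ ball (0 : E) R, HasFDerivAt Θ (fderiv ℂ Θ z) z := fun z hz =>
    (hΘ.differentiableAt (hnh z hz)).hasFDerivAt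
  -- The radial equation differentiated in the direction u; it gives access to the second derivative
  -- f''(z)(u, z).
  have hdiff : ∀ z ∈ ball (0 : E) R, ∀ u, fderiv ℂ (fderiv ℂ f) z u z + fderiv ℂ f z u =
      fderiv ℂ Θ z u z (f z) + Θ z u (f z) + Θ z z (fderiv ℂ f z u) := by
    intro z hz u
    have h1 := (hf2 z hz).clm_apply (hasFDerivAt_id z)
    have h2 := ((hΘd z hz).clm_apply (hasFDerivAt_id z)).clm_apply (hfd z hz)
    have h3 : (fun y => Θ y (id y) (f y)) =ᶠ[𝓝 z] fun y => fderiv ℂ f y (id y) := by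
      filter_upwards [hnh z hz] with y hy
      exact (hrad y hy).symm
    have h4 := congrArg (fun L : E →L[ℂ] F => L u) ((h2.congr_of_eventuallyEq h3.symm).unique h1)
    simp at h4
    rw [add_comm, ← h4]
    abel
  -- The factor s provides the zero initial value and absorbs the extra term f'(z)v of `hdiff`.
  have hw : ∀ s ∈ Icc (0 : ℝ) 1, HasDerivAt
      (fun s : ℝ => s • (fderiv ℂ f (s • x) v - Θ (s • x) v (f (s • x))))
      (Θ (s • x) x (s • (fderiv ℂ f (s • x) v - Θ (s • x) v (f (s • x))))) s := by
    intro s hs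
    have hz := smul_mem_ball_zero hx hs
    set z := s • x with hzs
    have h1 := ((hf2 z hz).clm_apply (hasFDerivAt_const v z)).sub
      (((hΘd z hz).clm_apply (hasFDerivAt_const v z)).clm_apply (hfd z hz))
    have h2 := hasDerivAt_comp_ray h1
    have h3 := (hasDerivAt_id s).smul h2
    refine (show HasDerivAt (fun s : ℝ => s • (fderiv ℂ f (s • x) v - Θ (s • x) v (f (s • x))))
      _ s from h3).congr_deriv ?_
    symm
    rw [one_smul, id]
    have hsz : ∀ L : E →L[ℂ] F, s • L x = L z := fun L => by
      rw [hzs]; exact (L.restrictScalars ℝ).map_smul s x |>.symm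
    rw [hsz]
    have e1 := hdiff z hz v
    have e2 := fderiv_fderiv_symm isOpen_ball hf hz v z
    have e3 := hflat z hz z v (f z)
    have e4 := hrad z hz
    have e5 : ∀ y, Θ z x (s • y) = Θ z z y := fun y => by
      rw [hzs, ← hzs]
      have : Θ z z = s • Θ z x := by
        conv_lhs => rw [hzs]
        exact ((Θ (s • x)).restrictScalars ℝ).map_smul s x
      rw [this]
      exact ((Θ z x).restrictScalars ℝ).map_smul s y
    rw [e5, map_sub]
    rw [e2] at e1
    simp only [_root_.sub_apply, _root_.add_apply,
      ContinuousLinearMap.comp_apply, ContinuousLinearMap.flip_apply, map_zero,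
      _root_.zero_apply, zero_add, e4]
    have e6 : fderiv ℂ (fderiv ℂ f) z z v = fderiv ℂ Θ z v z (f z) + Θ z v (f z) +
      Θ z z (fderiv ℂ f z v) - fderiv ℂ f z v := by rw [← e1]; abel
    have e7 : fderiv ℂ Θ z z v (f z) = fderiv ℂ Θ z v z (f z) + Θ z z (Θ z v (f z)) -
      Θ z v (Θ z z (f z)) := by rw [← e3]; abel
    rw [e6]
    simp [e7]
    abel
  have hB : ContinuousOn (fun s : ℝ => Θ (s • x) x) (Icc 0 1) :=
    (hΘ.continuousOn.comp (f := fun s : ℝ => s • x) (by fun_prop)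
      fun s hs => smul_mem_ball_zero hx hs).clm_apply continuousOn_const
  have := eq_zero_of_linear_ode hB hw (by simp)
  simp only [one_smul] at this
  exact sub_eq_zero.1 this

theorem exists_ball_norm_lt {f : E → F} {U : Set E} (hU : IsOpen U)
    (hf : DifferentiableOn ℂ f U) {x₀ : E} (hx₀ : x₀ ∈ U) :
    ∃ δ > 0, ∀ x ∈ ball x₀ δ, ‖f x‖ < ‖f x₀‖ + 1 :=
  Metric.eventually_nhds_iff_ball.1
    ((hf.continuousOn.norm.continuousAt (hU.mem_nhds hx₀)).eventually
      (gt_mem_nhds (lt_add_one ‖f x₀‖)))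

/-- The holomorphic Frobenius theorem for linear systems `f'(x) v = Θ(x)(v) f(x)`. -/
theorem exists_flat_section [FiniteDimensional ℂ E] [CompleteSpace F] {U : Set E}
    (hU : IsOpen U) (hΘ : DifferentiableOn ℂ Θ U)
    (hflat : ∀ x ∈ U, ∀ u v (y : F), fderiv ℂ Θ x u v y + Θ x v (Θ x u y) =
      fderiv ℂ Θ x v u y + Θ x u (Θ x v y)) {x₀ : E} (hx₀ : x₀ ∈ U) :
    ∃ R : ℝ, 0 < R ∧ ball x₀ R ⊆ U ∧ ∀ f₀ : F, ∃ f : E → F, f x₀ = f₀ ∧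
      DifferentiableOn ℂ f (ball x₀ R) ∧ ∀ x ∈ ball x₀ R, ∀ v, fderiv ℂ f x v = Θ x v (f x) := by
  have : ProperSpace E := FiniteDimensional.proper ℂ E
  set Θ' : E → E →L[ℂ] F →L[ℂ] F := fun x => Θ (x + x₀) with hΘ'
  obtain ⟨ε, hε, hεU⟩ := Metric.isOpen_iff.1 hU x₀ hx₀
  obtain ⟨δ, hδ, hδ'⟩ := exists_ball_norm_lt (F := E →L[ℂ] F →L[ℂ] F) hU hΘ hx₀
  set M : ℝ := ‖Θ x₀‖ + 1 with hMdef
  have hM : 0 < M := by positivity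
  -- With 2R ≤ 1/(2M) the bound M for Θ gives ‖Θ z x‖ ≤ 1/2. The radius does not depend on the
  -- initial value, so several solutions share one ball.
  obtain ⟨R, hR, hR1⟩ : ∃ R : ℝ, 0 < R ∧ 2 * R ≤ min (min ε δ) (1 / (2 * M)) :=
    ⟨min (min ε δ) (1 / (2 * M)) / 2, by positivity, by linarith⟩
  have hRε : 2 * R ≤ ε := hR1.trans ((min_le_left _ _).trans (min_le_left _ _))
  have hRδ : 2 * R ≤ δ := hR1.trans ((min_le_left _ _).trans (min_le_right _ _))
  have hRM : 2 * R ≤ 1 / (2 * M) := hR1.trans (min_le_right _ _)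
  have hadd : ∀ x ∈ ball (0 : E) (2 * R), x + x₀ ∈ ball x₀ (2 * R) := fun x hx => by
    simpa [dist_eq_norm] using hx
  have hadd' : ∀ x ∈ ball (0 : E) (2 * R), x + x₀ ∈ U := fun x hx =>
    hεU (ball_subset_ball hRε (hadd x hx))
  have hshift : DifferentiableOn ℂ (fun x : E => x + x₀) (ball 0 (2 * R)) := by fun_prop
  have hdΘ' : DifferentiableOn ℂ Θ' (ball 0 (2 * R)) :=
    DifferentiableOn.comp (G := E →L[ℂ] F →L[ℂ] F) hΘ hshift hadd'
  have hb : ∀ z ∈ ball (0 : E) (2 * R), ∀ x ∈ ball (0 : E) (2 * R), ‖Θ' z x‖ ≤ 1 / 2 := by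
    intro z hz x hx
    have h1 : ‖Θ' z‖ ≤ M := by
      exact (hδ' _ (ball_subset_ball hRδ (hadd z hz))).le
    rw [mem_ball_zero_iff] at hx
    calc ‖Θ' z x‖ ≤ M * ‖x‖ := ContinuousLinearMap.le_of_opNorm_le _ h1 _
      _ ≤ M * (1 / (2 * M)) := by gcongr; linarith
      _ = 1 / 2 := by field_simp
  have hRR : ball (0 : E) R ⊆ ball 0 (2 * R) := ball_subset_ball (by linarith)
  refine ⟨R, hR, (ball_subset_ball (by linarith)).trans hεU, fun f₀ => ?_⟩
  obtain ⟨f, hf0, hfd, hfr⟩ := radial_solution hR hdΘ' hb f₀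
  have hflat' : ∀ x ∈ ball (0 : E) R, ∀ u v (y : F), fderiv ℂ Θ' x u v y + Θ' x v (Θ' x u y) =
      fderiv ℂ Θ' x v u y + Θ' x u (Θ' x v y) := fun x hx u v y => by
    have := hflat (x + x₀) (hadd' x (hRR hx)) u v y
    have e : fderiv ℂ Θ' x = fderiv ℂ Θ (x + x₀) :=
      fderiv_comp_add_right (𝕜 := ℂ) (F := E →L[ℂ] F →L[ℂ] F) (f := Θ) (x := x) x₀
    rw [e]
    exact this
  have hsub : ∀ x ∈ ball x₀ R, x - x₀ ∈ ball (0 : E) R := fun x hx => by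
    simpa [dist_eq_norm] using hx
  refine ⟨fun x => f (x - x₀), by simpa using hf0,
    hfd.comp (f := fun x => x - x₀) (by fun_prop) hsub, fun x hx v => ?_⟩
  have := fderiv_eq_of_radial (hdΘ'.mono hRR) hflat' hfd hfr (hsub x hx) v
  have e : fderiv ℂ (fun x => f (x - x₀)) x = fderiv ℂ f (x - x₀) := by
    simpa only [sub_eq_add_neg] using fderiv_comp_add_right (f := f) (x := x) (-x₀)
  rw [e, this]
  simp [hΘ']

end Frobenius
end

section
variable {r : ℕ}
open Set Metric Filter Topology

/-! ### Partial derivatives -/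

theorem hasFDerivAt_sum_smul {E G ι : Type*} [NormedAddCommGroup E] [NormedSpace ℂ E]
    [NormedAddCommGroup G] [NormedSpace ℂ G] [Fintype ι] {U : Set E} (hU : IsOpen U)
    {c : ι → E → ℂ} (hc : ∀ a, DifferentiableOn ℂ (c a) U) (T : ι → G) {x : E} (hx : x ∈ U) :
    HasFDerivAt (fun x => ∑ a, c a x • T a) (∑ a, (fderiv ℂ (c a) x).smulRight (T a)) x :=
  HasFDerivAt.fun_sum fun a _ =>
    (((hc a).differentiableAt (hU.mem_nhds hx)).hasFDerivAt).smul_const (T a)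

section PartialDerivatives

variable {f g : (Fin r → ℂ) → ℂ} {t : Fin r → ℂ} {U : Set (Fin r → ℂ)}

theorem eq_sum_single (v : Fin r → ℂ) : v = ∑ i, v i • (Pi.single i 1 : Fin r → ℂ) := by
  ext j
  simp [Finset.sum_apply, Pi.single_apply]

theorem fderiv_apply_eq_sum_pd (f : (Fin r → ℂ) → ℂ) (t v : Fin r → ℂ) :
    fderiv ℂ f t v = ∑ i, v i * pd i f t := by
  conv_lhs => rw [eq_sum_single v, map_sum]
  simp [pd]

theorem pd_congr (h : f =ᶠ[𝓝 t] g) (i : Fin r) : pd i f t = pd i g t := by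
  rw [pd, pd, h.fderiv_eq]

theorem pd_congr_of_eqOn (hU : IsOpen U) (h : EqOn f g U) (ht : t ∈ U) (i : Fin r) :
    pd i f t = pd i g t :=
  pd_congr (h.eventuallyEq_of_mem (hU.mem_nhds ht)) i

theorem pd_const (c : ℂ) (i : Fin r) : pd i (fun _ => c) t = 0 := by
  simp [pd]

theorem pd_add (hf : DifferentiableAt ℂ f t) (hg : DifferentiableAt ℂ g t) (i : Fin r) :
    pd i (fun x => f x + g x) t = pd i f t + pd i g t := by
  rw [pd, fderiv_fun_add hf hg]; rfl

theorem pd_sub (hf : DifferentiableAt ℂ f t) (hg : DifferentiableAt ℂ g t) (i : Fin r) :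
    pd i (fun x => f x - g x) t = pd i f t - pd i g t := by
  rw [pd, fderiv_fun_sub hf hg]; rfl

theorem pd_mul (hf : DifferentiableAt ℂ f t) (hg : DifferentiableAt ℂ g t) (i : Fin r) :
    pd i (fun x => f x * g x) t = pd i f t * g t + f t * pd i g t := by
  rw [pd, fderiv_fun_mul hf hg]
  simp [pd]; ring

theorem pd_sum {ι : Type*} (s : Finset ι) {f : ι → (Fin r → ℂ) → ℂ}
    (hf : ∀ a ∈ s, DifferentiableAt ℂ (f a) t) (i : Fin r) :
    pd i (fun x => ∑ a ∈ s, f a x) t = ∑ a ∈ s, pd i (f a) t := by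
  rw [pd, fderiv_fun_sum hf]
  simp [pd]

theorem pd_coord (i j : Fin r) : pd i (fun x => x j) t = if j = i then 1 else 0 := by
  have : HasFDerivAt (fun x : Fin r → ℂ => x j) (ContinuousLinearMap.proj j : (Fin r → ℂ) →L[ℂ] ℂ) t :=
    hasFDerivAt_apply j t
  rw [pd, this.fderiv]
  simp [Pi.single_apply]

theorem differentiableOn_pd (hU : IsOpen U) (hf : DifferentiableOn ℂ f U) (i : Fin r) :
    DifferentiableOn ℂ (pd i f) U :=
  differentiableOn_fderiv_apply hU hf _

theorem pd_comm (hU : IsOpen U) (hf : DifferentiableOn ℂ f U) (ht : t ∈ U) (i j : Fin r) :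
    pd i (pd j f) t = pd j (pd i f) t := by
  have hd := (differentiableOn_fderiv hU hf).differentiableAt (hU.mem_nhds ht)
  have h : ∀ i j : Fin r, pd i (pd j f) t =
      fderiv ℂ (fderiv ℂ f) t (Pi.single i 1) (Pi.single j 1) := by
    intro i j
    have := (hd.hasFDerivAt.clm_apply (hasFDerivAt_const (Pi.single j 1 : Fin r → ℂ) t)).fderiv
    change fderiv ℂ (fun x => fderiv ℂ f x (Pi.single j 1)) t (Pi.single i 1) = _
    rw [this]
    simp
  rw [h, h, fderiv_fderiv_symm hU hf ht]

/-- The Poincaré lemma in coordinates. -/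
theorem exists_primitive_of_pd_symm (hU : IsOpen U) (hconv : Convex ℝ U)
    {F : Fin r → (Fin r → ℂ) → ℂ} (hF : ∀ j, DifferentiableOn ℂ (F j) U)
    (hs : ∀ x ∈ U, ∀ i j, pd i (F j) x = pd j (F i) x) (x₀ : Fin r → ℂ) (c : ℂ) :
    ∃ g : (Fin r → ℂ) → ℂ, g x₀ = c ∧ DifferentiableOn ℂ g U ∧ ∀ x ∈ U, ∀ j, pd j g x = F j x := by
  set Φ : (Fin r → ℂ) → (Fin r → ℂ) →L[ℂ] ℂ := fun x =>
    ∑ j, F j x • (ContinuousLinearMap.proj j : (Fin r → ℂ) →L[ℂ] ℂ) with hΦ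
  have hΦd : ∀ x ∈ U, HasFDerivAt Φ (∑ j, (fderiv ℂ (F j) x).smulRight
      (ContinuousLinearMap.proj j : (Fin r → ℂ) →L[ℂ] ℂ)) x := fun x hx =>
    hasFDerivAt_sum_smul (G := (Fin r → ℂ) →L[ℂ] ℂ) hU hF _ hx
  obtain ⟨g, hg⟩ := exists_primitive_of_fderiv_symm hU hconv (Φ := Φ)
    (fun x hx => (hΦd x hx).differentiableAt.differentiableWithinAt) (by
      intro x hx u v
      rw [(hΦd x hx).fderiv]
      simp only [_root_.sum_apply, ContinuousLinearMap.smulRight_apply,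
        _root_.smul_apply, ContinuousLinearMap.proj_apply, smul_eq_mul,
        fderiv_apply_eq_sum_pd, Finset.sum_mul]
      rw [Finset.sum_comm]
      refine Finset.sum_congr rfl fun i _ => Finset.sum_congr rfl fun j _ => ?_
      rw [hs x hx i j]; ring)
  refine ⟨fun x => g x + (c - g x₀), by simp, fun x hx =>
    ((hg x hx).add_const _).differentiableAt.differentiableWithinAt, fun x hx j => ?_⟩
  rw [pd, ((hg x hx).add_const _).fderiv]
  simp [hΦ, Pi.single_apply]

/-- Uniqueness for linear systems of partial differential equations, starting from zero. -/
theorem eq_zero_of_linear_system {ι : Type*} [Fintype ι] (hU : IsOpen U) (hconv : Convex ℝ U)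
    {y : ι → (Fin r → ℂ) → ℂ} {M : Fin r → (Fin r → ℂ) → Matrix ι ι ℂ}
    (hy : ∀ a, DifferentiableOn ℂ (y a) U) (hM : ∀ i a b, ContinuousOn (fun x => M i x a b) U)
    (h : ∀ x ∈ U, ∀ i a, pd i (y a) x = ∑ b, y b x * M i x b a) {x₀ : Fin r → ℂ} (hx₀ : x₀ ∈ U)
    (h0 : ∀ a, y a x₀ = 0) {x : Fin r → ℂ} (hx : x ∈ U) (a : ι) : y a x = 0 := by
  set p : ℝ → Fin r → ℂ := fun s => x₀ + s • (x - x₀) with hp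
  have hpU : ∀ s ∈ Icc (0 : ℝ) 1, p s ∈ U := fun s hs => hconv.add_smul_sub_mem hx₀ hx hs
  have hpc : Continuous p := by rw [hp]; fun_prop
  -- The system restricted to the segment from x₀ to x, where uniqueness for ordinary differential
  -- equations applies.
  set B : ℝ → (ι → ℂ) →L[ℂ] (ι → ℂ) := fun s => ContinuousLinearMap.pi fun a =>
    ∑ b, (∑ i, (x i - x₀ i) * M i (p s) b a) •
      (ContinuousLinearMap.proj b : (ι → ℂ) →L[ℂ] ℂ) with hB
  have hBc : ContinuousOn B (Icc 0 1) := by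
    have hMc : ∀ i a b, ContinuousOn (fun s => M i (p s) a b) (Icc 0 1) := fun i a b =>
      (hM i a b).comp hpc.continuousOn hpU
    rw [hB]
    refine continuousOn_clm_apply.2 fun y => continuousOn_pi.2 fun a => ?_
    simp only [ContinuousLinearMap.coe_pi', _root_.sum_apply, _root_.smul_apply,
      ContinuousLinearMap.proj_apply, smul_eq_mul]
    exact continuousOn_finsetSum _ fun b _ => ContinuousOn.mul
        (continuousOn_finsetSum _ fun i _ => continuousOn_const.mul (hMc i b a)) continuousOn_const
  have hd : ∀ s ∈ Icc (0 : ℝ) 1, HasDerivAt (fun s a => y a (p s)) (B s fun a => y a (p s)) s := by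
    intro s hs
    rw [hasDerivAt_pi]
    intro a
    have h1 : HasDerivAt p (x - x₀) s := by
      have h0 := ((hasDerivAt_id s).smul_const (x - x₀)).const_add x₀
      rw [one_smul] at h0
      exact h0
    have h2 := (((hy a).differentiableAt (hU.mem_nhds (hpU s hs))).hasFDerivAt.restrictScalars
      ℝ).comp_hasDerivAt s h1
    refine h2.congr_deriv ?_
    rw [ContinuousLinearMap.coe_restrictScalars', fderiv_apply_eq_sum_pd]
    simp only [h _ (hpU s hs), Finset.mul_sum, hB, ContinuousLinearMap.coe_pi',
      _root_.sum_apply, _root_.smul_apply, ContinuousLinearMap.proj_apply,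
      smul_eq_mul, Finset.sum_mul, Pi.sub_apply]
    rw [Finset.sum_comm]
    exact Finset.sum_congr rfl fun b _ => Finset.sum_congr rfl fun i _ => by ring
  have := eq_zero_of_linear_ode hBc hd (by ext a; simp [hp, h0])
  simpa [hp] using congrFun this a

end PartialDerivatives

/-! ### Holomorphic matrix functions -/

section Matrices

variable {n : ℕ} {M N : (Fin r → ℂ) → Matrix (Fin n) (Fin n) ℂ} {t : Fin r → ℂ}
  {U : Set (Fin r → ℂ)}

theorem HolMatOn.mono (hM : HolMatOn M U) {V : Set (Fin r → ℂ)} (h : V ⊆ U) : HolMatOn M V :=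
  fun k j => (hM k j).mono h

theorem HolMatOn.mul (hM : HolMatOn M U) (hN : HolMatOn N U) : HolMatOn (fun x => M x * N x) U := by
  intro k j
  simp only [Matrix.mul_apply]
  exact DifferentiableOn.fun_sum fun a _ => (hM k a).mul (hN a j)

theorem HolMatOn.sum_smul {ι : Type*} [Fintype ι] {c : ι → (Fin r → ℂ) → ℂ}
    {M : ι → (Fin r → ℂ) → Matrix (Fin n) (Fin n) ℂ} (hc : ∀ a, DifferentiableOn ℂ (c a) U)
    (hM : ∀ a, HolMatOn (M a) U) : HolMatOn (fun x => ∑ a, c a x • M a x) U := by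
  intro k j
  simp only [Matrix.sum_apply, Matrix.smul_apply, smul_eq_mul]
  exact DifferentiableOn.fun_sum fun a _ => (hc a).mul (hM a k j)

theorem HolMatOn.comp {n r' : ℕ} {M : (Fin r → ℂ) → Matrix (Fin n) (Fin n) ℂ}
    {V : Set (Fin r' → ℂ)} (hM : HolMatOn M U) {p : (Fin r' → ℂ) → Fin r → ℂ}
    (hp : DifferentiableOn ℂ p V) (h : MapsTo p V U) : HolMatOn (fun x => M (p x)) V :=
  fun k j => (hM k j).comp hp h

theorem differentiableOn_finset_prod {ι : Type*} {s : Finset ι} {f : ι → (Fin r → ℂ) → ℂ}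
    (hf : ∀ a, DifferentiableOn ℂ (f a) U) : DifferentiableOn ℂ (fun x => ∏ a ∈ s, f a x) U := by
  classical
  induction s using Finset.induction_on with
  | empty => simp
  | insert a s ha ih => simp only [Finset.prod_insert ha]; exact (hf a).mul ih

theorem HolMatOn.det (hM : HolMatOn M U) : DifferentiableOn ℂ (fun x => (M x).det) U := by
  simp only [Matrix.det_apply]
  exact DifferentiableOn.fun_sum fun σ _ =>
    (differentiableOn_finset_prod fun i => hM (σ i) i).const_smul (Equiv.Perm.sign σ)

theorem HolMatOn.inv (hM : HolMatOn M U) (hdet : ∀ x ∈ U, (M x).det ≠ 0) :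
    HolMatOn (fun x => (M x)⁻¹) U := by
  intro k j
  simp only [Matrix.inv_def, Matrix.smul_apply, smul_eq_mul, Ring.inverse_eq_inv',
    Matrix.adjugate_apply]
  refine (hM.det.inv hdet).mul (HolMatOn.det fun a b => ?_)
  by_cases h : a = j
  · subst h; simp only [Matrix.updateRow_self]; exact differentiableOn_const _
  · simp only [Matrix.updateRow_ne h]; exact hM a b

theorem HolMatOn.matPd (hU : IsOpen U) (hM : HolMatOn M U) (i : Fin r) : HolMatOn (matPd i M) U :=
  fun k j => differentiableOn_pd hU (hM k j) i

theorem matPd_congr_of_eqOn (hU : IsOpen U) (h : EqOn M N U) (ht : t ∈ U) (i : Fin r) :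
    matPd i M t = matPd i N t := by
  ext k j
  exact pd_congr_of_eqOn hU (fun x hx => by simp [h hx]) ht i

theorem matPd_const (A : Matrix (Fin n) (Fin n) ℂ) (i : Fin r) : matPd i (fun _ => A) t = 0 := by
  ext k j
  exact pd_const _ i

theorem matPd_mul (hU : IsOpen U) (hM : HolMatOn M U) (hN : HolMatOn N U) (ht : t ∈ U)
    (i : Fin r) : matPd i (fun x => M x * N x) t = matPd i M t * N t + M t * matPd i N t := by
  ext k j
  have hd : ∀ {M : (Fin r → ℂ) → Matrix (Fin n) (Fin n) ℂ}, HolMatOn M U → ∀ k j,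
    DifferentiableAt ℂ (fun x => M x k j) t := fun hM k j =>
      (hM k j).differentiableAt (hU.mem_nhds ht)
  simp only [QDM.matPd, Matrix.mul_apply, Matrix.of_apply, Matrix.add_apply]
  rw [pd_sum (f := fun a x => M x k a * N x a j) _ fun a _ => (hd hM k a).mul (hd hN a j),
    ← Finset.sum_add_distrib]
  exact Finset.sum_congr rfl fun a _ => pd_mul (hd hM k a) (hd hN a j) i

theorem matPd_inv (hU : IsOpen U) (hM : HolMatOn M U) (hdet : ∀ x ∈ U, (M x).det ≠ 0) (ht : t ∈ U)
    (i : Fin r) : matPd i (fun x => (M x)⁻¹) t = -((M t)⁻¹ * matPd i M t * (M t)⁻¹) := by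
  have hu : ∀ x ∈ U, IsUnit (M x).det := fun x hx => (hdet x hx).isUnit
  have h := matPd_mul hU hM (hM.inv hdet) ht i
  rw [matPd_congr_of_eqOn hU (N := fun _ => 1)
    (fun x hx => Matrix.mul_nonsing_inv _ (hu x hx)) ht, matPd_const] at h
  have h2 := congrArg ((M t)⁻¹ * ·) h
  simp only [mul_zero, mul_add, ← mul_assoc, Matrix.nonsing_inv_mul _ (hu t ht), one_mul] at h2
  exact (neg_eq_of_add_eq_zero_right h2.symm).symm

/-- The Frobenius theorem for `dQ = Q θ`, where `dθ + θ ∧ θ = 0`. -/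
theorem exists_flat_frame (hU : IsOpen U) {θ : Fin r → (Fin r → ℂ) → Matrix (Fin n) (Fin n) ℂ}
    (hθ : ∀ i, HolMatOn (θ i) U)
    (hflat : ∀ x ∈ U, ∀ i j, matPd i (θ j) x + θ i x * θ j x = matPd j (θ i) x + θ j x * θ i x)
    {x₀ : Fin r → ℂ} (hx₀ : x₀ ∈ U) :
    ∃ R : ℝ, 0 < R ∧ ball x₀ R ⊆ U ∧ ∃ Q : (Fin r → ℂ) → Matrix (Fin n) (Fin n) ℂ,
      Q x₀ = 1 ∧ HolMatOn Q (ball x₀ R) ∧ ∀ x ∈ ball x₀ R, ∀ i, matPd i Q x = Q x * θ i x := by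
  -- The rows of Q are found separately, with θᵢ acting on row vectors from the right. T (i, k, l)
  -- is the form v ↦ vᵢ with values in the multiples of the operator y ↦ y_k e_l.
  set T : Fin r × Fin n × Fin n → (Fin r → ℂ) →L[ℂ] (Fin n → ℂ) →L[ℂ] (Fin n → ℂ) := fun a =>
    (ContinuousLinearMap.proj a.1 : (Fin r → ℂ) →L[ℂ] ℂ).smulRight
      ((ContinuousLinearMap.proj a.2.1 : (Fin n → ℂ) →L[ℂ] ℂ).smulRight (Pi.single a.2.2 1)) with hT
  set Θ : (Fin r → ℂ) → (Fin r → ℂ) →L[ℂ] (Fin n → ℂ) →L[ℂ] (Fin n → ℂ) := fun x =>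
    ∑ a, θ a.1 x a.2.1 a.2.2 • T a with hΘdef
  have hsum : ∀ (A : Fin r → Matrix (Fin n) (Fin n) ℂ) (v : Fin r → ℂ) (y : Fin n → ℂ) (l : Fin n),
      (∑ a, A a.1 a.2.1 a.2.2 • T a) v y l = ∑ i, v i * ∑ k, y k * A i k l := by
    intro A v y l
    simp only [hT, _root_.sum_apply, _root_.smul_apply, ContinuousLinearMap.smulRight_apply,
      ContinuousLinearMap.proj_apply, Finset.sum_apply, Fintype.sum_prod_type,
      Pi.smul_apply, smul_eq_mul, Pi.single_apply, mul_ite, mul_one, mul_zero, Finset.sum_ite_eq,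
      Finset.mem_univ, if_true, Finset.mul_sum]
    exact Finset.sum_congr rfl fun i _ => Finset.sum_congr rfl fun k _ => by ring
  have hΘd : ∀ x ∈ U, HasFDerivAt Θ
      (∑ a, (fderiv ℂ (fun x => θ a.1 x a.2.1 a.2.2) x).smulRight (T a)) x := fun x hx =>
    hasFDerivAt_sum_smul (G := (Fin r → ℂ) →L[ℂ] (Fin n → ℂ) →L[ℂ] (Fin n → ℂ)) hU
      (fun a => hθ a.1 a.2.1 a.2.2) T hx
  have hΘ' : ∀ x ∈ U, ∀ u, fderiv ℂ Θ x u =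
      ∑ a, (∑ l, u l • matPd l (θ a.1) x) a.2.1 a.2.2 • T a := by
    intro x hx u
    rw [(hΘd x hx).fderiv]
    simp only [_root_.sum_apply, ContinuousLinearMap.smulRight_apply,
      fderiv_apply_eq_sum_pd, Matrix.sum_apply, Matrix.smul_apply, matPd, Matrix.of_apply,
      smul_eq_mul]
  obtain ⟨R, hR, hRU, H⟩ := exists_flat_section hU
    (fun x hx => (hΘd x hx).differentiableAt.differentiableWithinAt) (Θ := Θ) (by
      intro x hx u v y
      have hcomp : ∀ u v : Fin r → ℂ, fderiv ℂ Θ x u v y + Θ x v (Θ x u y) =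
          fun l => ∑ i, ∑ m, v i * u m * ∑ k, y k * (matPd m (θ i) x + θ m x * θ i x) k l := by
        intro u v
        ext l
        have h1 : fderiv ℂ Θ x u v y l =
            ∑ i, v i * ∑ k, y k * (∑ m, u m • matPd m (θ i) x) k l := by
          rw [hΘ' x hx]
          exact hsum (fun i => ∑ m, u m • matPd m (θ i) x) v y l
        have h2 : ∀ k, Θ x u y k = ∑ i, u i * ∑ m, y m * θ i x m k := hsum (fun i => θ i x) u y
        have h3 : Θ x v (Θ x u y) l = ∑ i, v i * ∑ k, Θ x u y k * θ i x k l :=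
          hsum (fun i => θ i x) v _ l
        rw [Pi.add_apply, h1, h3]
        simp only [h2]
        rw [← Finset.sum_add_distrib]
        refine Finset.sum_congr rfl fun i _ => ?_
        simp only [Matrix.sum_apply, Matrix.smul_apply, Matrix.add_apply, Matrix.mul_apply,
          smul_eq_mul, Finset.mul_sum, Finset.sum_mul, mul_add, Finset.sum_add_distrib]
        congr 1
        · rw [Finset.sum_comm]
          exact Finset.sum_congr rfl fun m _ => Finset.sum_congr rfl fun k _ => by ring
        · rw [Finset.sum_comm]
          refine Finset.sum_congr rfl fun m _ => ?_
          rw [Finset.sum_comm]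
          exact Finset.sum_congr rfl fun k _ => Finset.sum_congr rfl fun a _ => by ring
      rw [hcomp, hcomp]
      ext l
      rw [Finset.sum_comm]
      refine Finset.sum_congr rfl fun m _ => Finset.sum_congr rfl fun i _ => ?_
      rw [hflat x hx m i]; ring) hx₀
  choose f hf0 hfd hf using H
  -- Row k is the solution whose initial value is the k-th unit vector.
  refine ⟨R, hR, hRU, fun x => Matrix.of fun k j => f (Pi.single k 1) x j, ?_, ?_, ?_⟩
  · ext k j
    simp [hf0, Pi.single_apply, Matrix.one_apply, eq_comm]
  · exact fun k j => differentiableOn_pi.1 (hfd (Pi.single k 1)) j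
  · intro x hx i
    ext k j
    have hd := (hfd (Pi.single k 1)).differentiableAt (isOpen_ball.mem_nhds hx)
    have h1 := congrFun (hf (Pi.single k 1) x hx (Pi.single i 1)) j
    have h3 : Θ x (Pi.single i 1) (f (Pi.single k 1) x) j = _ :=
      hsum (fun i => θ i x) (Pi.single i 1) (f (Pi.single k 1) x) j
    rw [h3] at h1
    have h2 : pd i (fun x => f (Pi.single k 1) x j) x =
        fderiv ℂ (f (Pi.single k 1)) x (Pi.single i 1) j := by
      rw [pd, (hasFDerivAt_pi'.1 hd.hasFDerivAt j).fderiv]; rfl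
    simp only [matPd, Matrix.of_apply, Matrix.mul_apply]
    rw [h2, h1]
    simp [Pi.single_apply]

end Matrices
end

section
variable {r : ℕ}
open Set Metric Filter Topology

/-! ### Density of the complement of the coordinate hyperplanes, and division by coordinates. -/

section HolomorphicTools

variable {f : (Fin r → ℂ) → ℂ} {U : Set (Fin r → ℂ)}

/-- The complement of the coordinate hyperplanes is dense. This allows the factors qᵢ, which come
from ∂ᵢ = qᵢ ∂/∂qᵢ, to be cancelled. -/
theorem eqOn_zero_of_coord_ne_zero {F : Type*} [TopologicalSpace F] [T2Space F] [Zero F]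
    {f : (Fin r → ℂ) → F} (hU : IsOpen U) (hf : ContinuousOn f U)
    (h : ∀ q ∈ U, (∀ i, q i ≠ 0) → f q = 0) : ∀ q ∈ U, f q = 0 := by
  have hD : Dense (univ.pi fun _ : Fin r => ({0}ᶜ : Set ℂ)) :=
    dense_pi _ fun i _ => dense_compl_singleton 0
  refine EqOn.of_subset_closure (s := U ∩ univ.pi fun _ : Fin r => ({0}ᶜ : Set ℂ)) (g := fun _ => 0)
    (fun q hq => h q hq.1 fun i => hq.2 i (mem_univ i)) hf continuousOn_const inter_subset_left
    (hD.open_subset_closure_inter hU)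

theorem eqOn_of_mul_coord_eq {f g : (Fin r → ℂ) → ℂ} (hU : IsOpen U) (hf : ContinuousOn f U)
    (hg : ContinuousOn g U) (i j : Fin r) (h : ∀ q ∈ U, q i * q j * f q = q i * q j * g q) :
    ∀ q ∈ U, f q = g q := by
  intro q hq
  refine sub_eq_zero.1 (eqOn_zero_of_coord_ne_zero hU (hf.sub hg) (fun q hq hne => ?_) q hq)
  exact sub_eq_zero.2 (mul_left_cancel₀ (mul_ne_zero (hne i) (hne j)) (h q hq))

theorem norm_update_smul_lt {ρ : ℝ} {x : Fin r → ℂ} (hx : x ∈ ball (0 : Fin r → ℂ) ρ) (j : Fin r)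
    {s : ℝ} (hs : s ∈ Icc (0 : ℝ) 1) :
    Function.update x j (s * x j) ∈ ball (0 : Fin r → ℂ) ρ := by
  rw [mem_ball_zero_iff] at hx ⊢
  refine lt_of_le_of_lt ((pi_norm_le_iff_of_nonneg (norm_nonneg x)).2 fun i => ?_) hx
  by_cases h : i = j
  · subst h
    rw [Function.update_self, norm_mul, Complex.norm_real, Real.norm_of_nonneg hs.1]
    exact (mul_le_of_le_one_left (norm_nonneg _) hs.2).trans (norm_le_pi_norm x i)
  · rw [Function.update_of_ne h]; exact norm_le_pi_norm x i

/-- A holomorphic function on a polydisc which vanishes for `q_j = 0` is divisible by `q_j`. -/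
theorem exists_eq_coord_mul {ρ : ℝ} (hf : DifferentiableOn ℂ f (ball 0 ρ)) (j : Fin r)
    (h0 : ∀ q ∈ ball (0 : Fin r → ℂ) ρ, q j = 0 → f q = 0) :
    ∃ S : (Fin r → ℂ) → ℂ, DifferentiableOn ℂ S (ball 0 ρ) ∧
      ∀ q ∈ ball (0 : Fin r → ℂ) ρ, f q = q j * S q := by
  have hdf := differentiableOn_pd isOpen_ball hf j
  have hm : ∀ s ∈ Icc (0 : ℝ) 1, MapsTo (fun q : Fin r → ℂ => Function.update q j (s * q j))
      (ball 0 ρ) (ball 0 ρ) := fun s hs q hq => norm_update_smul_lt hq j hs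
  -- Hadamard's lemma: f is the integral of its derivative along the segment on which only the
  -- coordinate q_j is scaled up from 0.
  refine ⟨fun q => ∫ s in (0 : ℝ)..1, pd j f (Function.update q j (s * q j)),
    differentiableOn_intervalIntegral zero_le_one isOpen_ball ?_ ?_, fun q hq => ?_⟩
  · refine hdf.continuousOn.comp (f := fun p : ℝ × (Fin r → ℂ) =>
      Function.update p.2 j (p.1 * p.2 j)) ?_ fun p hp => hm p.1 hp.1 hp.2
    refine Continuous.continuousOn (continuous_snd.update j ?_)
    fun_prop
  · intro s hs
    refine hdf.comp (f := fun q : Fin r → ℂ => Function.update q j (s * q j)) ?_ (hm s hs)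
    refine differentiableOn_pi.2 fun i => ?_
    by_cases h : i = j
    · subst h; simp only [Function.update_self]; fun_prop
    · simp only [Function.update_of_ne h]; fun_prop
  · have hd : ∀ s ∈ uIcc (0 : ℝ) 1, HasDerivAt (fun s : ℝ => f (Function.update q j (s * q j)))
        (q j * pd j f (Function.update q j (s * q j))) s := by
      intro s hs
      rw [uIcc_of_le zero_le_one] at hs
      have h1 : HasDerivAt (fun s : ℝ => Function.update q j (s * q j))
          (Pi.single j (q j)) s := by
        rw [hasDerivAt_pi]
        intro i
        by_cases h : i = j
        · subst h
          simpa using (Complex.ofRealCLM.hasDerivAt (x := s)).mul_const (q i)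
        · simpa only [Function.update_of_ne h, Pi.single_eq_of_ne h] using
            hasDerivAt_const (x := s) (c := q i)
      have h2 := ((hf.differentiableAt (isOpen_ball.mem_nhds (hm s hs hq))).hasFDerivAt.restrictScalars
        ℝ).comp_hasDerivAt s h1
      refine h2.congr_deriv ?_
      rw [ContinuousLinearMap.coe_restrictScalars', fderiv_apply_eq_sum_pd]
      simp [Pi.single_apply]
    have hcont : ContinuousOn (fun s : ℝ => q j * pd j f (Function.update q j (s * q j)))
        (uIcc 0 1) := by
      rw [uIcc_of_le zero_le_one]
      refine continuousOn_const.mul (hdf.continuousOn.comp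
        (f := fun s : ℝ => Function.update q j (s * q j)) ?_ fun s hs => hm s hs hq)
      exact (continuous_const.update j (by fun_prop)).continuousOn
    have h3 := intervalIntegral.integral_eq_sub_of_hasDerivAt hd hcont.intervalIntegrable
    have h4 : f (Function.update q j (((0 : ℝ) : ℂ) * q j)) = 0 :=
      h0 _ (hm 0 (by simp) hq) (by simp)
    rw [h4, Complex.ofReal_one, one_mul, Function.update_eq_self, sub_zero,
      intervalIntegral.integral_const_mul] at h3
    exact h3.symm

/-- The sum is s times the derivative of s ↦ f(s q); the factor s can be cancelled on the open
interval. -/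
theorem eq_of_radial_deriv_eq_zero {ρ : ℝ} (hf : DifferentiableOn ℂ f (ball 0 ρ)) {q : Fin r → ℂ}
    (hq : q ∈ ball (0 : Fin r → ℂ) ρ)
    (h : ∀ s ∈ Ioo (0 : ℝ) 1, ∑ i, (s • q) i * pd i f (s • q) = 0) : f q = f 0 := by
  have hmem : ∀ s ∈ Icc (0 : ℝ) 1, s • q ∈ ball (0 : Fin r → ℂ) ρ := fun s hs =>
    smul_mem_ball_zero hq hs
  have hd : ∀ s ∈ Icc (0 : ℝ) 1, HasDerivAt (fun s : ℝ => f (s • q)) (fderiv ℂ f (s • q) q) s :=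
    fun s hs => hasDerivAt_comp_ray
      (hf.differentiableAt (isOpen_ball.mem_nhds (hmem s hs))).hasFDerivAt
  have h2 := intervalIntegral.integral_eq_sub_of_hasDerivAt_of_le (a := 0) (b := 1) zero_le_one
    (fun s hs => (hd s hs).continuousAt.continuousWithinAt) (f' := fun _ => 0) (fun s hs => ?_)
    intervalIntegrable_const
  · simp only [intervalIntegral.integral_zero, one_smul, zero_smul] at h2
    exact sub_eq_zero.1 h2.symm
  · refine (hd s (Ioo_subset_Icc_self hs)).congr_deriv ?_
    have h3 := h s hs
    rw [fderiv_apply_eq_sum_pd]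
    simp only [Pi.smul_apply, smul_mul_assoc, ← Finset.smul_sum] at h3
    exact (smul_eq_zero.1 h3).resolve_left hs.1.ne'

/-! ### Weighted homogeneous functions -/

/-- The path `τ ↦ (e^{-w₁τ} q₁, …, e^{-w_rτ} q_r)`. -/
def weightPath (w : Fin r → ℕ) (q : Fin r → ℂ) (τ : ℝ) : Fin r → ℂ :=
  fun i => Complex.exp (-(w i : ℂ) * τ) * q i

theorem norm_weightPath_le (w : Fin r → ℕ) (q : Fin r → ℂ) {τ : ℝ} (hτ : 0 ≤ τ) :
    ‖weightPath w q τ‖ ≤ ‖q‖ := by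
  refine (pi_norm_le_iff_of_nonneg (norm_nonneg q)).2 fun i => ?_
  rw [weightPath, norm_mul, Complex.norm_exp]
  refine (mul_le_of_le_one_left (norm_nonneg _) ?_).trans (norm_le_pi_norm q i)
  rw [Real.exp_le_one_iff]
  simp only [Complex.mul_re, Complex.neg_re, Complex.natCast_re, Complex.ofReal_re,
    Complex.neg_im, Complex.natCast_im, Complex.ofReal_im]
  have : (0 : ℝ) ≤ w i := by positivity
  nlinarith

/-- Along the flow of the weighted Euler field, run towards 0, f is multiplied by exp(−nτ). The
weights are nonnegative, so the flow stays in the ball for τ ≥ 0. -/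
theorem eq_exp_mul_weightPath {w : Fin r → ℕ} {n : ℤ} {ρ : ℝ}
    (hf : DifferentiableOn ℂ f (ball 0 ρ))
    (hE : ∀ q ∈ ball (0 : Fin r → ℂ) ρ, ∑ i, (w i : ℂ) * (q i * pd i f q) = n * f q)
    {q : Fin r → ℂ} (hq : q ∈ ball (0 : Fin r → ℂ) ρ) {τ : ℝ} (hτ : 0 ≤ τ) :
    f q = Complex.exp (n * τ) * f (weightPath w q τ) := by
  have hmem : ∀ s : ℝ, 0 ≤ s → weightPath w q s ∈ ball (0 : Fin r → ℂ) ρ := fun s hs => by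
    rw [mem_ball_zero_iff] at *
    exact (norm_weightPath_le w q hs).trans_lt hq
  have hd : ∀ s : ℝ, 0 ≤ s →
      HasDerivAt (fun s : ℝ => Complex.exp (n * s) * f (weightPath w q s)) 0 s := by
    intro s hs
    have hlin : ∀ c : ℂ, HasDerivAt (fun s : ℝ => Complex.exp (c * s)) (Complex.exp (c * s) * c) s := by
      intro c
      have : HasDerivAt (fun s : ℝ => c * (s : ℂ)) c s := by
        simpa using (Complex.ofRealCLM.hasDerivAt (x := s)).const_mul c
      exact this.cexp
    have h1 : HasDerivAt (weightPath w q) (fun i => -(w i : ℂ) * weightPath w q s i) s := by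
      rw [hasDerivAt_pi]
      intro i
      refine ((hlin (-(w i : ℂ))).mul_const (q i)).congr_deriv ?_
      simp only [weightPath]; ring
    have h2 := ((hf.differentiableAt (isOpen_ball.mem_nhds (hmem s hs))).hasFDerivAt.restrictScalars
        ℝ).comp_hasDerivAt s h1
    refine ((hlin n).mul h2).congr_deriv ?_
    rw [ContinuousLinearMap.coe_restrictScalars', fderiv_apply_eq_sum_pd]
    have h3 := hE _ (hmem s hs)
    have h4 : ∑ i, -(w i : ℂ) * weightPath w q s i * pd i f (weightPath w q s) =
        -(n * f (weightPath w q s)) := by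
      rw [← h3, ← Finset.sum_neg_distrib]
      exact Finset.sum_congr rfl fun i _ => by ring
    rw [h4, Function.comp_apply]; ring
  have h := constant_of_has_deriv_right_zero (a := 0) (b := τ)
    (fun s hs => (hd s hs.1).continuousAt.continuousWithinAt)
    (fun s hs => (hd s hs.1).hasDerivWithinAt) τ ⟨hτ, le_rfl⟩
  simp only [h]
  have : weightPath w q 0 = q := by ext i; simp [weightPath]
  simp [this]

/-- A weighted homogeneous function is zero when it is a combination of weighted homogeneous
functions of larger degree. -/
theorem eq_zero_of_eq_sum_mul_of_lt {V : Set (Fin r → ℂ)} (hV : IsOpen V) (h0 : 0 ∈ V)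
    (hconn : IsPreconnected V) {w : Fin r → ℕ} {n m : ℤ} (hnm : n < m)
    {ι : Type*} [Fintype ι] {f : (Fin r → ℂ) → ℂ} {c g : ι → (Fin r → ℂ) → ℂ}
    (hf : DifferentiableOn ℂ f V) (hc : ∀ a, ContinuousOn (c a) V)
    (hg : ∀ a, DifferentiableOn ℂ (g a) V)
    (hEf : ∀ q ∈ V, ∑ i, (w i : ℂ) * (q i * pd i f q) = n * f q)
    (hEg : ∀ a, ∀ q ∈ V, ∑ i, (w i : ℂ) * (q i * pd i (g a) q) = m * g a q)
    (hsum : ∀ q ∈ V, f q = ∑ a, c a q * g a q) : ∀ q ∈ V, f q = 0 := by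
  obtain ⟨ρ, hρ, hρV⟩ := exists_closedBall_two_mul_subset hV h0
  have hsub : ball (0 : Fin r → ℂ) (2 * ρ) ⊆ V := ball_subset_closedBall.trans hρV
  have hz : ∀ q ∈ ball (0 : Fin r → ℂ) (2 * ρ), f q = 0 := by
    intro q hq
    have hb : ∀ a, ∃ C, ∀ x ∈ closedBall (0 : Fin r → ℂ) (2 * ρ), ‖c a x‖ ≤ C := fun a =>
      (isCompact_closedBall _ _).exists_bound_of_continuousOn ((hc a).mono hρV)
    choose C hC using hb
    have hle : ∀ τ : ℝ, 0 ≤ τ → ‖f q‖ ≤ Real.exp ((n - m : ℝ) * τ) * ∑ a, C a * ‖g a q‖ := by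
      intro τ hτ
      have hmem : weightPath w q τ ∈ ball (0 : Fin r → ℂ) (2 * ρ) := by
        rw [mem_ball_zero_iff] at *
        exact (norm_weightPath_le w q hτ).trans_lt hq
      -- Under the flow f scales with exponent n and every g a with exponent m. What remains is the
      -- factor exp((n − m)τ), which tends to 0 while the coefficients c stay bounded on the closed
      -- ball.
      have e1 : f q = ∑ a, c a (weightPath w q τ) * (Complex.exp ((n - m : ℂ) * τ) * g a q) := by
        rw [eq_exp_mul_weightPath (hf.mono hsub) (fun q hq => hEf q (hsub hq)) hq hτ,
          hsum _ (hsub hmem), Finset.mul_sum]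
        refine Finset.sum_congr rfl fun a _ => ?_
        rw [eq_exp_mul_weightPath ((hg a).mono hsub) (fun q hq => hEg a q (hsub hq)) hq hτ,
          show Complex.exp (n * τ) = Complex.exp ((n - m : ℂ) * τ) * Complex.exp (m * τ) by
            rw [← Complex.exp_add]; ring_nf]
        ring
      have hexp : ‖Complex.exp ((n - m : ℂ) * τ)‖ = Real.exp ((n - m : ℝ) * τ) := by
        rw [Complex.norm_exp]; simp
      rw [e1, Finset.mul_sum]
      refine (norm_sum_le _ _).trans (Finset.sum_le_sum fun a _ => ?_)
      rw [norm_mul, norm_mul, hexp, ← mul_assoc, mul_comm ‖c a _‖, mul_assoc]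
      gcongr
      exact hC a _ (ball_subset_closedBall hmem)
    have hlim : Tendsto (fun τ : ℝ => Real.exp ((n - m : ℝ) * τ) * ∑ a, C a * ‖g a q‖) atTop
        (𝓝 (0 * ∑ a, C a * ‖g a q‖)) := by
      refine Tendsto.mul_const _ (Real.tendsto_exp_atBot.comp ?_)
      refine Tendsto.const_mul_atTop_of_neg ?_ tendsto_id
      have : (n : ℝ) < m := by exact_mod_cast hnm
      linarith
    rw [zero_mul] at hlim
    have := ge_of_tendsto hlim (b := ‖f q‖) (by
      filter_upwards [eventually_ge_atTop 0] with τ hτ using hle τ hτ)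
    exact norm_le_zero_iff.1 this
  have hev : f =ᶠ[𝓝 0] 0 := by
    filter_upwards [ball_mem_nhds (0 : Fin r → ℂ) (by positivity : 0 < 2 * ρ)] with q hq
    exact hz q hq
  exact eqOn_zero_of_eventuallyEq_zero hV hconn hf h0 hev

end HolomorphicTools

/-! ### The chain rule for q = exp t, and inverse function theorems. -/

section ChangeOfVariables

variable {t : Fin r → ℂ} {U : Set (Fin r → ℂ)}

theorem differentiable_expMap : Differentiable ℂ (expMap : (Fin r → ℂ) → Fin r → ℂ) := by
  refine differentiable_pi.2 fun i => ?_
  exact Complex.differentiable_exp.comp (by fun_prop)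

theorem pd_comp {f : (Fin r → ℂ) → ℂ} {φ : (Fin r → ℂ) → Fin r → ℂ}
    (hf : DifferentiableAt ℂ f (φ t)) (hφ : DifferentiableAt ℂ φ t) (i : Fin r) :
    pd i (fun x => f (φ x)) t = ∑ l, pd l f (φ t) * jac φ t l i := by
  have h := (hf.hasFDerivAt.comp t hφ.hasFDerivAt).fderiv
  change fderiv ℂ (f ∘ φ) t (Pi.single i 1) = _
  rw [h, ContinuousLinearMap.comp_apply, fderiv_apply_eq_sum_pd]
  refine Finset.sum_congr rfl fun l _ => ?_
  rw [mul_comm]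
  congr 1
  simp only [jac, Matrix.of_apply, pd]
  rw [(hasFDerivAt_pi'.1 hφ.hasFDerivAt l).fderiv]
  rfl

theorem jac_expMap (t : Fin r → ℂ) : jac expMap t = Matrix.diagonal (expMap t) := by
  ext j i
  have h : HasFDerivAt (fun x : Fin r → ℂ => Complex.exp (x j)) (Complex.exp (t j) •
      (ContinuousLinearMap.proj j : (Fin r → ℂ) →L[ℂ] ℂ)) t := (hasFDerivAt_apply j t).cexp
  change fderiv ℂ (fun x : Fin r → ℂ => Complex.exp (x j)) t (Pi.single i 1) = _
  rw [h.fderiv, Matrix.diagonal_apply]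
  simp [Pi.single_apply, expMap]

theorem pd_comp_expMap {f : (Fin r → ℂ) → ℂ} (hf : DifferentiableAt ℂ f (expMap t)) (i : Fin r) :
    pd i (fun x => f (expMap x)) t = expMap t i * pd i f (expMap t) := by
  rw [pd_comp hf (differentiable_expMap t), jac_expMap]
  simp [Matrix.diagonal_apply, mul_comm]

theorem matPd_comp_expMap {n : ℕ} {M : (Fin r → ℂ) → Matrix (Fin n) (Fin n) ℂ} (hU : IsOpen U)
    (hM : HolMatOn M U) (ht : expMap t ∈ U) (i : Fin r) :
    matPd i (fun x => M (expMap x)) t = expMap t i • matPd i M (expMap t) := by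
  ext k j
  exact pd_comp_expMap ((hM k j).differentiableAt (hU.mem_nhds ht)) i

theorem exists_hasFDerivAt_equiv {φ : (Fin r → ℂ) → Fin r → ℂ} (hφ : DifferentiableAt ℂ φ t)
    (hdet : (jac φ t).det ≠ 0) :
    ∃ L : (Fin r → ℂ) ≃L[ℂ] (Fin r → ℂ), HasFDerivAt φ (L : (Fin r → ℂ) →L[ℂ] (Fin r → ℂ)) t := by
  have hu : IsUnit (jac φ t).det := hdet.isUnit
  refine ⟨(Matrix.toLin'OfInv (Matrix.nonsing_inv_mul _ hu)
    (Matrix.mul_nonsing_inv _ hu)).toContinuousLinearEquiv, ?_⟩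
  convert hφ.hasFDerivAt using 1
  ext v j
  have h1 : fderiv ℂ φ t v j = fderiv ℂ (fun x => φ x j) t v := by
    rw [(hasFDerivAt_pi'.1 hφ.hasFDerivAt j).fderiv]; rfl
  rw [h1, fderiv_apply_eq_sum_pd]
  simp [Matrix.toLin'OfInv, Matrix.mulVec, dotProduct, jac, mul_comm]

theorem differentiableOn_symm {φ : OpenPartialHomeomorph (Fin r → ℂ) (Fin r → ℂ)}
    (hφ : DifferentiableOn ℂ φ φ.source) (hdet : ∀ t ∈ φ.source, (jac φ t).det ≠ 0) :
    DifferentiableOn ℂ φ.symm φ.target := by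
  intro τ hτ
  have hs := φ.map_target hτ
  obtain ⟨L, hL⟩ := exists_hasFDerivAt_equiv (hφ.differentiableAt (φ.open_source.mem_nhds hs))
    (hdet _ hs)
  exact (φ.hasFDerivAt_symm hτ hL).differentiableAt.differentiableWithinAt

/-- The inverse function theorem for holomorphic maps. -/
theorem exists_openPartialHomeomorph {φ : (Fin r → ℂ) → Fin r → ℂ} (hU : IsOpen U)
    (hφ : DifferentiableOn ℂ φ U) (ht : t ∈ U) (hdet : (jac φ t).det ≠ 0) :
    ∃ Φ : OpenPartialHomeomorph (Fin r → ℂ) (Fin r → ℂ), t ∈ Φ.source ∧ Φ.source ⊆ U ∧ ⇑Φ = φ := by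
  obtain ⟨L, hL⟩ := exists_hasFDerivAt_equiv (hφ.differentiableAt (hU.mem_nhds ht)) hdet
  have hc : ContDiffAt ℂ 1 φ t :=
    (contDiffOn_of_differentiableOn hU hφ 1).contDiffAt (hU.mem_nhds ht)
  refine ⟨(hc.toOpenPartialHomeomorph φ hL one_ne_zero).restrOpen U hU, ?_, ?_, ?_⟩
  · rw [OpenPartialHomeomorph.restrOpen_source]
    exact ⟨hc.mem_toOpenPartialHomeomorph_source hL one_ne_zero, ht⟩
  · rw [OpenPartialHomeomorph.restrOpen_source]
    exact inter_subset_right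
  · rfl

/-- A map `t ↦ t + ε(t)`, where `ε` has small derivative, on a convex open set. -/
theorem exists_openPartialHomeomorph_of_norm_fderiv_le {D : Set (Fin r → ℂ)} (hD : IsOpen D)
    (hconv : Convex ℝ D) {ε : (Fin r → ℂ) → Fin r → ℂ} (hε : DifferentiableOn ℂ ε D)
    (hb : ∀ t ∈ D, ‖fderiv ℂ ε t‖ ≤ 1 / 2) :
    ∃ Φ : OpenPartialHomeomorph (Fin r → ℂ) (Fin r → ℂ), Φ.source = D ∧ ∀ t, Φ t = t + ε t := by
  have ha : ApproximatesLinearOn (fun t => t + ε t)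
      (ContinuousLinearEquiv.refl ℂ (Fin r → ℂ) : (Fin r → ℂ) →L[ℂ] (Fin r → ℂ)) D (1 / 2) := by
    intro x hx y hy
    have h := hconv.norm_image_sub_le_of_norm_fderiv_le (𝕜 := ℂ) (f := ε)
      (fun t ht => hε.differentiableAt (hD.mem_nhds ht)) hb hy hx
    have e : x + ε x - (y + ε y) - (x - y) = ε x - ε y := by abel
    simpa [e] using h
  -- For r = 0 the identity has norm 0, so this case has to be separated.
  have hc : Subsingleton (Fin r → ℂ) ∨ (1 / 2 : NNReal) <
      ‖((ContinuousLinearEquiv.refl ℂ (Fin r → ℂ)).symm : (Fin r → ℂ) →L[ℂ] (Fin r → ℂ))‖₊⁻¹ := by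
    rcases subsingleton_or_nontrivial (Fin r → ℂ) with h | h
    · exact Or.inl h
    · right
      have : ‖((ContinuousLinearEquiv.refl ℂ (Fin r → ℂ)).symm :
          (Fin r → ℂ) →L[ℂ] (Fin r → ℂ))‖₊ = 1 := by
        rw [← NNReal.coe_inj]
        exact ContinuousLinearMap.norm_id
      rw [this, inv_one]
      exact NNReal.half_lt_self one_ne_zero
  exact ⟨ha.toOpenPartialHomeomorph _ _ hc hD, rfl, fun t => rfl⟩

end ChangeOfVariables
end

section
variable {r : ℕ}

/-! ### The differential algebra K of holomorphic functions. -/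

namespace CoeffAlgebra

variable (K : CoeffAlgebra r)

/-- The holomorphic function on `V` given by an element of `K`, extended by zero. -/
def fn (f : K.Elem) : (Fin r → ℂ) → ℂ := zeroExt (K.toFun f)

variable {K}

theorem fn_eq_eval (f : K.Elem) (q : K.V) : K.fn f q.1 = K.eval q f := zeroExt_apply _ q

theorem isOpen_V : IsOpen (K.V : Set (Fin r → ℂ)) := K.V.isOpen

theorem differentiableOn_fn (f : K.Elem) : DifferentiableOn ℂ (K.fn f) K.V :=
  K.holo _ (K.toFun_mem f)

theorem differentiableAt_fn (f : K.Elem) {q : Fin r → ℂ} (hq : q ∈ K.V) :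
    DifferentiableAt ℂ (K.fn f) q :=
  (differentiableOn_fn f).differentiableAt (isOpen_V.mem_nhds hq)

theorem ext_fn {f g : K.Elem} (h : ∀ q ∈ K.V, K.fn f q = K.fn g q) : f = g := by
  apply K.toFun_injective
  funext q
  have := h q.1 q.2
  rwa [fn_eq_eval, fn_eq_eval] at this

theorem fn_mul (f g : K.Elem) {q : Fin r → ℂ} (hq : q ∈ K.V) :
    K.fn (f * g) q = K.fn f q * K.fn g q := by
  simp only [fn_eq_eval _ ⟨q, hq⟩, map_mul]

theorem fn_add (f g : K.Elem) {q : Fin r → ℂ} (hq : q ∈ K.V) :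
    K.fn (f + g) q = K.fn f q + K.fn g q := by
  simp only [fn_eq_eval _ ⟨q, hq⟩, map_add]

theorem fn_zero {q : Fin r → ℂ} (hq : q ∈ K.V) : K.fn 0 q = 0 := by
  simp only [fn_eq_eval _ ⟨q, hq⟩, map_zero]

theorem fn_sum {ι : Type*} (s : Finset ι) (f : ι → K.Elem) {q : Fin r → ℂ} (hq : q ∈ K.V) :
    K.fn (∑ a ∈ s, f a) q = ∑ a ∈ s, K.fn (f a) q := by
  simp only [fn_eq_eval _ ⟨q, hq⟩, map_sum]

theorem eval_algebraMap (q : K.V) (c : ℂ) : K.eval q (algebraMap ℂ K.Elem c) = c := by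
  change K.toFun (algebraMap ℂ K.Elem c) q = c
  rw [AlgHom.commutes]; rfl

theorem eval_smul (q : K.V) (c : ℂ) (f : K.Elem) : K.eval q (c • f) = c * K.eval q f := by
  rw [Algebra.smul_def, map_mul, eval_algebraMap]

theorem fn_smul (c : ℂ) (f : K.Elem) {q : Fin r → ℂ} (hq : q ∈ K.V) :
    K.fn (c • f) q = c * K.fn f q := by
  simp only [fn_eq_eval _ ⟨q, hq⟩, eval_smul]

theorem fn_del (i : Fin r) (f : K.Elem) {q : Fin r → ℂ} (hq : q ∈ K.V) :
    K.fn (K.del i f) q = q i * pd i (K.fn f) q :=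
  zeroExt_apply (logDerivFun i (K.toFun f)) ⟨q, hq⟩

theorem del_mul (i : Fin r) (f g : K.Elem) :
    K.del i (f * g) = K.del i f * g + f * K.del i g := by
  refine ext_fn fun q hq => ?_
  rw [fn_del i _ hq, fn_add _ _ hq, fn_mul _ _ hq, fn_mul _ _ hq, fn_del i _ hq, fn_del i _ hq,
    pd_congr_of_eqOn isOpen_V (g := fun q => K.fn f q * K.fn g q)
      (fun x hx => fn_mul f g hx) hq i,
    pd_mul (differentiableAt_fn f hq) (differentiableAt_fn g hq)]
  ring

theorem del_one (i : Fin r) : K.del i 1 = 0 := by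
  have h := del_mul i (1 : K.Elem) 1
  rw [one_mul, one_mul, mul_one] at h
  exact (left_eq_add.1 h)

theorem del_comm (i j : Fin r) (f : K.Elem) : K.del i (K.del j f) = K.del j (K.del i f) := by
  refine ext_fn fun q hq => ?_
  have h : ∀ i j : Fin r, K.fn (K.del i (K.del j f)) q =
      q i * ((if j = i then 1 else 0) * pd j (K.fn f) q + q j * pd i (pd j (K.fn f)) q) := by
    intro i j
    rw [fn_del i _ hq, pd_congr_of_eqOn isOpen_V (g := fun q => q j * pd j (K.fn f) q)
      (fun x hx => fn_del j f hx) hq i, pd_mul (by fun_prop)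
      ((differentiableOn_pd isOpen_V (differentiableOn_fn f) j).differentiableAt
        (isOpen_V.mem_nhds hq)), pd_coord]
  rw [h, h, pd_comm isOpen_V (differentiableOn_fn f) hq i j]
  by_cases hij : i = j
  · subst hij; rfl
  · rw [if_neg hij, if_neg (Ne.symm hij)]; ring

variable (K) in
/-- The coordinate function `q_j`. -/
def coord (j : Fin r) : K.Elem := K.elemMk _ (K.coord_mem j)

theorem eval_coord (q : K.V) (j : Fin r) : K.eval q (K.coord j) = q.1 j := rfl

theorem fn_coord {q : Fin r → ℂ} (hq : q ∈ K.V) (j : Fin r) : K.fn (K.coord j) q = q j :=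
  fn_eq_eval _ ⟨q, hq⟩

theorem del_coord (i j : Fin r) : K.del i (K.coord j) = if j = i then K.coord j else 0 := by
  refine ext_fn fun q hq => ?_
  rw [fn_del i _ hq, pd_congr_of_eqOn isOpen_V (g := fun q => q j) (fun x hx => fn_coord hx j) hq i,
    pd_coord]
  split_ifs with h
  · subst h; rw [fn_coord hq, mul_one]
  · rw [fn_zero hq, mul_zero]

theorem del_pow (i : Fin r) {f : K.Elem} {a : ℂ} (hf : K.del i f = a • f) (n : ℕ) :
    K.del i (f ^ n) = ((n : ℂ) * a) • f ^ n := by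
  induction n with
  | zero => simp [del_one]
  | succ n ih =>
    rw [pow_succ, del_mul, ih, hf, mul_smul_comm, smul_mul_assoc, ← add_smul]
    push_cast; ring_nf

theorem del_prod_coord (i : Fin r) (n : Fin r → ℕ) (s : Finset (Fin r)) :
    K.del i (∏ j ∈ s, K.coord j ^ n j) =
      (if i ∈ s then (n i : ℂ) else 0) • ∏ j ∈ s, K.coord j ^ n j := by
  induction s using Finset.induction_on with
  | empty => simp [del_one]
  | insert a s ha ih =>
    have h1 : K.del i (K.coord a) = (if a = i then (1 : ℂ) else 0) • K.coord a := by
      rw [del_coord]; split_ifs <;> simp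
    rw [Finset.prod_insert ha, del_mul, del_pow i h1, ih, mul_smul_comm, smul_mul_assoc,
      ← add_smul]
    congr 1
    by_cases h : a = i
    · subst h; simp [ha]
    · have : i ≠ a := Ne.symm h
      simp [h, this]

theorem nontrivial_elem : Nontrivial K.Elem := (K.eval K.origin).domain_nontrivial

/-- An element which vanishes at all points of `V` off the coordinate hyperplanes is zero. -/
theorem eq_zero_of_eval_eq_zero {f : K.Elem}
    (h : ∀ q : K.V, (∀ i, q.1 i ≠ 0) → K.eval q f = 0) : f = 0 := by
  refine ext_fn fun q hq => ?_
  rw [fn_zero hq]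
  refine eqOn_zero_of_coord_ne_zero isOpen_V (differentiableOn_fn f).continuousOn
    (fun q hq hne => ?_) q hq
  rw [fn_eq_eval f ⟨q, hq⟩]
  exact h _ hne

theorem fn_isHomog {w : Fin r → ℕ} {f : K.Elem} {n : ℤ} (h : K.IsHomog w f n) {q : Fin r → ℂ}
    (hq : q ∈ K.V) : ∑ i, (w i : ℂ) * (q i * pd i (K.fn f) q) = n * K.fn f q := by
  have := congrArg (fun f => K.fn f q) h
  simp only [fn_sum _ _ hq, fn_smul _ _ hq, fn_del _ _ hq] at this
  exact this

/-- A weighted homogeneous element of `K` is zero when it is a combination of weighted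
homogeneous elements of larger degree. -/
theorem eq_zero_of_eq_sum_mul {w : Fin r → ℕ} {n m : ℤ} (hnm : n < m) {ι : Type*} (s : Finset ι)
    {f : K.Elem} {c g : ι → K.Elem} (hf : K.IsHomog w f n) (hg : ∀ a, K.IsHomog w (g a) m)
    (hsum : f = ∑ a ∈ s, c a * g a) : f = 0 := by
  refine ext_fn fun q hq => ?_
  rw [fn_zero hq]
  refine eq_zero_of_eq_sum_mul_of_lt (ι := s) (c := fun a => K.fn (c a)) (g := fun a => K.fn (g a))
    isOpen_V K.zero_mem K.connected hnm (differentiableOn_fn f)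
    (fun a => (differentiableOn_fn _).continuousOn) (fun a => differentiableOn_fn _)
    (fun q hq => fn_isHomog hf hq) (fun a q hq => fn_isHomog (hg a) hq) (fun q hq => ?_) q hq
  rw [hsum, fn_sum _ _ hq, Finset.sum_coe_sort s (fun a => K.fn (c a) q * K.fn (g a) q)]
  exact Finset.sum_congr rfl fun a _ => fn_mul _ _ hq

theorem isHomog_one (w : Fin r → ℕ) : K.IsHomog w 1 0 := by
  simp [IsHomog, del_one]

/-- Here f = f · 1 is a multiple of an element of degree 0 > n. -/
theorem eq_zero_of_isHomog_neg {w : Fin r → ℕ} {n : ℤ} (hn : n < 0) {f : K.Elem}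
    (hf : K.IsHomog w f n) : f = 0 :=
  eq_zero_of_eq_sum_mul hn (Finset.univ : Finset Unit) (c := fun _ => f) (g := fun _ => 1) hf
    (fun _ => isHomog_one w) (by simp)

end CoeffAlgebra

open CoeffAlgebra

/-! ### Operators on symbols -/

section Symbols

variable {K : CoeffAlgebra r}

/-- The operator `∂ᵢ` on `K[h]`. -/
def pdel (K : CoeffAlgebra r) (i : Fin r) : K.Elem[X] →ₗ[ℂ] K.Elem[X] :=
  Polynomial.lsum fun k =>
    ((Polynomial.monomial k : K.Elem →ₗ[K.Elem] K.Elem[X]).restrictScalars ℂ) ∘ₗ K.del i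

theorem hdel_apply (i : Fin r) (a : K.Elem[X]) : hdel K i a = Polynomial.X * pdel K i a := rfl

theorem pdel_monomial (i : Fin r) (k : ℕ) (f : K.Elem) :
    pdel K i (Polynomial.monomial k f) = Polynomial.monomial k (K.del i f) := by
  rw [pdel, Polynomial.lsum_apply, Polynomial.sum_monomial_index]
  · rfl
  · simp

theorem coeff_pdel (i : Fin r) (a : K.Elem[X]) (k : ℕ) :
    (pdel K i a).coeff k = K.del i (a.coeff k) := by
  induction a using Polynomial.induction_on' with
  | add p q hp hq => simp only [map_add, Polynomial.coeff_add, hp, hq]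
  | monomial n f =>
    rw [pdel_monomial, Polynomial.coeff_monomial, Polynomial.coeff_monomial]
    split_ifs <;> simp

theorem pdel_mul (i : Fin r) (a b : K.Elem[X]) : pdel K i (a * b) = pdel K i a * b + a * pdel K i b := by
  ext k
  simp only [coeff_pdel, Polynomial.coeff_mul, Polynomial.coeff_add, map_sum, del_mul,
    Finset.sum_add_distrib]

theorem pdel_comm (i j : Fin r) (a : K.Elem[X]) : pdel K i (pdel K j a) = pdel K j (pdel K i a) := by
  ext k
  simp only [coeff_pdel, del_comm i j]

theorem pdel_X (i : Fin r) : pdel K i Polynomial.X = 0 := by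
  ext k
  rw [coeff_pdel, Polynomial.coeff_X]
  split_ifs <;> simp [del_one]

theorem hdel_mul (i : Fin r) (a b : K.Elem[X]) : hdel K i (a * b) = hdel K i a * b + a * hdel K i b := by
  simp only [hdel_apply, pdel_mul]; ring

theorem hdel_comm (i j : Fin r) (a : K.Elem[X]) : hdel K i (hdel K j a) = hdel K j (hdel K i a) := by
  simp only [hdel_apply, pdel_mul, pdel_X, zero_mul, zero_add, pdel_comm i j]

theorem hdel_one (i : Fin r) : hdel K i 1 = 0 := by
  have := hdel_mul i (1 : K.Elem[X]) 1
  rw [one_mul, one_mul, mul_one] at this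
  exact left_eq_add.1 this

theorem eval_zero_hdel (i : Fin r) (a : K.Elem[X]) : (hdel K i a).eval 0 = 0 := by
  rw [hdel_apply]; simp

/-- Application of additive maps to the coefficients of a symbol. -/
def mapCoeff (φ : (Fin r →₀ ℕ) → K.Elem[X] →ₗ[ℂ] K.Elem[X]) (p : Sym K) : Sym K :=
  ∑ m ∈ p.support, MvPolynomial.monomial m (φ m (p.coeff m))

theorem coeff_mapCoeff (φ : (Fin r →₀ ℕ) → K.Elem[X] →ₗ[ℂ] K.Elem[X]) (p : Sym K)
    (m : Fin r →₀ ℕ) : (mapCoeff φ p).coeff m = φ m (p.coeff m) := by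
  classical
  rw [mapCoeff, MvPolynomial.coeff_sum]
  simp only [MvPolynomial.coeff_monomial]
  rw [Finset.sum_ite_eq']
  split_ifs with h
  · rfl
  · rw [MvPolynomial.notMem_support_iff.1 h, map_zero]

theorem mapCoeff_add (φ : (Fin r →₀ ℕ) → K.Elem[X] →ₗ[ℂ] K.Elem[X]) (p q : Sym K) :
    mapCoeff φ (p + q) = mapCoeff φ p + mapCoeff φ q := by
  ext1 m
  simp only [coeff_mapCoeff, MvPolynomial.coeff_add, map_add]

theorem mapCoeff_monomial (φ : (Fin r →₀ ℕ) → K.Elem[X] →ₗ[ℂ] K.Elem[X]) (m : Fin r →₀ ℕ)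
    (a : K.Elem[X]) : mapCoeff φ (MvPolynomial.monomial m a) = MvPolynomial.monomial m (φ m a) := by
  classical
  ext1 n
  rw [coeff_mapCoeff, MvPolynomial.coeff_monomial, MvPolynomial.coeff_monomial]
  split_ifs with h
  · rw [h]
  · rw [map_zero]

/-- The action of `h∂ᵢ` from the left on symbols. -/
def symDel (i : Fin r) (p : Sym K) : Sym K := MvPolynomial.X i * p + mapCoeff (fun _ => hdel K i) p

theorem symDel_add (i : Fin r) (p q : Sym K) : symDel i (p + q) = symDel i p + symDel i q := by
  simp only [symDel, mapCoeff_add, mul_add]; abel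

theorem symDel_monomial (i : Fin r) (m : Fin r →₀ ℕ) (a : K.Elem[X]) :
    symDel i (MvPolynomial.monomial m a) =
      MvPolynomial.monomial (m + Finsupp.single i 1) a + MvPolynomial.monomial m (hdel K i a) := by
  rw [symDel, mapCoeff_monomial, mul_comm, MvPolynomial.X, MvPolynomial.monomial_mul, mul_one]

theorem symDel_zero (i : Fin r) : symDel i (0 : Sym K) = 0 := by
  simp [symDel, mapCoeff]

theorem symDel_sum {ι : Type*} (s : Finset ι) (i : Fin r) (p : ι → Sym K) :
    symDel i (∑ a ∈ s, p a) = ∑ a ∈ s, symDel i (p a) := by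
  classical
  induction s using Finset.induction_on with
  | empty => simp [symDel_zero]
  | insert a s ha ih => rw [Finset.sum_insert ha, Finset.sum_insert ha, symDel_add, ih]

theorem symDel_smul (i : Fin r) (a : K.Elem[X]) (p : Sym K) :
    symDel i (a • p) = a • symDel i p + hdel K i a • p := by
  have h : mapCoeff (fun _ => hdel K i) (a • p) =
      a • mapCoeff (fun _ => hdel K i) p + hdel K i a • p := by
    ext1 m
    simp only [coeff_mapCoeff, MvPolynomial.coeff_smul, MvPolynomial.coeff_add, smul_eq_mul,
      hdel_mul]
    ring
  rw [symDel, h, symDel, smul_add, mul_smul_comm, add_assoc]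

theorem symDel_comm (i j : Fin r) (p : Sym K) : symDel i (symDel j p) = symDel j (symDel i p) := by
  induction p using MvPolynomial.monomial_add_induction_on with
  | C a =>
    rw [← MvPolynomial.monomial_zero']
    simp only [symDel_monomial, symDel_add, hdel_comm i j]
    rw [add_right_comm (0 : Fin r →₀ ℕ)]; abel
  | monomial_add m a p _ _ ih =>
    simp only [symDel_add, symDel_monomial, hdel_comm i j, ih]
    rw [add_right_comm m]; abel

/-! ### Operators and their symbols -/

theorem mul_prod_ofFn_pow {M : Type*} [Monoid M] {r : ℕ} (f : Fin r → M)
    (hf : ∀ i j, Commute (f i) (f j)) (m : Fin r → ℕ) (i : Fin r) :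
    f i * (List.ofFn fun j => f j ^ m j).prod =
      (List.ofFn fun j => f j ^ (m j + if j = i then 1 else 0)).prod := by
  induction r with
  | zero => exact i.elim0
  | succ r ih =>
    simp only [List.ofFn_succ, List.prod_cons]
    refine Fin.cases ?_ (fun i => ?_) i
    · rw [← mul_assoc, ← pow_succ']
      simp
    · rw [← mul_assoc, ((hf i.succ 0).pow_right _).eq, mul_assoc,
        ih (fun j => f j.succ) (fun a b => hf _ _) (fun j => m j.succ) i]
      simp [(Fin.succ_ne_zero i).symm]

theorem commute_hdel (i j : Fin r) : Commute (hdel K i) (hdel K j) := by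
  rw [commute_iff_eq]
  refine LinearMap.ext fun x => ?_
  rw [Module.End.mul_apply, Module.End.mul_apply, hdel_comm]

/-- The operator `(h∂)^m`. -/
def opMon (K : CoeffAlgebra r) (m : Fin r →₀ ℕ) : Module.End ℂ K.Elem[X] :=
  (List.ofFn fun i => hdel K i ^ m i).prod

theorem opMon_add_single (m : Fin r →₀ ℕ) (i : Fin r) :
    opMon K (m + Finsupp.single i 1) = hdel K i * opMon K m := by
  rw [opMon, opMon, mul_prod_ofFn_pow (hdel K) commute_hdel m i]
  simp only [Finsupp.add_apply, Finsupp.single_apply, eq_comm]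

theorem op_monomial (m : Fin r →₀ ℕ) (a : K.Elem[X]) :
    op K (MvPolynomial.monomial m a) = a • opMon K m := by
  have h : MvPolynomial.monomial m a = a • MvPolynomial.basisMonomials (Fin r) K.Elem[X] m := by
    rw [MvPolynomial.coe_basisMonomials, MvPolynomial.smul_monomial, smul_eq_mul, mul_one]
  rw [h, map_smul, op, Module.Basis.constr_basis, opMon]

/-- The Leibniz rule: moving h∂ᵢ past a coefficient a produces the additional coefficient h∂ᵢ(a). -/
theorem op_symDel (i : Fin r) (p : Sym K) : op K (symDel i p) = hdel K i * op K p := by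
  induction p using MvPolynomial.induction_on' with
  | monomial m a =>
    rw [symDel_monomial, map_add, op_monomial, op_monomial, op_monomial, opMon_add_single]
    refine LinearMap.ext fun x => ?_
    rw [LinearMap.add_apply, LinearMap.smul_apply, LinearMap.smul_apply, Module.End.mul_apply,
      Module.End.mul_apply, LinearMap.smul_apply, smul_eq_mul, smul_eq_mul, smul_eq_mul, hdel_mul,
      add_comm]
  | add p q hp hq => rw [symDel_add, map_add, map_add, hp, hq, mul_add]

end Symbols
end

section
variable {r : ℕ}
open CoeffAlgebra

/-! ### Operators are determined by their symbols; the left ideal in terms of symbols. -/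

section LeftIdeal

variable {K : CoeffAlgebra r}

theorem op_apply (p : Sym K) (x : K.Elem[X]) :
    op K p x = ∑ m ∈ p.support, p.coeff m * opMon K m x := by
  conv_lhs => rw [p.as_sum, map_sum]
  rw [LinearMap.sum_apply]
  refine Finset.sum_congr rfl fun m _ => ?_
  rw [op_monomial, LinearMap.smul_apply, smul_eq_mul]

/-- The monomial `q^n` in `K`. -/
def coordMon (K : CoeffAlgebra r) (n : Fin r → ℕ) : K.Elem := ∏ j, K.coord j ^ n j

theorem hdel_monomial_coordMon (i : Fin r) (k : ℕ) (c : ℂ) (n : Fin r → ℕ) :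
    hdel K i (Polynomial.monomial k (c • coordMon K n)) =
      Polynomial.monomial (k + 1) ((n i * c) • coordMon K n) := by
  rw [hdel_apply, pdel_monomial, map_smul, coordMon, del_prod_coord, if_pos (Finset.mem_univ i),
    Polynomial.X_mul_monomial, smul_smul, mul_comm c]

/-- The function q^n is an eigenvector of every h∂ᵢ, with eigenvalue h nᵢ. These functions serve as
test functions which separate the symbols. -/
theorem opMon_coordMon (m : Fin r →₀ ℕ) (n : Fin r → ℕ) :
    opMon K m (Polynomial.C (coordMon K n)) =
      Polynomial.monomial m.degree ((∏ i, (n i : ℂ) ^ m i) • coordMon K n) := by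
  have key : ∀ d (m : Fin r →₀ ℕ), m.degree = d → opMon K m (Polynomial.C (coordMon K n)) =
      Polynomial.monomial m.degree ((∏ i, (n i : ℂ) ^ m i) • coordMon K n) := by
    intro d
    induction d with
    | zero =>
      intro m hm
      have : m = 0 := (Finsupp.degree_eq_zero_iff m).1 hm
      subst this
      simp [opMon]
    | succ d ih =>
      intro m hm
      obtain ⟨i, hi⟩ : ∃ i, m i ≠ 0 := by
        by_contra! h
        have : m = 0 := Finsupp.ext h
        simp [this] at hm
      have hle : Finsupp.single i 1 ≤ m := Finsupp.single_le_iff.2 (Nat.one_le_iff_ne_zero.2 hi)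
      obtain ⟨m', rfl⟩ : ∃ m', m = m' + Finsupp.single i 1 :=
        ⟨m - Finsupp.single i 1, (tsub_add_cancel_of_le hle).symm⟩
      have hd : m'.degree = d := by simpa using hm
      rw [opMon_add_single, Module.End.mul_apply, ih m' hd, hdel_monomial_coordMon]
      have h1 : (m' + Finsupp.single i 1).degree = m'.degree + 1 := by simp
      have h2 : ∏ j, (n j : ℂ) ^ (m' + Finsupp.single i 1 : Fin r →₀ ℕ) j =
          n i * ∏ j, (n j : ℂ) ^ m' j := by
        simp only [Finsupp.add_apply, pow_add, Finset.prod_mul_distrib, Finsupp.single_apply,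
          pow_ite, pow_one, pow_zero]
        simp [mul_comm]
      rw [h1, h2]
  exact key _ m rfl

/-- Apply the operator to all q^n. At a point off the coordinate hyperplanes this gives ∑ a_m(q)
h^|m| n^m = 0 for all n ∈ ℕ^r, so this polynomial in n has zero coefficients; then a_m vanishes on a
dense set. -/
theorem op_injective : Function.Injective (op K) := by
  rw [injective_iff_map_eq_zero]
  intro p hp
  ext1 m
  rw [MvPolynomial.coeff_zero]
  ext k
  rw [Polynomial.coeff_zero]
  refine eq_zero_of_eval_eq_zero fun q hq => ?_
  -- Its value at n is the operator applied to q^n, evaluated at q and divided by q^n; the variable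
  -- X stands for h.
  set P : MvPolynomial (Fin r) ℂ[X] := ∑ m ∈ p.support,
    MvPolynomial.monomial m ((p.coeff m).map (K.eval q) * Polynomial.X ^ m.degree) with hP
  have hP0 : P = 0 := by
    refine MvPolynomial.funext_set (fun _ => Set.range fun n : ℕ => (n : ℂ[X]))
      (fun _ => Set.infinite_range_of_injective Nat.cast_injective) fun x hx => ?_
    have hx' : ∀ i, ∃ n : ℕ, (n : ℂ[X]) = x i := fun i => hx i (Set.mem_univ i)
    choose n hn using hx'
    have h0 : op K p (Polynomial.C (coordMon K n)) = 0 := by rw [hp, LinearMap.zero_apply]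
    have h1 := congrArg (Polynomial.map (K.eval q)) ((op_apply p _).symm.trans h0)
    rw [Polynomial.map_zero, Polynomial.map_sum] at h1
    have hne : (∏ j, (q.1 j) ^ n j : ℂ) ≠ 0 := Finset.prod_ne_zero_iff.2 fun j _ => pow_ne_zero _ (hq j)
    have hne' : Polynomial.C (∏ j, (q.1 j) ^ n j : ℂ) ≠ 0 := Polynomial.C_ne_zero.2 hne
    rw [map_zero, hP, map_sum]
    refine (mul_eq_zero.1 ?_).resolve_right hne'
    rw [Finset.sum_mul]
    refine Eq.trans (Finset.sum_congr rfl fun m _ => ?_) h1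
    rw [Polynomial.map_mul, opMon_coordMon, Polynomial.map_monomial, eval_smul,
      MvPolynomial.eval_monomial, coordMon, map_prod]
    simp only [map_pow]
    rw [← Polynomial.C_mul_X_pow_eq_monomial, map_mul, Finsupp.prod_fintype _ _ (by simp)]
    simp only [← hn, map_prod, map_pow, map_natCast, eval_coord]
    ring
  have h2 : P.coeff m = 0 := by rw [hP0, MvPolynomial.coeff_zero]
  have h3 : P.coeff m = (p.coeff m).map (K.eval q) * Polynomial.X ^ m.degree := by
    classical
    rw [hP, MvPolynomial.coeff_sum]
    simp only [MvPolynomial.coeff_monomial]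
    rw [Finset.sum_ite_eq']
    split_ifs with h
    · rfl
    · rw [MvPolynomial.notMem_support_iff.1 h, Polynomial.map_zero, zero_mul]
  rw [h3] at h2
  have h4 := (mul_eq_zero.1 h2).resolve_right (pow_ne_zero _ Polynomial.X_ne_zero)
  rw [← Polynomial.coeff_map, h4, Polynomial.coeff_zero]

theorem hdel_mem_Dh (i : Fin r) : hdel K i ∈ Dh K := Algebra.subset_adjoin (Or.inr ⟨i, rfl⟩)

variable {u : ℕ} {d : Fin u → Sym K}

theorem symDel_mem_leftIdeal (i : Fin r) {p : Sym K} (hp : p ∈ leftIdeal K d) :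
    symDel i p ∈ leftIdeal K d := by
  change op K (symDel i p) ∈ Submodule.span ↥(Dh K) _
  rw [op_symDel]
  exact Submodule.smul_mem _ (⟨hdel K i, hdel_mem_Dh i⟩ : ↥(Dh K)) hp

theorem gen_mem_leftIdeal (l : Fin u) : d l ∈ leftIdeal K d :=
  Submodule.subset_span (Set.mem_range_self l)

/-- The left ideal is the smallest submodule which contains the generators and is stable under
multiplication by the `h∂ᵢ` from the left. -/
theorem leftIdeal_le {J : Submodule K.Elem[X] (Sym K)} (hd : ∀ l, d l ∈ J)
    (hJ : ∀ i, ∀ p ∈ J, symDel i p ∈ J) : leftIdeal K d ≤ J := by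
  -- The operators with symbol in J form a D^h-submodule, by induction over the generators of D^h.
  -- Injectivity of `op` then leads back to symbols.
  let N : Submodule ↥(Dh K) (Module.End ℂ K.Elem[X]) :=
    { carrier := {T | ∃ p ∈ J, op K p = T}
      add_mem' := by
        rintro _ _ ⟨p, hp, rfl⟩ ⟨p', hp', rfl⟩
        exact ⟨p + p', J.add_mem hp hp', map_add _ _ _⟩
      zero_mem' := ⟨0, J.zero_mem, map_zero _⟩
      smul_mem' := by
        rintro ⟨T, hT⟩ S hS
        change ∃ p ∈ J, op K p = T * S
        induction hT using Algebra.adjoin_induction generalizing S with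
        | mem T hT =>
          obtain ⟨p, hp, rfl⟩ := hS
          rcases hT with ⟨a, rfl⟩ | ⟨i, rfl⟩
          · exact ⟨a • p, J.smul_mem a hp, by rw [map_smul]; rfl⟩
          · exact ⟨symDel i p, hJ i p hp, op_symDel i p⟩
        | algebraMap c =>
          obtain ⟨p, hp, rfl⟩ := hS
          refine ⟨(algebraMap ℂ K.Elem[X] c) • p, J.smul_mem _ hp, ?_⟩
          rw [map_smul, algebraMap_smul, Algebra.smul_def]
        | add T T' _ _ h h' =>
          obtain ⟨p, hp, e⟩ := h hS
          obtain ⟨p', hp', e'⟩ := h' hS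
          exact ⟨p + p', J.add_mem hp hp', by rw [map_add, e, e', add_mul]⟩
        | mul T T' _ _ h h' =>
          obtain ⟨p, hp, e⟩ := h (h' hS)
          exact ⟨p, hp, by rw [e, mul_assoc]⟩ }
  intro p hp
  have hN : Submodule.span ↥(Dh K) (Set.range fun l => op K (d l)) ≤ N := by
    rw [Submodule.span_le]
    rintro _ ⟨l, rfl⟩
    exact ⟨d l, hd l, rfl⟩
  obtain ⟨p', hp', e⟩ := hN hp
  rwa [← op_injective e]

/-! ### The classical limit -/

theorem map_mapCoeff_hdel (i : Fin r) (p : Sym K) :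
    MvPolynomial.map (Polynomial.evalRingHom 0) (mapCoeff (fun _ => hdel K i) p) = 0 := by
  ext1 m
  rw [MvPolynomial.coeff_map, coeff_mapCoeff, Polynomial.coe_evalRingHom, eval_zero_hdel,
    MvPolynomial.coeff_zero]

/-- The derivative term of `symDel` carries a factor h, so at h = 0 left multiplication by h∂ᵢ is
multiplication by bᵢ. Hence the symbols whose limit is in the ideal of relations are stable under
it. -/
theorem map_mem_relIdeal {R : Fin u → MvPolynomial (Fin r) K.Elem}
    (hlim : ∀ l, MvPolynomial.map (Polynomial.evalRingHom 0) (d l) = R l) {p : Sym K}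
    (hp : p ∈ leftIdeal K d) : MvPolynomial.map (Polynomial.evalRingHom 0) p ∈ relIdeal K R := by
  let J : Submodule K.Elem[X] (Sym K) :=
    { carrier := {p | MvPolynomial.map (Polynomial.evalRingHom 0) p ∈ relIdeal K R}
      add_mem' := fun hp hq => by
        simp only [Set.mem_ofPred_eq, map_add] at *
        exact add_mem hp hq
      zero_mem' := by simp
      smul_mem' := fun a p hp => by
        simp only [Set.mem_ofPred_eq, MvPolynomial.smul_eq_C_mul, map_mul] at *
        exact Ideal.mul_mem_left _ _ hp }
  refine leftIdeal_le (J := J) (fun l => ?_) (fun i p hp => ?_) hp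
  · change MvPolynomial.map (Polynomial.evalRingHom (0 : K.Elem)) (d l) ∈ relIdeal K R
    rw [hlim]
    exact Ideal.subset_span (Set.mem_range_self l)
  · change MvPolynomial.map (Polynomial.evalRingHom (0 : K.Elem)) (symDel i p) ∈ relIdeal K R
    rw [symDel, map_add, map_mapCoeff_hdel, add_zero, map_mul]
    exact Ideal.mul_mem_left _ _ hp

/-! ### The Euler operator -/

/-- The Euler operator on `K[h]`, with `h` of degree `2`. -/
def euler (K : CoeffAlgebra r) (w : Fin r → ℕ) : K.Elem[X] →ₗ[ℂ] K.Elem[X] :=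
  ∑ i, (w i : ℂ) • pdel K i + (2 : ℂ) • (LinearMap.mulLeft ℂ (Polynomial.X : K.Elem[X]) ∘ₗ
    (Polynomial.derivative : K.Elem[X] →ₗ[K.Elem] K.Elem[X]).restrictScalars ℂ)

theorem euler_apply (w : Fin r → ℕ) (a : K.Elem[X]) : euler K w a =
    ∑ i, (w i : ℂ) • pdel K i a + (2 : ℂ) • (Polynomial.X * Polynomial.derivative a) := by
  rw [euler, LinearMap.add_apply, LinearMap.sum_apply]
  rfl

theorem coeff_euler (w : Fin r → ℕ) (a : K.Elem[X]) (k : ℕ) :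
    (euler K w a).coeff k = ∑ i, (w i : ℂ) • K.del i (a.coeff k) + (2 * k : ℂ) • a.coeff k := by
  rw [euler_apply, Polynomial.coeff_add, Polynomial.finsetSum_coeff, Polynomial.coeff_smul]
  simp only [Polynomial.coeff_smul, coeff_pdel]
  congr 1
  cases k with
  | zero => simp
  | succ k =>
    rw [Polynomial.coeff_X_mul, Polynomial.coeff_derivative, mul_smul, Nat.cast_smul_eq_nsmul,
      nsmul_eq_mul, mul_comm]
    push_cast; rfl

theorem euler_mul (w : Fin r → ℕ) (a b : K.Elem[X]) :
    euler K w (a * b) = euler K w a * b + a * euler K w b := by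
  simp only [euler_apply, pdel_mul, Polynomial.derivative_mul, smul_add, Finset.sum_add_distrib,
    mul_add, add_mul, Finset.sum_mul, Finset.mul_sum, smul_mul_assoc, mul_smul_comm]
  have e1 : Polynomial.X * (Polynomial.derivative a * b) =
    Polynomial.X * Polynomial.derivative a * b := by ring
  have e2 : Polynomial.X * (a * Polynomial.derivative b) =
    a * (Polynomial.X * Polynomial.derivative b) := by ring
  rw [e1, e2]; abel

/-- The commutator is 2 h∂ᵢ, because ∂ᵢ commutes with the Euler operator and h has degree 2. -/
theorem euler_hdel (w : Fin r → ℕ) (i : Fin r) (a : K.Elem[X]) :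
    euler K w (hdel K i a) = hdel K i (euler K w a) + (2 : ℂ) • hdel K i a := by
  have hX : euler K w Polynomial.X = (2 : ℂ) • Polynomial.X := by
    rw [euler_apply]; simp [pdel_X]
  have hp : euler K w (pdel K i a) = pdel K i (euler K w a) := by
    ext k
    simp only [coeff_euler, coeff_pdel, map_add, map_sum, map_smul, del_comm i]
  rw [hdel_apply, euler_mul, hX, hp, hdel_apply, smul_mul_assoc, add_comm]

/-- The Euler operator on symbols, with `bᵢ` of degree `2`. -/
def symEuler (w : Fin r → ℕ) : Sym K → Sym K :=
  mapCoeff fun m => euler K w + (2 * m.degree : ℂ) • LinearMap.id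

theorem symEuler_add (w : Fin r → ℕ) (p q : Sym K) :
    symEuler w (p + q) = symEuler w p + symEuler w q := mapCoeff_add _ p q

theorem coeff_symEuler (w : Fin r → ℕ) (p : Sym K) (m : Fin r →₀ ℕ) :
    (symEuler w p).coeff m = euler K w (p.coeff m) + (2 * m.degree : ℂ) • p.coeff m :=
  coeff_mapCoeff _ p m

theorem symEuler_monomial (w : Fin r → ℕ) (m : Fin r →₀ ℕ) (a : K.Elem[X]) :
    symEuler w (MvPolynomial.monomial m a) =
      MvPolynomial.monomial m (euler K w a + (2 * m.degree : ℂ) • a) := mapCoeff_monomial _ m a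

theorem symEuler_smul (w : Fin r → ℕ) (a : K.Elem[X]) (p : Sym K) :
    symEuler w (a • p) = euler K w a • p + a • symEuler w p := by
  ext1 m
  rw [coeff_symEuler, MvPolynomial.coeff_smul, MvPolynomial.coeff_add, MvPolynomial.coeff_smul,
    MvPolynomial.coeff_smul, coeff_symEuler, smul_eq_mul, smul_eq_mul, smul_eq_mul, euler_mul,
    mul_add, mul_smul_comm, add_assoc]

theorem symEuler_symDel (w : Fin r → ℕ) (i : Fin r) (p : Sym K) :
    symEuler w (symDel i p) = symDel i (symEuler w p) + (2 : ℂ) • symDel i p := by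
  induction p using MvPolynomial.induction_on' with
  | monomial m a =>
    have h1 : ((m + Finsupp.single i 1).degree : ℂ) = m.degree + 1 := by simp
    rw [symDel_monomial, symEuler_add, symEuler_monomial, symEuler_monomial, h1, euler_hdel,
      symEuler_monomial, symDel_monomial, map_add (hdel K i), map_smul (hdel K i), smul_add,
      MvPolynomial.smul_monomial, MvPolynomial.smul_monomial, mul_add, mul_one, add_smul]
    simp only [map_add]
    abel
  | add p q hp hq => simp only [symDel_add, symEuler_add, hp, hq, smul_add]; abel

/-- Homogeneous generators are eigenvectors of the Euler operator, and its commutators with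
coefficients and with `symDel` do not leave the ideal. This is the only way in which homogeneity of
the operators enters. -/
theorem symEuler_mem_leftIdeal {w : Fin r → ℕ} (hd : ∀ l, IsHomogOp K w (d l)) {p : Sym K}
    (hp : p ∈ leftIdeal K d) : symEuler w p ∈ leftIdeal K d := by
  -- Membership of p itself is part of the condition, since the commutators reproduce multiples of p
  -- and of `symDel i p`.
  let J : Submodule K.Elem[X] (Sym K) :=
    { carrier := {p | p ∈ leftIdeal K d ∧ symEuler w p ∈ leftIdeal K d}
      add_mem' := fun hp hq => ⟨add_mem hp.1 hq.1, by
        rw [symEuler_add]; exact add_mem hp.2 hq.2⟩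
      zero_mem' := ⟨zero_mem _, by
        have : symEuler w (0 : Sym K) = 0 := by simp [symEuler, mapCoeff]
        rw [this]; exact zero_mem _⟩
      smul_mem' := fun a p hp => ⟨Submodule.smul_mem _ a hp.1, by
        rw [symEuler_smul]
        exact add_mem (Submodule.smul_mem _ _ hp.1) (Submodule.smul_mem _ _ hp.2)⟩ }
  refine (leftIdeal_le (J := J) (fun l => ⟨gen_mem_leftIdeal l, ?_⟩) (fun i p hp =>
    ⟨symDel_mem_leftIdeal i hp.1, ?_⟩) hp).2
  · obtain ⟨N, hN⟩ := hd l
    have : symEuler w (d l) = (algebraMap ℂ K.Elem[X] N) • d l := by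
      ext1 m
      rw [coeff_symEuler, MvPolynomial.coeff_smul, smul_eq_mul, ← Algebra.smul_def]
      ext k
      rw [Polynomial.coeff_add, coeff_euler, Polynomial.coeff_smul, Polynomial.coeff_smul]
      have h := hN m k
      rw [IsHomog] at h
      rw [h, ← add_smul, ← add_smul]
      congr 1
      push_cast; ring
    rw [this]
    exact Submodule.smul_mem _ _ (gen_mem_leftIdeal l)
  · rw [symEuler_symDel]
    refine add_mem (symDel_mem_leftIdeal i hp.2) ?_
    have := Submodule.smul_mem _ (algebraMap ℂ K.Elem[X] 2) (symDel_mem_leftIdeal i hp.1)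
    rwa [algebraMap_smul] at this

end LeftIdeal
end

section
variable {r : ℕ}
open CoeffAlgebra

/-! ### The monomial order, division, and the basis of standard monomials. -/

section Grevlex

theorem GrevlexLT.degree_le {m n : Fin r →₀ ℕ} (h : GrevlexLT m n) : m.degree ≤ n.degree := by
  rcases h with h | h
  exacts [h.le, h.1.le]

theorem GrevlexLT.trans {m n p : Fin r →₀ ℕ} (h : GrevlexLT m n) (h' : GrevlexLT n p) :
    GrevlexLT m p := by
  rcases h with h | ⟨h, i, hi, hi'⟩
  · exact Or.inl (h.trans_le h'.degree_le)
  · rcases h' with h' | ⟨h', j, hj, hj'⟩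
    · exact Or.inl (h.trans_lt h')
    · refine Or.inr ⟨h.trans h', ?_⟩
      rcases lt_trichotomy i j with hij | rfl | hij
      · exact ⟨j, by rw [hi' j hij]; exact hj, fun l hl => by rw [hi' l (hij.trans hl), hj' l hl]⟩
      · exact ⟨i, hj.trans hi, fun l hl => by rw [hi' l hl, hj' l hl]⟩
      · exact ⟨i, by rw [← hj' i hij]; exact hi, fun l hl => by rw [hi' l hl, hj' l (hij.trans hl)]⟩

theorem GrevlexLT.irrefl (m : Fin r →₀ ℕ) : ¬ GrevlexLT m m := by
  rintro (h | ⟨-, i, hi, -⟩)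
  exacts [h.false, hi.false]

theorem GrevlexLT.add_right {m n : Fin r →₀ ℕ} (h : GrevlexLT m n) (k : Fin r →₀ ℕ) :
    GrevlexLT (m + k) (n + k) := by
  rcases h with h | ⟨h, i, hi, hi'⟩
  · exact Or.inl (by simpa using h)
  · exact Or.inr ⟨by simpa using h, i, by simpa using hi, fun j hj => by simp [hi' j hj]⟩

theorem grevlexLT_add_single (m : Fin r →₀ ℕ) (i : Fin r) :
    GrevlexLT m (m + Finsupp.single i 1) := Or.inl (by simp)

/-- A predecessor has no larger degree, so every exponent has finitely many predecessors, and their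
number decreases strictly along the order. -/
theorem wellFounded_grevlexLT : WellFounded (GrevlexLT (r := r)) := by
  have hfin : ∀ n : Fin r →₀ ℕ, {m | GrevlexLT m n}.Finite := fun n => by
    refine (Set.finite_Icc (0 : Fin r →₀ ℕ)
      (Finsupp.equivFunOnFinite.symm fun _ => n.degree)).subset fun m hm => ⟨zero_le, fun i => ?_⟩
    exact (Finsupp.le_degree i m).trans (GrevlexLT.degree_le hm)
  refine Subrelation.wf (r := InvImage (· < ·) fun n : Fin r →₀ ℕ => {m | GrevlexLT m n}.ncard)
    (fun {a b} hab => ?_) (InvImage.wf _ wellFounded_lt)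
  refine Set.ncard_lt_ncard ⟨fun m hm => GrevlexLT.trans hm hab, fun h => ?_⟩ (hfin b)
  exact GrevlexLT.irrefl a (h hab)

end Grevlex

section Standard

variable {K : CoeffAlgebra r}

/-- The leading term of `p` is `c b^m`. -/
def HasLead (p : Sym K) (m : Fin r →₀ ℕ) (c : K.Elem[X]) : Prop :=
  p.coeff m = c ∧ ∀ n, n ≠ m → p.coeff n ≠ 0 → GrevlexLT n m

theorem IsLeading.hasLead {p : Sym K} {m : Fin r →₀ ℕ} (h : IsLeading K p m) :
    HasLead p m (p.coeff m) :=
  ⟨rfl, fun n hn hc => h.2 n (MvPolynomial.mem_support_iff.2 hc) hn⟩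

theorem IsLeading.unique {p : Sym K} {m n : Fin r →₀ ℕ} (h : IsLeading K p m)
    (h' : IsLeading K p n) : m = n := by
  by_contra hmn
  exact GrevlexLT.irrefl _ ((h'.2 m h.1 hmn).trans (h.2 n h'.1 (Ne.symm hmn)))

/-- The derivative term lives on exponents already present in p, all of which lie below m + eᵢ. So
the leading coefficient is carried along unchanged. -/
theorem HasLead.symDel {p : Sym K} {m : Fin r →₀ ℕ} {c : K.Elem[X]} (h : HasLead p m c)
    (i : Fin r) : HasLead (symDel i p) (m + Finsupp.single i 1) c := by
  classical
  have hco : ∀ n, (QDM.symDel i p).coeff n =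
      (if i ∈ n.support then p.coeff (n - Finsupp.single i 1) else 0) + hdel K i (p.coeff n) :=
    fun n => by rw [QDM.symDel, MvPolynomial.coeff_add, coeff_mapCoeff, MvPolynomial.coeff_X_mul']
  constructor
  · have h0 : p.coeff (m + Finsupp.single i 1) = 0 := by
      by_contra h0
      refine GrevlexLT.irrefl m ((grevlexLT_add_single m i).trans (h.2 _ (fun h => ?_) h0))
      have := congrArg (fun n : Fin r →₀ ℕ => n i) h
      simp at this
    rw [hco, h0, map_zero, add_zero, if_pos (by simp), add_tsub_cancel_right, h.1]
  · intro n hn hc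
    rw [hco] at hc
    by_cases h1 : p.coeff n = 0
    · rw [h1, map_zero, add_zero] at hc
      have hi : i ∈ n.support := by
        by_contra hi
        exact hc (if_neg hi)
      rw [if_pos hi] at hc
      have hle : Finsupp.single i 1 ≤ n :=
        Finsupp.single_le_iff.2 (Nat.one_le_iff_ne_zero.2 (Finsupp.mem_support_iff.1 hi))
      have hn' := tsub_add_cancel_of_le hle
      rw [← hn']
      refine (h.2 _ (fun h => hn ?_) hc).add_right _
      rw [← hn', h]
    · by_cases hnm : n = m
      · rw [hnm]; exact grevlexLT_add_single m i
      · exact (h.2 n hnm h1).trans (grevlexLT_add_single m i)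

variable {u : ℕ} {d : Fin u → Sym K}

/-- Left multiplication by (h∂)^k, one factor at a time. -/
theorem exists_hasLead_add (k : Fin r →₀ ℕ) : ∀ {p : Sym K} {m : Fin r →₀ ℕ} {c : K.Elem[X]},
    p ∈ leftIdeal K d → HasLead p m c → ∃ p' ∈ leftIdeal K d, HasLead p' (m + k) c := by
  induction k using Finsupp.induction_linear with
  | zero => exact fun hp h => ⟨_, hp, by rwa [add_zero]⟩
  | add k k' ih ih' =>
    intro p m c hp h
    obtain ⟨p', hp', h'⟩ := ih hp h
    obtain ⟨p'', hp'', h''⟩ := ih' hp' h'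
    exact ⟨p'', hp'', by rwa [← add_assoc]⟩
  | single i n =>
    induction n with
    | zero => exact fun hp h => ⟨_, hp, by rwa [Finsupp.single_zero, add_zero]⟩
    | succ n ih =>
      intro p m c hp h
      obtain ⟨p', hp', h'⟩ := ih hp h
      refine ⟨symDel i p', symDel_mem_leftIdeal i hp', ?_⟩
      rw [Finsupp.single_add, ← add_assoc]
      exact h'.symDel i

variable {G : Set (Sym K)} {s : ℕ} {e : Fin (s + 1) → Fin r →₀ ℕ}

theorem clsM_eq_zero_iff {p : Sym K} : clsM K d p = 0 ↔ p ∈ leftIdeal K d :=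
  Submodule.Quotient.mk_eq_zero _

theorem clsM_monomial (n : Fin r →₀ ℕ) (a : K.Elem[X]) :
    clsM K d (MvPolynomial.monomial n a) = a • clsM K d (MvPolynomial.monomial n 1) := by
  rw [clsM, clsM, ← map_smul, MvPolynomial.smul_monomial, smul_eq_mul, mul_one]

theorem exists_lead_of_not_standard (hG : IsGroebner K (leftIdeal K d) G) {n : Fin r →₀ ℕ}
    (hn : n ∉ standardExps K G) : ∃ g ∈ G, ∃ m, IsLeading K g m ∧ IsUnit (g.coeff m) ∧ m ≤ n := by
  simp only [standardExps, Set.mem_ofPred_eq, not_forall, not_not] at hn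
  obtain ⟨g, hg, m, hm, hmn⟩ := hn
  obtain ⟨m', hm', hu⟩ := hG.unit g hg
  obtain rfl := hm.unique hm'
  exact ⟨g, hg, m, hm, hu, hmn⟩

/-- Division: a nonstandard monomial is the leading monomial of a left multiple of some g ∈ G. The
coefficient is a unit, so its class is a combination of classes of smaller monomials. -/
theorem clsM_monomial_mem_span (hG : IsGroebner K (leftIdeal K d) G)
    (he' : Set.range e = standardExps K G) (n : Fin r →₀ ℕ) :
    clsM K d (MvPolynomial.monomial n 1) ∈ Submodule.span K.Elem[X]
      (Set.range fun j => clsM K d (MvPolynomial.monomial (e j) 1)) := by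
  induction n using wellFounded_grevlexLT.induction with
  | _ n ih =>
  by_cases hn : n ∈ standardExps K G
  · rw [← he'] at hn
    obtain ⟨j, rfl⟩ := hn
    exact Submodule.subset_span ⟨j, rfl⟩
  · obtain ⟨g, hg, m, hm, hu, hmn⟩ := exists_lead_of_not_standard hG hn
    obtain ⟨p, hp, hl⟩ := exists_hasLead_add (n - m) (hG.subset g hg) hm.hasLead
    rw [add_tsub_cancel_of_le hmn] at hl
    obtain ⟨c, hc⟩ := hu
    rw [← hc] at hl
    have hsum : clsM K d p = ∑ n' ∈ p.support, p.coeff n' •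
        clsM K d (MvPolynomial.monomial n' 1) := by
      conv_lhs => rw [p.as_sum, clsM, map_sum]
      exact Finset.sum_congr rfl fun n' _ => clsM_monomial n' _
    rw [clsM_eq_zero_iff.2 hp] at hsum
    by_cases hns : n ∈ p.support
    · rw [← Finset.add_sum_erase _ _ hns, hl.1] at hsum
      have h1 : clsM K d (MvPolynomial.monomial n 1) = -((↑c⁻¹ : K.Elem[X]) •
          ∑ n' ∈ p.support.erase n, p.coeff n' • clsM K d (MvPolynomial.monomial n' 1)) := by
        rw [← smul_neg, ← eq_neg_of_add_eq_zero_left hsum.symm, smul_smul, Units.inv_mul, one_smul]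
      rw [h1]
      refine Submodule.neg_mem _ (Submodule.smul_mem _ _ (Submodule.sum_mem _ fun n' hn' => ?_))
      obtain ⟨h2, h3⟩ := Finset.mem_erase.1 hn'
      exact Submodule.smul_mem _ _ (ih n' (hl.2 n' h2 (MvPolynomial.mem_support_iff.1 h3)))
    -- A unit that is zero: the ring would be trivial and all classes zero.
    · have h0 : (c : K.Elem[X]) = 0 := by rw [← hl.1, MvPolynomial.notMem_support_iff.1 hns]
      have h1 : (1 : K.Elem[X]) = 0 := by rw [← c.mul_inv, h0, zero_mul]
      have : clsM K d (MvPolynomial.monomial n 1) = 0 := by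
        rw [← one_smul K.Elem[X] (clsM K d _), h1, zero_smul]
      rw [this]; exact zero_mem _

/-- A relation is an element of the left ideal supported on standard monomials, and its leading
monomial is not divisible by any leading monomial of G. -/
theorem linearIndependent_standard (hG : IsGroebner K (leftIdeal K d) G)
    (he : Function.Injective e) (he' : Set.range e = standardExps K G) :
    LinearIndependent K.Elem[X] fun j => clsM K d (MvPolynomial.monomial (e j) 1) := by
  classical
  rw [Fintype.linearIndependent_iff]
  intro a ha j
  have hmon : ∑ j, a j • clsM K d (MvPolynomial.monomial (e j) 1) =
      clsM K d (∑ j, MvPolynomial.monomial (e j) (a j)) := by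
    rw [clsM, map_sum]
    exact Finset.sum_congr rfl fun j _ => (clsM_monomial _ _).symm
  rw [hmon, clsM_eq_zero_iff] at ha
  set p : Sym K := ∑ j, MvPolynomial.monomial (e j) (a j) with hp
  have hp0 : p = 0 := by
    by_contra h0
    obtain ⟨g, hg, m, n, hm, hn, hmn⟩ := hG.lead p ha h0
    obtain ⟨j, rfl⟩ : ∃ j, e j = n := by
      by_contra! h
      refine MvPolynomial.mem_support_iff.1 hn.1 ?_
      rw [hp, MvPolynomial.coeff_sum]
      exact Finset.sum_eq_zero fun j _ => by rw [MvPolynomial.coeff_monomial, if_neg (h j)]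
    have : e j ∈ standardExps K G := he' ▸ Set.mem_range_self j
    exact this g hg m hm hmn
  have h1 : p.coeff (e j) = a j := by
    rw [hp, MvPolynomial.coeff_sum]
    simp only [MvPolynomial.coeff_monomial, he.eq_iff]
    rw [Finset.sum_ite_eq' Finset.univ j a, if_pos (Finset.mem_univ j)]
  rw [← h1, hp0, MvPolynomial.coeff_zero]

/-- The standard monomials form a basis of `M^h` over `K[h]`. -/
def standardBasis (hG : IsGroebner K (leftIdeal K d) G)
    (he : Function.Injective e) (he' : Set.range e = standardExps K G) :
    Module.Basis (Fin (s + 1)) K.Elem[X] (Mh K d) :=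
  Module.Basis.mk (linearIndependent_standard hG he he') fun x _ => by
    obtain ⟨p, rfl⟩ := Submodule.mkQ_surjective _ x
    rw [p.as_sum, map_sum]
    refine Submodule.sum_mem _ fun n _ => ?_
    have : MvPolynomial.monomial n (p.coeff n) =
        p.coeff n • (MvPolynomial.monomial n 1 : Sym K) := by
      rw [MvPolynomial.smul_monomial, smul_eq_mul, mul_one]
    rw [this, map_smul]
    exact Submodule.smul_mem _ _ (clsM_monomial_mem_span hG he' n)

theorem standardBasis_apply (hG : IsGroebner K (leftIdeal K d) G)
    (he : Function.Injective e) (he' : Set.range e = standardExps K G) (j : Fin (s + 1)) :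
    standardBasis hG he he' j = clsM K d (MvPolynomial.monomial (e j) 1) := by
  rw [standardBasis, Module.Basis.mk_apply]

end Standard
end

section
variable {r : ℕ}
open CoeffAlgebra

/-! ### The limit h = 0: the low degree part of 𝒜₀ and the basis of 𝒜. -/

section Classical

variable {K : CoeffAlgebra r} {w : Fin r → ℕ} {s u : ℕ} {R : Fin u → MvPolynomial (Fin r) K.Elem}

theorem eval_origin_del (i : Fin r) (f : K.Elem) : K.eval K.origin (K.del i f) = 0 :=
  zero_mul _

theorem relIdeal₀_eq_map : relIdeal₀ K R =
    Ideal.map (MvPolynomial.map (K.eval K.origin)) (relIdeal K R) := by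
  rw [relIdeal₀, relIdeal, Ideal.map_span, ← Set.range_comp]
  rfl

theorem exists_eq_single_of_degree_eq_one {m : Fin r →₀ ℕ} (h : m.degree = 1) :
    ∃ i, m = Finsupp.single i 1 := by
  have : m ∈ Set.range fun a : Fin r => Finsupp.single a 1 := by
    rw [Finsupp.range_single_one]; exact h
  obtain ⟨i, hi⟩ := this
  exact ⟨i, hi.symm⟩

-- The derivations qᵢ ∂/∂qᵢ vanish at q = 0, so Euler's identity leaves only (N − 2|m|) times the
-- coefficient of b^m, which must be zero.
attribute [local instance] MvPolynomial.gradedAlgebra in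
theorem isHomogeneous_relIdeal₀
    (h : ∀ l, ∃ N : ℤ, ∀ m, K.IsHomog w ((R l).coeff m) (N - 2 * (m.degree : ℤ))) :
    (relIdeal₀ K R).IsHomogeneous (MvPolynomial.homogeneousSubmodule (Fin r) ℂ) := by
  refine Ideal.homogeneous_span _ _ ?_
  rintro _ ⟨l, rfl⟩
  obtain ⟨N, hN⟩ := h l
  -- If N is odd or negative, the relation vanishes at q = 0 and the chosen degree is immaterial.
  refine ⟨(N / 2).toNat, ?_⟩
  rw [MvPolynomial.mem_homogeneousSubmodule]
  intro m hm
  rw [MvPolynomial.coeff_map] at hm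
  have h1 := congrArg (K.eval K.origin) (hN m)
  rw [map_sum] at h1
  simp only [eval_smul, eval_origin_del, mul_zero, Finset.sum_const_zero] at h1
  have h2 := (mul_eq_zero.1 h1.symm).resolve_right hm
  have h3 : N - 2 * (m.degree : ℤ) = 0 := by exact_mod_cast h2
  have h4 : Finsupp.weight 1 m = m.degree :=
    (DFunLike.congr_fun (Finsupp.degree_eq_weight_one (R := ℕ) (σ := Fin r)) m).symm
  rw [h4]
  omega

-- A homogeneous ideal contains the components of its elements. A nonzero constant component would
-- give 𝒜₀ = 0, and a nonzero linear one would be a relation among the bᵢ.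
attribute [local instance] MvPolynomial.gradedAlgebra in
theorem coeff_eq_zero_of_mem_relIdeal₀ (hA : IsDeformation K w s R) {p : MvPolynomial (Fin r) ℂ}
    (hp : p ∈ relIdeal₀ K R) {n : Fin r →₀ ℕ} (hn : n.degree ≤ 1) : p.coeff n = 0 := by
  have hI := isHomogeneous_relIdeal₀ hA.homog
  have hc := fun k => MvPolynomial.homogeneousComponent_mem_of_mem hI hp k
  rcases Nat.le_one_iff_eq_zero_or_eq_one.1 hn with hn | hn
  · rw [Finsupp.degree_eq_zero_iff] at hn
    subst hn
    by_contra h0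
    have h1 := hc 0
    rw [MvPolynomial.homogeneousComponent_zero] at h1
    have h2 : relIdeal₀ K R = ⊤ := Ideal.eq_top_of_isUnit_mem _ h1
      ((isUnit_iff_ne_zero.2 h0).map MvPolynomial.C)
    obtain ⟨b⟩ := hA.free₀
    have : Subsingleton (AlgA₀ K R) := Ideal.Quotient.subsingleton_iff.2 h2
    exact b.ne_zero 0 (Subsingleton.elim _ _)
  · have h1 : MvPolynomial.homogeneousComponent 1 p =
        ∑ i, p.coeff (Finsupp.single i 1) • MvPolynomial.X i := by
      ext1 m
      rw [MvPolynomial.coeff_homogeneousComponent, MvPolynomial.coeff_sum]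
      simp only [MvPolynomial.coeff_smul, MvPolynomial.coeff_X, smul_eq_mul]
      split_ifs with hm
      · obtain ⟨i, rfl⟩ := exists_eq_single_of_degree_eq_one hm
        simp [Finsupp.single_left_inj]
      · symm
        refine Finset.sum_eq_zero fun i _ => ?_
        rw [if_neg, mul_zero]
        rintro rfl
        simp at hm
    have h2 := hc 1
    rw [h1] at h2
    have h3 : ∑ i, p.coeff (Finsupp.single i 1) • cls₀ K R (MvPolynomial.X i) = 0 := by
      have := Ideal.Quotient.eq_zero_iff_mem.2 h2
      rw [← Ideal.Quotient.mkₐ_eq_mk ℂ, map_sum] at this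
      simp only [map_smul] at this
      exact this
    obtain ⟨i, rfl⟩ := exists_eq_single_of_degree_eq_one hn
    exact Fintype.linearIndependent_iff.1 hA.indep _ h3 i

variable {d : Fin u → Sym K} {G : Set (Sym K)} {e : Fin (s + 1) → Fin r →₀ ℕ}

/-- The leading coefficient is a unit, so it survives h = 0 and q = 0; in degree at most 1 it would
contradict `coeff_eq_zero_of_mem_relIdeal₀`. -/
theorem two_le_degree_of_isLeading (hA : IsDeformation K w s R) (hM : IsQuantization K s R d)
    (hG : IsGroebner K (leftIdeal K d) G) {g : Sym K} (hg : g ∈ G) {m : Fin r →₀ ℕ}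
    (hm : IsLeading K g m) : 2 ≤ m.degree := by
  by_contra! h
  obtain ⟨m', hm', hu⟩ := hG.unit g hg
  obtain rfl := hm.unique hm'
  have h1 := Ideal.mem_map_of_mem (MvPolynomial.map (K.eval K.origin))
    (map_mem_relIdeal hM.limit (hG.subset g hg))
  rw [← relIdeal₀_eq_map] at h1
  have h2 := coeff_eq_zero_of_mem_relIdeal₀ hA h1 (Nat.lt_succ_iff.1 h)
  rw [MvPolynomial.coeff_map, MvPolynomial.coeff_map] at h2
  exact ((hu.map (Polynomial.evalRingHom 0)).map (K.eval K.origin)).ne_zero h2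

theorem exists_of_degree_le_one (hA : IsDeformation K w s R) (hM : IsQuantization K s R d)
    (hG : IsGroebner K (leftIdeal K d) G) (he' : Set.range e = standardExps K G)
    {n : Fin r →₀ ℕ} (hn : n.degree ≤ 1) : ∃ k, e k = n := by
  rw [← Set.mem_range, he']
  intro g hg m hm hmn
  have h1 := two_le_degree_of_isLeading hA hM hG hg hm
  have h2 : m.degree ≤ n.degree := Finsupp.degree_mono hmn
  omega

/-- The classes of the standard monomials span `𝒜`. -/
theorem span_monomial_eq_top (hM : IsQuantization K s R d) (hG : IsGroebner K (leftIdeal K d) G)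
    (he' : Set.range e = standardExps K G) : ⊤ ≤ Submodule.span K.Elem (Set.range fun j =>
      Ideal.Quotient.mk (relIdeal K R) (MvPolynomial.monomial (e j) 1)) := by
  rintro x -
  obtain ⟨p, rfl⟩ := Ideal.Quotient.mk_surjective x
  have hsm : ∀ (a : K.Elem) (p : MvPolynomial (Fin r) K.Elem),
      Ideal.Quotient.mk (relIdeal K R) (a • p) = a • Ideal.Quotient.mk (relIdeal K R) p :=
    fun a p => map_smul (Ideal.Quotient.mkₐ K.Elem (relIdeal K R)) a p
  rw [p.as_sum, map_sum]
  refine Submodule.sum_mem _ fun n _ => ?_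
  have : MvPolynomial.monomial n (p.coeff n) =
      p.coeff n • (MvPolynomial.monomial n 1 : MvPolynomial (Fin r) K.Elem) := by
    rw [MvPolynomial.smul_monomial, smul_eq_mul, mul_one]
  rw [this, hsm]
  refine Submodule.smul_mem _ _ ?_
  obtain ⟨a, ha⟩ := (Submodule.mem_span_range_iff_exists_fun _).1
    (clsM_monomial_mem_span (d := d) hG he' n)
  have h1 : ∑ j, a j • (MvPolynomial.monomial (e j) 1 : Sym K) - MvPolynomial.monomial n 1 ∈
      leftIdeal K d := by
    rw [← clsM_eq_zero_iff, clsM, map_sub, map_sum, sub_eq_zero]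
    simp only [map_smul]
    exact ha
  have h2 := Ideal.Quotient.eq_zero_iff_mem.2 (map_mem_relIdeal hM.limit h1)
  simp only [map_sub, map_sum, MvPolynomial.smul_eq_C_mul, map_mul, MvPolynomial.map_C,
    MvPolynomial.map_monomial, map_one] at h2
  rw [← sub_eq_zero.1 h2]
  refine Submodule.sum_mem _ fun j _ => ?_
  rw [← map_mul, ← MvPolynomial.smul_eq_C_mul, hsm]
  exact Submodule.smul_mem _ _ (Submodule.subset_span ⟨j, rfl⟩)

/-- The classes of the standard monomials form a basis of `𝒜` over `K`. -/
def classicalBasis (hA : IsDeformation K w s R) (hM : IsQuantization K s R d)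
    (hG : IsGroebner K (leftIdeal K d) G) (he' : Set.range e = standardExps K G) :
    Module.Basis (Fin (s + 1)) K.Elem (AlgA K R) :=
  haveI : Nontrivial K.Elem := nontrivial_elem
  -- Over a commutative ring, a spanning family with as many members as the rank is a basis.
  basisOfTopLeSpanOfCardEqFinrank _ (span_monomial_eq_top hM hG he')
    (Module.finrank_eq_card_basis hA.free.some).symm

theorem classicalBasis_apply (hA : IsDeformation K w s R) (hM : IsQuantization K s R d)
    (hG : IsGroebner K (leftIdeal K d) G) (he' : Set.range e = standardExps K G)
    (j : Fin (s + 1)) : classicalBasis hA hM hG he' j =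
      Ideal.Quotient.mk (relIdeal K R) (MvPolynomial.monomial (e j) 1) := by
  rw [classicalBasis, coe_basisOfTopLeSpanOfCardEqFinrank]

end Classical

/-! ### The fibres of `𝒜` -/

section Fibre

variable {K : CoeffAlgebra r} {s u : ℕ} {R : Fin u → MvPolynomial (Fin r) K.Elem}

/-- The ideal of the relations at the point `q`. -/
def relIdealAt (R : Fin u → MvPolynomial (Fin r) K.Elem) (q : K.V) :
    Ideal (MvPolynomial (Fin r) ℂ) :=
  Ideal.map (MvPolynomial.map (K.eval q)) (relIdeal K R)

variable (bA : Module.Basis (Fin (s + 1)) K.Elem (AlgA K R))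

/-- The coordinates of the class of a polynomial in the fibre of `𝒜` at the point `q`, with respect
to a basis of `𝒜`. -/
def coordAt (q : K.V) : MvPolynomial (Fin r) ℂ →ₗ[ℂ] (Fin (s + 1) → ℂ) where
  toFun p k := K.eval q (bA.repr (Ideal.Quotient.mk _ (MvPolynomial.map (algebraMap ℂ K.Elem) p)) k)
  map_add' p p' := by
    funext k
    simp only [map_add, Finsupp.add_apply, Pi.add_apply]
  map_smul' c p := by
    funext k
    have : MvPolynomial.map (algebraMap ℂ K.Elem) (c • p) =
        algebraMap ℂ K.Elem c • MvPolynomial.map (algebraMap ℂ K.Elem) p := by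
      rw [MvPolynomial.smul_eq_C_mul, map_mul, MvPolynomial.map_C, ← MvPolynomial.smul_eq_C_mul]
    rw [this, ← Ideal.Quotient.mkₐ_eq_mk K.Elem, map_smul, map_smul, Finsupp.smul_apply,
      smul_eq_mul, map_mul, eval_algebraMap]
    rfl

theorem coordAt_apply (q : K.V) (p : MvPolynomial (Fin r) ℂ) (k : Fin (s + 1)) :
    coordAt bA q p k =
      K.eval q (bA.repr (Ideal.Quotient.mk _ (MvPolynomial.map (algebraMap ℂ K.Elem) p)) k) := rfl

/-- `coordAt` lifts coefficients to constants of K; here any other lift is seen to give the same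
coordinates at q. -/
theorem coordAt_map (q : K.V) (P : MvPolynomial (Fin r) K.Elem) (k : Fin (s + 1)) :
    coordAt bA q (MvPolynomial.map (K.eval q) P) k =
      K.eval q (bA.repr (Ideal.Quotient.mk _ P) k) := by
  have hmon : ∀ (n : Fin r →₀ ℕ) (a : K.Elem),
      bA.repr (Ideal.Quotient.mk (relIdeal K R) (MvPolynomial.monomial n a)) k =
        a * bA.repr (Ideal.Quotient.mk (relIdeal K R) (MvPolynomial.monomial n 1)) k :=
    fun n a => by
      have : (MvPolynomial.monomial n a : MvPolynomial (Fin r) K.Elem) =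
          a • MvPolynomial.monomial n 1 := by
        rw [MvPolynomial.smul_monomial, smul_eq_mul, mul_one]
      rw [this, ← Ideal.Quotient.mkₐ_eq_mk K.Elem, map_smul, map_smul, Finsupp.smul_apply,
        smul_eq_mul]
  induction P using MvPolynomial.induction_on' with
  | monomial n a =>
    rw [MvPolynomial.map_monomial, coordAt_apply, MvPolynomial.map_monomial, hmon, map_mul,
      eval_algebraMap, hmon n a, map_mul]
  | add p p' hp hp' => simp only [map_add, Pi.add_apply, hp, hp', Finsupp.add_apply]

theorem coordAt_eq_zero_of_mem {q : K.V} {p : MvPolynomial (Fin r) ℂ} (hp : p ∈ relIdealAt R q) :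
    coordAt bA q p = 0 := by
  have hsurj : Function.Surjective (MvPolynomial.map (σ := Fin r) (K.eval q)) :=
    MvPolynomial.map_surjective _ fun c => ⟨algebraMap ℂ K.Elem c, eval_algebraMap q c⟩
  obtain ⟨P, hP, rfl⟩ := (Ideal.mem_map_iff_of_surjective _ hsurj).1 hp
  funext k
  rw [coordAt_map, Ideal.Quotient.eq_zero_iff_mem.2 hP]
  simp

variable {bA} {e : Fin (s + 1) → Fin r →₀ ℕ}

theorem coordAt_monomial
    (hb : ∀ j, bA j = Ideal.Quotient.mk (relIdeal K R) (MvPolynomial.monomial (e j) 1))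
    (q : K.V) (j : Fin (s + 1)) :
    coordAt bA q (MvPolynomial.monomial (e j) 1) = Pi.single j 1 := by
  funext k
  rw [coordAt_apply, MvPolynomial.map_monomial, map_one, ← hb, Module.Basis.repr_self,
    Finsupp.single_apply, Pi.single_apply]
  by_cases h : j = k
  · subst h; simp
  · simp [h, Ne.symm h]

theorem sub_sum_coordAt_mem
    (hb : ∀ j, bA j = Ideal.Quotient.mk (relIdeal K R) (MvPolynomial.monomial (e j) 1))
    (q : K.V) (p : MvPolynomial (Fin r) ℂ) :
    p - ∑ k, coordAt bA q p k • MvPolynomial.monomial (e k) 1 ∈ relIdealAt R q := by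
  set P : MvPolynomial (Fin r) K.Elem := MvPolynomial.map (algebraMap ℂ K.Elem) p with hP
  have h1 : P - ∑ k, bA.repr (Ideal.Quotient.mk _ P) k • MvPolynomial.monomial (e k) 1 ∈
      relIdeal K R := by
    rw [← Ideal.Quotient.eq_zero_iff_mem, ← Ideal.Quotient.mkₐ_eq_mk K.Elem, map_sub, map_sum]
    simp only [map_smul, Ideal.Quotient.mkₐ_eq_mk, ← hb]
    rw [bA.sum_repr, sub_self]
  have h2 := Ideal.mem_map_of_mem (MvPolynomial.map (K.eval q)) h1
  have h3 : MvPolynomial.map (K.eval q) P = p := by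
    rw [hP, MvPolynomial.map_map]
    have : (K.eval q).comp (algebraMap ℂ K.Elem) = RingHom.id ℂ :=
      RingHom.ext fun c => eval_algebraMap q c
    rw [this, MvPolynomial.map_id]
  rw [map_sub, map_sum, h3] at h2
  simp only [MvPolynomial.smul_eq_C_mul, map_mul, MvPolynomial.map_C, MvPolynomial.map_monomial,
    map_one] at h2 ⊢
  exact h2

/-- Hence the basis of 𝒜 specialises to a basis of the fibre at every point of V, without loss of
dimension. -/
theorem coordAt_eq_zero_iff
    (hb : ∀ j, bA j = Ideal.Quotient.mk (relIdeal K R) (MvPolynomial.monomial (e j) 1))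
    {q : K.V} {p : MvPolynomial (Fin r) ℂ} :
    coordAt bA q p = 0 ↔ p ∈ relIdealAt R q := by
  refine ⟨fun h => ?_, coordAt_eq_zero_of_mem bA⟩
  have := sub_sum_coordAt_mem hb q p
  simpa [h] using this

/-- The multiplication of the fibre of `𝒜` at `q` in coordinates. -/
theorem coordAt_mul
    (hb : ∀ j, bA j = Ideal.Quotient.mk (relIdeal K R) (MvPolynomial.monomial (e j) 1))
    (q : K.V) (p p' : MvPolynomial (Fin r) ℂ) (k : Fin (s + 1)) :
    coordAt bA q (p * p') k =
      ∑ i, ∑ j, K.eval q (bA.repr (bA i * bA j) k) * (coordAt bA q p i * coordAt bA q p' j) := by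
  have h1 := coordAt_eq_zero_of_mem bA (Ideal.mul_mem_right p' _ (sub_sum_coordAt_mem hb q p))
  have h2 := fun i => coordAt_eq_zero_of_mem bA
    (Ideal.mul_mem_left _ (MvPolynomial.monomial (e i) 1) (sub_sum_coordAt_mem hb q p'))
  have h3 : ∀ i j, coordAt bA q (MvPolynomial.monomial (e i) 1 * MvPolynomial.monomial (e j) 1) k =
      K.eval q (bA.repr (bA i * bA j) k) := fun i j => by
    rw [coordAt_apply, map_mul, map_mul, MvPolynomial.map_monomial, MvPolynomial.map_monomial,
      map_one, ← hb, ← hb]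
  simp only [sub_mul, mul_sub, Finset.sum_mul, Finset.mul_sum, smul_mul_assoc, mul_smul_comm,
    map_sub, map_sum, map_smul, sub_eq_zero] at h1 h2
  rw [h1]
  simp only [h2, Finset.sum_apply, Pi.smul_apply, smul_eq_mul, h3]
  refine Finset.sum_congr rfl fun i _ => ?_
  rw [Finset.mul_sum]
  exact Finset.sum_congr rfl fun j _ => by ring

/-- The multiplication by `bᵢ` in coordinates. -/
theorem coordAt_X_mul
    (hb : ∀ j, bA j = Ideal.Quotient.mk (relIdeal K R) (MvPolynomial.monomial (e j) 1))
    {ω : Fin r → Matrix (Fin (s + 1)) (Fin (s + 1)) K.Elem}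
    (hω : ∀ i j, MvPolynomial.X i * MvPolynomial.monomial (e j) 1 -
      ∑ k, ω i k j • MvPolynomial.monomial (e k) 1 ∈ relIdeal K R)
    (q : K.V) (i : Fin r) (p : MvPolynomial (Fin r) ℂ) :
    coordAt bA q (MvPolynomial.X i * p) = ((ω i).map (K.eval q)).mulVec (coordAt bA q p) := by
  have h1 := coordAt_eq_zero_of_mem bA
    (Ideal.mul_mem_left _ (MvPolynomial.X i) (sub_sum_coordAt_mem hb q p))
  simp only [mul_sub, Finset.mul_sum, mul_smul_comm, map_sub, map_sum, map_smul, sub_eq_zero] at h1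
  have h2 : ∀ j k, coordAt bA q (MvPolynomial.X i * MvPolynomial.monomial (e j) 1) k =
      K.eval q (ω i k j) := fun j k => by
    have h3 := coordAt_eq_zero_of_mem bA
      (Ideal.mem_map_of_mem (MvPolynomial.map (K.eval q)) (hω i j))
    simp only [map_sub, map_sum, MvPolynomial.smul_eq_C_mul, map_mul, MvPolynomial.map_C,
      MvPolynomial.map_monomial, map_one, MvPolynomial.map_X, sub_eq_zero] at h3
    rw [h3]
    simp only [← MvPolynomial.smul_eq_C_mul, map_smul, coordAt_monomial hb, Finset.sum_apply,
      Pi.smul_apply, Pi.single_apply, smul_eq_mul, mul_ite, mul_one, mul_zero]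
    rw [Finset.sum_ite_eq Finset.univ k, if_pos (Finset.mem_univ k)]
  funext k
  rw [h1]
  simp only [Finset.sum_apply, Pi.smul_apply, smul_eq_mul, h2, Matrix.mulVec, dotProduct,
    Matrix.map_apply]
  exact Finset.sum_congr rfl fun j _ => mul_comm _ _

end Fibre
end

/-! ### The connection matrices: flatness, homogeneity, and the shape of θ. -/

section
variable {r : ℕ}
open CoeffAlgebra

/-- The properties of the matrices of a flat connection `(1/h) ω + θ` which express that it comes from
a quantization: flatness for all `h`, and the form of the columns of `θ` belonging to the monomials `1` (of
index `k₀`) and `h∂ᵢ` (of index `κ i`). -/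
structure IsFlatConnection (K : CoeffAlgebra r) {n : ℕ}
    (ω θ : Fin r → Matrix (Fin n) (Fin n) K.Elem) (k₀ : Fin n) (κ : Fin r → Fin n) : Prop where
  comm : ∀ i j, ω i * ω j = ω j * ω i
  closed : ∀ i j, (ω j).map (K.del i) + (ω i * θ j + θ i * ω j) =
    (ω i).map (K.del j) + (ω j * θ i + θ j * ω i)
  flat : ∀ i j, (θ j).map (K.del i) + θ i * θ j = (θ i).map (K.del j) + θ j * θ i
  θ_one : ∀ i k, θ i k k₀ = 0
  θ_symm : ∀ i j k, θ i k (κ j) = θ j k (κ i)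
  θ_row : ∀ i j k, (∀ l, k ≠ κ l) → θ i k (κ j) = 0
  κ_injective : Function.Injective κ

section Coordinates

variable {K : CoeffAlgebra r} {s u : ℕ} {d : Fin u → Sym K}
  (bM : Module.Basis (Fin (s + 1)) K.Elem[X] (Mh K d))

/-- The coordinates in `M^h` of the operator with a given symbol. -/
def coordM : Sym K →ₗ[K.Elem[X]] (Fin (s + 1) → K.Elem[X]) :=
  bM.equivFun.toLinearMap ∘ₗ (leftIdeal K d).mkQ

theorem coordM_apply (p : Sym K) : coordM bM p = bM.equivFun (clsM K d p) := rfl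

theorem coordM_eq_zero {p : Sym K} (hp : p ∈ leftIdeal K d) : coordM bM p = 0 := by
  rw [coordM_apply, clsM_eq_zero_iff.2 hp, map_zero]

variable {bM} {e : Fin (s + 1) → Fin r →₀ ℕ}

theorem coordM_monomial
    (hb : ∀ j, bM j = clsM K d (MvPolynomial.monomial (e j) 1))
    (j : Fin (s + 1)) :
    coordM bM (MvPolynomial.monomial (e j) 1) = Pi.single j 1 := by
  funext k
  rw [coordM_apply, ← hb, Module.Basis.equivFun_self, Pi.single_apply]
  exact if_congr eq_comm rfl rfl

theorem sub_sum_coordM_mem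
    (hb : ∀ j, bM j = clsM K d (MvPolynomial.monomial (e j) 1))
    (p : Sym K) :
    p - ∑ k, coordM bM p k • MvPolynomial.monomial (e k) 1 ∈ leftIdeal K d := by
  rw [← clsM_eq_zero_iff, clsM, map_sub, map_sum, sub_eq_zero]
  simp only [map_smul]
  conv_lhs => rw [← bM.sum_equivFun ((leftIdeal K d).mkQ p)]
  exact Finset.sum_congr rfl fun k _ => by rw [hb]; rfl

variable {ω θ : Fin r → Matrix (Fin (s + 1)) (Fin (s + 1)) K.Elem}

theorem coordM_X_mul
    (hb : ∀ j, bM j = clsM K d (MvPolynomial.monomial (e j) 1))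
    (hΩ : HasConnectionForm K d e ω θ) (i : Fin r) (j k : Fin (s + 1)) :
    coordM bM (MvPolynomial.X i * MvPolynomial.monomial (e j) 1) k =
      Polynomial.C (ω i k j) + Polynomial.X * Polynomial.C (θ i k j) := by
  rw [coordM_apply, hΩ i j, map_sum]
  simp only [← hb, map_smul, Module.Basis.equivFun_self, Finset.sum_apply, Pi.smul_apply,
    smul_eq_mul, mul_ite, mul_one, mul_zero]
  rw [Finset.sum_ite_eq' Finset.univ k (fun x => Polynomial.C (ω i x j) +
    Polynomial.X * Polynomial.C (θ i x j)), if_pos (Finset.mem_univ k)]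

/-- The Leibniz rule: on coordinate vectors h∂ᵢ acts as the matrix ωᵢ + h θᵢ plus h∂ᵢ applied to the
entries. -/
theorem coordM_symDel
    (hb : ∀ j, bM j = clsM K d (MvPolynomial.monomial (e j) 1))
    (hΩ : HasConnectionForm K d e ω θ) (i : Fin r) (p : Sym K)
    (k : Fin (s + 1)) : coordM bM (symDel i p) k =
      ∑ j, (Polynomial.C (ω i k j) + Polynomial.X * Polynomial.C (θ i k j)) * coordM bM p j +
        hdel K i (coordM bM p k) := by
  have h1 : coordM bM (symDel i p) =
      coordM bM (symDel i (∑ j, coordM bM p j • MvPolynomial.monomial (e j) 1)) := by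
    have h2 := coordM_eq_zero bM (symDel_mem_leftIdeal i (sub_sum_coordM_mem hb p))
    have h3 := symDel_add i (p - ∑ j, coordM bM p j • MvPolynomial.monomial (e j) 1)
      (∑ j, coordM bM p j • MvPolynomial.monomial (e j) 1)
    rw [sub_add_cancel] at h3
    rw [h3, map_add, h2, zero_add]
  have h4 : ∀ j, symDel i (MvPolynomial.monomial (e j) 1 : Sym K) =
      MvPolynomial.X i * MvPolynomial.monomial (e j) 1 := fun j => by
    rw [symDel, mapCoeff_monomial, hdel_one, map_zero, add_zero]
  rw [h1, symDel_sum, map_sum]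
  simp only [symDel_smul, h4, map_add, map_smul, Finset.sum_apply, Pi.add_apply, Pi.smul_apply,
    coordM_X_mul hb hΩ, coordM_monomial hb, Finset.sum_add_distrib, Pi.single_apply, smul_eq_mul,
    mul_ite, mul_one, mul_zero]
  rw [Finset.sum_ite_eq Finset.univ k, if_pos (Finset.mem_univ k)]
  congr 1
  exact Finset.sum_congr rfl fun j _ => mul_comm _ _

/-- This holds because h∂ᵢ and h∂ⱼ commute on the class of P_l. It is kept as an identity of
polynomials in h, to be split by powers of h. -/
theorem connection_flatness
    (hb : ∀ j, bM j = clsM K d (MvPolynomial.monomial (e j) 1))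
    (hΩ : HasConnectionForm K d e ω θ) (i j : Fin r) (k l : Fin (s + 1)) :
    ∑ m, (Polynomial.C (ω i k m) + Polynomial.X * Polynomial.C (θ i k m)) *
        (Polynomial.C (ω j m l) + Polynomial.X * Polynomial.C (θ j m l)) +
        hdel K i (Polynomial.C (ω j k l) + Polynomial.X * Polynomial.C (θ j k l)) =
      ∑ m, (Polynomial.C (ω j k m) + Polynomial.X * Polynomial.C (θ j k m)) *
        (Polynomial.C (ω i m l) + Polynomial.X * Polynomial.C (θ i m l)) +
        hdel K j (Polynomial.C (ω i k l) + Polynomial.X * Polynomial.C (θ i k l)) := by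
  have h4 : ∀ i, symDel i (MvPolynomial.monomial (e l) 1 : Sym K) =
      MvPolynomial.X i * MvPolynomial.monomial (e l) 1 := fun i => by
    rw [symDel, mapCoeff_monomial, hdel_one, map_zero, add_zero]
  have h := congrArg (fun p => coordM bM p k)
    (symDel_comm i j (MvPolynomial.monomial (e l) 1 : Sym K))
  simp only [coordM_symDel hb hΩ i, coordM_symDel hb hΩ j, h4, coordM_X_mul hb hΩ] at h
  exact h

/-- The coordinates in `M^h` are weighted homogeneous. -/
theorem coordM_isHomog
    (hb : ∀ j, bM j = clsM K d (MvPolynomial.monomial (e j) 1))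
    {w : Fin r → ℕ} (hd : ∀ l, IsHomogOp K w (d l)) (n : Fin r →₀ ℕ)
    (k : Fin (s + 1)) (l : ℕ) : K.IsHomog w ((coordM bM (MvPolynomial.monomial n 1) k).coeff l)
      (2 * (n.degree : ℤ) - 2 * ((e k).degree : ℤ) - 2 * (l : ℤ)) := by
  set p : Sym K := MvPolynomial.monomial n 1 with hp
  have he1 : euler K w 1 = 0 := by
    ext k
    rw [coeff_euler, Polynomial.coeff_one]
    split_ifs with h
    · subst h; simp [del_one]
    · simp
  have hmon : ∀ n, symEuler w (MvPolynomial.monomial n 1 : Sym K) =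
      (algebraMap ℂ K.Elem[X] (2 * (n.degree : ℂ))) • MvPolynomial.monomial n 1 := fun n => by
    rw [symEuler_monomial, he1, zero_add, MvPolynomial.smul_monomial, smul_eq_mul, Algebra.smul_def]
  have hsum : ∀ a : Fin (s + 1) → K.Elem[X],
      symEuler w (∑ j, a j • (MvPolynomial.monomial (e j) 1 : Sym K)) =
        ∑ j, symEuler w (a j • (MvPolynomial.monomial (e j) 1 : Sym K)) := fun a =>
    map_sum (AddMonoidHom.mk' (symEuler w) (symEuler_add w)) _ _
  -- The Euler operator preserves the left ideal, so it may be applied to the expansion of p in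
  -- standard monomials, each of which is an eigenvector with eigenvalue 2|e_j|.
  have h1 : coordM bM (symEuler w p) =
      coordM bM (symEuler w (∑ j, coordM bM p j • MvPolynomial.monomial (e j) 1)) := by
    have h2 := coordM_eq_zero bM (symEuler_mem_leftIdeal hd (sub_sum_coordM_mem hb p))
    have h3 := symEuler_add w (p - ∑ j, coordM bM p j • MvPolynomial.monomial (e j) 1)
      (∑ j, coordM bM p j • MvPolynomial.monomial (e j) 1)
    rw [sub_add_cancel] at h3
    rw [h3, map_add, h2, zero_add]
  have h5 := congrFun h1 k
  rw [hp, hmon, ← hp, hsum, map_smul, map_sum] at h5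
  simp only [symEuler_smul, hmon, map_add, map_smul, Finset.sum_apply, Pi.add_apply, Pi.smul_apply,
    coordM_monomial hb, Finset.sum_add_distrib, Pi.single_apply, smul_eq_mul, mul_ite, mul_one,
    mul_zero] at h5
  rw [Finset.sum_ite_eq Finset.univ k, Finset.sum_ite_eq Finset.univ k,
    if_pos (Finset.mem_univ k), if_pos (Finset.mem_univ k), mul_comm (coordM bM p k),
    ← Algebra.smul_def, ← Algebra.smul_def] at h5
  have h6 := congrArg (fun a => a.coeff l) h5
  simp only [Polynomial.coeff_add, Polynomial.coeff_smul, coeff_euler] at h6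
  rw [IsHomog]
  push_cast
  simp only [Algebra.smul_def, map_sub] at h6 ⊢
  rw [sub_mul, sub_mul, h6]
  ring

end Coordinates

theorem coeff_linear_mul {A : Type*} [CommRing A] (a b a' b' : A) (k : ℕ) :
    ((Polynomial.C a + Polynomial.X * Polynomial.C b) *
      (Polynomial.C a' + Polynomial.X * Polynomial.C b')).coeff k =
      if k = 0 then a * a' else if k = 1 then a * b' + b * a' else if k = 2 then b * b' else 0 := by
  have : (Polynomial.C a + Polynomial.X * Polynomial.C b) *
      (Polynomial.C a' + Polynomial.X * Polynomial.C b') =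
      Polynomial.C (a * a') + Polynomial.C (a * b' + b * a') * Polynomial.X ^ 1 +
        Polynomial.C (b * b') * Polynomial.X ^ 2 := by
    simp only [map_mul, map_add]; ring
  rw [this]
  simp only [Polynomial.coeff_add, Polynomial.coeff_C_mul, Polynomial.coeff_X_pow,
    Polynomial.coeff_C]
  rcases k with _ | _ | _ | k <;> simp

theorem coeff_hdel_linear {K : CoeffAlgebra r} (i : Fin r) (a b : K.Elem) (k : ℕ) :
    (hdel K i (Polynomial.C a + Polynomial.X * Polynomial.C b)).coeff k =
      if k = 1 then K.del i a else if k = 2 then K.del i b else 0 := by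
  rw [hdel_apply]
  rcases k with _ | _ | _ | k
  · simp
  · rw [Polynomial.coeff_X_mul, coeff_pdel]; simp
  · rw [Polynomial.coeff_X_mul, coeff_pdel]; simp
  · rw [Polynomial.coeff_X_mul, coeff_pdel]
    simp

section Flat

variable {K : CoeffAlgebra r} {w : Fin r → ℕ} {s u : ℕ} {R : Fin u → MvPolynomial (Fin r) K.Elem}
  {d : Fin u → Sym K} {G : Set (Sym K)} {e : Fin (s + 1) → Fin r →₀ ℕ}
  {ω θ : Fin r → Matrix (Fin (s + 1)) (Fin (s + 1)) K.Elem}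
  {k₀ : Fin (s + 1)} {κ : Fin r → Fin (s + 1)}

/-- The coordinates at `1` of the classes of the second order monomials have no term of degree one
in `h`. -/
theorem coeff_one_coordM_eq_zero {bM : Module.Basis (Fin (s + 1)) K.Elem[X] (Mh K d)}
    (hb : ∀ j, bM j = clsM K d (MvPolynomial.monomial (e j) 1))
    (hd : ∀ l, IsHomogOp K w (d l)) (hG : IsGroebner K (leftIdeal K d) G)
    (hdeg : ∀ g ∈ G, ∀ m, IsLeading K g m → 2 ≤ m.degree)
    (hG2 : ZerothTermsConstant K G) (he' : Set.range e = standardExps K G)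
    (hk₀ : e k₀ = 0) (hκ : ∀ i, e (κ i) = Finsupp.single i 1)
    (hΩ : HasConnectionForm K d e ω θ) (n : Fin r →₀ ℕ) (hn : n.degree = 2) :
    (coordM bM (MvPolynomial.monomial n 1) k₀).coeff 1 = 0 := by
  have hlow : ∀ k, (e k).degree ≠ 0 → coordM bM (MvPolynomial.monomial (e k) 1) k₀ = 0 :=
    fun k hk => by
      rw [coordM_monomial hb, Pi.single_apply, if_neg]
      rintro rfl
      exact hk (by simp [hk₀])
  have hdegone : ∀ n : Fin r →₀ ℕ, n.degree = 1 →
      coordM bM (MvPolynomial.monomial n 1) k₀ = 0 := fun n hn => by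
    obtain ⟨i, rfl⟩ := exists_eq_single_of_degree_eq_one hn
    rw [← hκ]
    exact hlow _ (by simp [hκ])
  -- A second order monomial is h∂ᵢ times the standard monomial h∂ⱼ, so the form of the connection
  -- makes its coordinates at most linear in h.
  have hdegtwo : ∀ n : Fin r →₀ ℕ, n.degree = 2 → ∃ a b : K.Elem,
      coordM bM (MvPolynomial.monomial n 1) k₀ =
        Polynomial.C a + Polynomial.X * Polynomial.C b := fun n hn => by
    obtain ⟨i, hi⟩ : ∃ i, n i ≠ 0 := by
      by_contra! h
      have : n = 0 := Finsupp.ext h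
      simp [this] at hn
    have hle : Finsupp.single i 1 ≤ n := Finsupp.single_le_iff.2 (Nat.one_le_iff_ne_zero.2 hi)
    obtain ⟨m, rfl⟩ : ∃ m, n = Finsupp.single i 1 + m := ⟨_, (add_tsub_cancel_of_le hle).symm⟩
    have hm : m.degree = 1 := by
      rw [map_add, Finsupp.degree_single] at hn; omega
    obtain ⟨j, rfl⟩ := exists_eq_single_of_degree_eq_one hm
    refine ⟨ω i k₀ (κ j), θ i k₀ (κ j), ?_⟩
    rw [← coordM_X_mul hb hΩ i (κ j) k₀, hκ, MvPolynomial.X, MvPolynomial.monomial_mul, one_mul]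
  induction n using wellFounded_grevlexLT.induction with
  | _ n ih =>
  by_cases hns : n ∈ standardExps K G
  · rw [← he'] at hns
    obtain ⟨k, rfl⟩ := hns
    rw [hlow k (by omega), Polynomial.coeff_zero]
  · obtain ⟨g, hg, m, hm, hu, hmn⟩ := exists_lead_of_not_standard hG hns
    have hmn' : m = n := by
      have h1 := hdeg g hg m hm
      obtain ⟨m', rfl⟩ : ∃ m', n = m + m' := ⟨_, (add_tsub_cancel_of_le hmn).symm⟩
      have h2 : m'.degree = 0 := by rw [map_add] at hn; omega
      rw [(Finsupp.degree_eq_zero_iff m').1 h2, add_zero]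
    subst hmn'
    have hle2 : ∀ n' ∈ g.support, n'.degree ≤ 2 := fun n' hn' => by
      by_cases h : n' = m
      · rw [h, hn]
      · exact hn ▸ (hm.2 n' hn' h).degree_le
    have htd : g.totalDegree = 2 := by
      refine le_antisymm ?_ ?_
      · rw [MvPolynomial.totalDegree_eq]
        refine Finset.sup_le fun n' hn' => ?_
        rw [Finsupp.card_toMultiset]
        have := hle2 n' hn'
        rwa [Finsupp.degree_eq_sum, ← Finsupp.sum_fintype n' (fun _ k => k) (fun _ => rfl)] at this
      · have := MvPolynomial.le_totalDegree hm.1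
        rw [Finsupp.sum_fintype m (fun _ k => k) (fun _ => rfl), ← Finsupp.degree_eq_sum, hn] at this
        exact this
    obtain ⟨a, ha⟩ := hG2 g hg htd
    have hsum : ∑ n' ∈ g.support, g.coeff n' * coordM bM (MvPolynomial.monomial n' 1) k₀ = 0 := by
      have h1 := congrFun (coordM_eq_zero bM (hG.subset g hg)) k₀
      rw [g.as_sum, map_sum, Finset.sum_apply] at h1
      rw [← Pi.zero_apply (M := fun _ : Fin (s + 1) => K.Elem[X]) k₀, ← h1]
      refine Finset.sum_congr rfl fun n' _ => ?_
      have : MvPolynomial.monomial n' (g.coeff n') =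
          g.coeff n' • (MvPolynomial.monomial n' 1 : Sym K) := by
        rw [MvPolynomial.smul_monomial, smul_eq_mul, mul_one]
      rw [this, map_smul, Pi.smul_apply, smul_eq_mul]
    set W : (Fin r →₀ ℕ) → K.Elem := fun n' =>
      if n'.degree = 2 then (coordM bM (MvPolynomial.monomial n' 1) k₀).coeff 0 else 0 with hW
    set T : K.Elem := (coordM bM (MvPolynomial.monomial m 1) k₀).coeff 1 with hT
    -- The coefficient of h in the coordinate of g at 1, term by term. The zeroth order term
    -- contributes nothing since it is independent of h, first order monomials have no coordinate at
    -- 1, and second order monomials below m contribute only through W, by induction.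
    have hterm : ∀ n' ∈ g.support,
        (g.coeff n' * coordM bM (MvPolynomial.monomial n' 1) k₀).coeff 1 =
          (g.coeff n').coeff 1 * W n' + if n' = m then (g.coeff m).coeff 0 * T else 0 := by
      intro n' hn'
      have hlin : ∀ (f : K.Elem[X]) (a b : K.Elem),
          (f * (Polynomial.C a + Polynomial.X * Polynomial.C b)).coeff 1 =
            f.coeff 1 * a + f.coeff 0 * b := fun f a b => by
        rw [mul_add, Polynomial.coeff_add, Polynomial.coeff_mul_C, ← mul_assoc,
          Polynomial.coeff_mul_C, Polynomial.coeff_mul_X]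
      have h2 := hle2 n' hn'
      have hcases : n'.degree = 0 ∨ n'.degree = 1 ∨ n'.degree = 2 := by omega
      rcases hcases with h | h | h
      · have hne : n' ≠ m := by rintro rfl; omega
        have h0 : n' = 0 := (Finsupp.degree_eq_zero_iff n').1 h
        subst h0
        rw [if_neg hne, ← hk₀, coordM_monomial hb, Pi.single_eq_same, mul_one, hk₀, ha]
        simp [hW]
      · have hne : n' ≠ m := by rintro rfl; omega
        rw [if_neg hne, hdegone n' h, mul_zero]
        simp [hW, h]
      · obtain ⟨x, y, hxy⟩ := hdegtwo n' h
        have hx : W n' = x := by simp [hW, h, hxy]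
        have hy : (coordM bM (MvPolynomial.monomial n' 1) k₀).coeff 1 = y := by
          simp [hxy, Polynomial.coeff_C]
        rw [hx, hxy, hlin]
        congr 1
        split_ifs with hnm
        · subst hnm; rw [hT, hy]
        · rw [← hy, ih n' (hm.2 n' hn' hnm) h, mul_zero]
    have h3 := congrArg (fun a => a.coeff 1) hsum
    simp only [Polynomial.finsetSum_coeff, Polynomial.coeff_zero] at h3
    rw [Finset.sum_congr rfl hterm, Finset.sum_add_distrib, Finset.sum_ite_eq' g.support m,
      if_pos hm.1] at h3
    obtain ⟨c, hc⟩ : IsUnit ((g.coeff m).coeff 0) :=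
      (Polynomial.isUnit_iff_coeff_isUnit_isNilpotent.1 hu).1
    have h4 : T = ∑ n' ∈ g.support, (-(↑c⁻¹ : K.Elem) * (g.coeff n').coeff 1) * W n' := by
      simp only [mul_assoc]
      have h5 : ∀ S : K.Elem, S + (g.coeff m).coeff 0 * T = 0 → T = -(↑c⁻¹ : K.Elem) * S :=
        fun S hS => by
          rw [← hc] at hS
          linear_combination (↑c⁻¹ : K.Elem) * hS - T * c.inv_mul
      exact (h5 _ h3).trans (Finset.mul_sum g.support (fun x => (g.coeff x).coeff 1 * W x)
        (-(↑c⁻¹ : K.Elem)))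
    -- T has degree 4 − 2 = 2 because of the factor h, whereas every W n' has degree 4; so the
    -- combination `h4` forces T = 0.
    have hTd : K.IsHomog w T 2 := by
      have := coordM_isHomog hb hd m k₀ 1
      rw [hn, hk₀] at this
      simpa using this
    refine eq_zero_of_eq_sum_mul (by norm_num : (2 : ℤ) < 4) g.support hTd (fun n' => ?_) h4
    simp only [hW]
    split_ifs with h
    · have := coordM_isHomog hb hd n' k₀ 0
      rw [h, hk₀] at this
      simpa using this
    · simp [IsHomog]

/-- The coefficients of h⁰, h¹, h² in `connection_flatness` give the first three properties. In the
column of h∂ⱼ the entry of θᵢ in row P_k has degree 2 − 2|e_k|: negative for |e_k| ≥ 2, while the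
row of 1 is settled by `coeff_one_coordM_eq_zero`. -/
theorem isFlatConnection (hA : IsDeformation K w s R) (hM : IsQuantization K s R d)
    (hd : ∀ l, IsHomogOp K w (d l)) (hG : IsGroebner K (leftIdeal K d) G)
    (hG2 : ZerothTermsConstant K G) (he : Function.Injective e)
    (he' : Set.range e = standardExps K G) (hΩ : HasConnectionForm K d e ω θ)
    (hk₀ : e k₀ = 0) (hκ : ∀ i, e (κ i) = Finsupp.single i 1) :
    IsFlatConnection K ω θ k₀ κ := by
  set bM := standardBasis hG he he' with hbM
  have hb : ∀ j, bM j = clsM K d (MvPolynomial.monomial (e j) 1) := standardBasis_apply hG he he'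
  have hflat := connection_flatness hb hΩ
  have hcoeff : ∀ (i j : Fin r) (k l : Fin (s + 1)) (n : ℕ), _ :=
    fun i j k l n => congrArg (fun a => a.coeff n) (hflat i j k l)
  simp only [Polynomial.coeff_add, Polynomial.finsetSum_coeff, coeff_linear_mul,
    coeff_hdel_linear] at hcoeff
  have hlin : ∀ {a b a' b' : K.Elem}, Polynomial.C a + Polynomial.X * Polynomial.C b =
      Polynomial.C a' + Polynomial.X * Polynomial.C b' → a = a' ∧ b = b' := fun {a b a' b'} h => by
    have h0 := congrArg (fun p => p.coeff 0) h
    have h1 := congrArg (fun p => p.coeff 1) h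
    simp [Polynomial.coeff_C] at h0 h1
    exact ⟨h0, h1⟩
  -- h∂ᵢ · 1 is itself a standard monomial, so its expansion has no term in h.
  have hone : ∀ i k, θ i k k₀ = 0 := fun i k => by
    have h := coordM_X_mul hb hΩ i k₀ k
    rw [hk₀, MvPolynomial.X, MvPolynomial.monomial_mul, add_zero, one_mul, ← hκ i,
      coordM_monomial hb, Pi.single_apply] at h
    refine (hlin (a' := if k = κ i then 1 else 0) (h.symm.trans ?_)).2
    split_ifs <;> simp
  have hXX : ∀ i j, (MvPolynomial.X i * MvPolynomial.monomial (e (κ j)) 1 : Sym K) =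
      MvPolynomial.monomial (Finsupp.single i 1 + Finsupp.single j 1) 1 := fun i j => by
    rw [hκ, MvPolynomial.X, MvPolynomial.monomial_mul, one_mul]
  have hsym : ∀ i j k, θ i k (κ j) = θ j k (κ i) := fun i j k => by
    refine (hlin (a := ω i k (κ j)) (a' := ω j k (κ i)) ?_).2
    rw [← coordM_X_mul hb hΩ, ← coordM_X_mul hb hΩ, hXX, hXX, add_comm (Finsupp.single j 1)]
  refine ⟨fun i j => ?_, fun i j => ?_, fun i j => ?_, hone, hsym,
    fun i j k hk => ?_, fun i j hij => ?_⟩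
  · ext k l
    simpa [Matrix.mul_apply] using hcoeff i j k l 0
  · ext k l
    have := hcoeff i j k l 1
    simp only [one_ne_zero, if_false, if_true, Finset.sum_add_distrib] at this
    rw [add_comm] at this
    rw [Matrix.add_apply, Matrix.add_apply, Matrix.add_apply, Matrix.add_apply, Matrix.mul_apply,
      Matrix.mul_apply, Matrix.mul_apply, Matrix.mul_apply, Matrix.map_apply, Matrix.map_apply,
      this, add_comm]
  · ext k l
    have := hcoeff i j k l 2
    norm_num at this
    rw [add_comm] at this
    rw [Matrix.add_apply, Matrix.add_apply, Matrix.mul_apply,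
      Matrix.mul_apply, Matrix.map_apply, Matrix.map_apply, this, add_comm]
  · have h1 : θ i k (κ j) = (coordM bM (MvPolynomial.monomial
        (Finsupp.single i 1 + Finsupp.single j 1) 1) k).coeff 1 := by
      rw [← hXX, coordM_X_mul hb hΩ]
      simp [Polynomial.coeff_C]
    have h2 : ((Finsupp.single i 1 + Finsupp.single j 1 : Fin r →₀ ℕ)).degree = 2 := by simp
    rw [h1]
    by_cases hk0 : k = k₀
    · subst hk0
      exact coeff_one_coordM_eq_zero hb hd hG
        (fun g hg m hm => two_le_degree_of_isLeading hA hM hG hg hm) hG2 he' hk₀ hκ hΩ _ h2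
    · have h3 := coordM_isHomog hb hd (Finsupp.single i 1 + Finsupp.single j 1) k 1
      rw [h2] at h3
      refine eq_zero_of_isHomog_neg ?_ h3
      have h4 : 2 ≤ (e k).degree := by
        by_contra! h
        have h5 : (e k).degree = 0 ∨ (e k).degree = 1 := by omega
        rcases h5 with h5 | h5
        · exact hk0 (he (by rw [hk₀, (Finsupp.degree_eq_zero_iff _).1 h5]))
        · obtain ⟨l, hl⟩ := exists_eq_single_of_degree_eq_one h5
          exact hk l (he (by rw [hl, hκ]))
      push_cast; omega
  · have := (hκ i).symm.trans ((congrArg e hij).trans (hκ j))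
    exact (Finsupp.single_left_inj one_ne_zero).1 this

theorem X_mul_monomial_sub_mem (hM : IsQuantization K s R d) (hΩ : HasConnectionForm K d e ω θ)
    (i : Fin r) (j : Fin (s + 1)) : MvPolynomial.X i * MvPolynomial.monomial (e j) 1 -
      ∑ k, ω i k j • MvPolynomial.monomial (e k) 1 ∈ relIdeal K R := by
  have h1 : MvPolynomial.X i * MvPolynomial.monomial (e j) 1 - ∑ k, (Polynomial.C (ω i k j) +
      Polynomial.X * Polynomial.C (θ i k j)) • (MvPolynomial.monomial (e k) 1 : Sym K) ∈
      leftIdeal K d := by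
    rw [← clsM_eq_zero_iff, clsM, map_sub, map_sum, sub_eq_zero]
    simp only [map_smul]
    exact hΩ i j
  have h2 := map_mem_relIdeal hM.limit h1
  simpa [MvPolynomial.smul_eq_C_mul] using h2

end Flat
end

section
variable {r : ℕ}
open CoeffAlgebra Set Topology

/-! ### Evaluation at q = exp t, and the gauge transformation. -/

section EvalMat

variable {K : CoeffAlgebra r} {n : ℕ} {z t : Fin r → ℂ}

theorem evalMat_apply (M : Matrix (Fin n) (Fin n) K.Elem) (z : Fin r → ℂ) (k j : Fin n) :
    evalMat K M z k j = K.fn (M k j) z := rfl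

theorem evalMat_mul (M N : Matrix (Fin n) (Fin n) K.Elem) (hz : z ∈ K.V) :
    evalMat K (M * N) z = evalMat K M z * evalMat K N z := by
  ext k j
  simp only [evalMat_apply, Matrix.mul_apply, fn_sum _ _ hz, fn_mul _ _ hz]

theorem evalMat_add (M N : Matrix (Fin n) (Fin n) K.Elem) (hz : z ∈ K.V) :
    evalMat K (M + N) z = evalMat K M z + evalMat K N z := by
  ext k j
  simp only [evalMat_apply, Matrix.add_apply, fn_add _ _ hz]

theorem holMatOn_evalMat (M : Matrix (Fin n) (Fin n) K.Elem) : HolMatOn (evalMat K M) K.V :=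
  fun k j => differentiableOn_fn (M k j)

theorem holMatOn_evalMat_expMap (M : Matrix (Fin n) (Fin n) K.Elem) :
    HolMatOn (fun t => evalMat K M (expMap t)) (expMap ⁻¹' K.V) :=
  (holMatOn_evalMat M).comp differentiable_expMap.differentiableOn fun _ h => h

theorem isOpen_preimage_expMap {U : Set (Fin r → ℂ)} (hU : IsOpen U) : IsOpen (expMap ⁻¹' U) :=
  hU.preimage differentiable_expMap.continuous

theorem matPd_evalMat_expMap (M : Matrix (Fin n) (Fin n) K.Elem) (ht : expMap t ∈ K.V) (i : Fin r) :
    matPd i (fun x => evalMat K M (expMap x)) t = evalMat K (M.map (K.del i)) (expMap t) := by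
  rw [matPd_comp_expMap isOpen_V (holMatOn_evalMat M) ht]
  ext k j
  rw [evalMat_apply, Matrix.map_apply, fn_del _ _ ht]
  rfl

end EvalMat

section Gauge

variable {K : CoeffAlgebra r} {s : ℕ} {ω θ : Fin r → Matrix (Fin (s + 1)) (Fin (s + 1)) K.Elem}
  {k₀ : Fin (s + 1)} {κ : Fin r → Fin (s + 1)}
  {φ : OpenPartialHomeomorph (Fin r → ℂ) (Fin r → ℂ)}
  {Q : (Fin r → ℂ) → Matrix (Fin (s + 1)) (Fin (s + 1)) ℂ}

/-- The coefficient of `dt̂_j` in `Q ω Q⁻¹`. -/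
def gaugedForm (K : CoeffAlgebra r) (ω : Fin r → Matrix (Fin (s + 1)) (Fin (s + 1)) K.Elem)
    (φ : OpenPartialHomeomorph (Fin r → ℂ) (Fin r → ℂ))
    (Q : (Fin r → ℂ) → Matrix (Fin (s + 1)) (Fin (s + 1)) ℂ) (j : Fin r) (τ : Fin r → ℂ) :
    Matrix (Fin (s + 1)) (Fin (s + 1)) ℂ :=
  ∑ i, jac φ.symm τ i j • (Q (φ.symm τ) * evalMat K (ω i) (expMap (φ.symm τ)) * (Q (φ.symm τ))⁻¹)

theorem jac_symm_mul_jac (hφ : DifferentiableOn ℂ φ φ.source)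
    (hJ : ∀ t ∈ φ.source, (jac φ t).det ≠ 0) {t : Fin r → ℂ} (ht : t ∈ φ.source) :
    jac φ.symm (φ t) * jac φ t = 1 := by
  ext j i
  have hs := (differentiableOn_symm hφ hJ).differentiableAt
    (φ.open_target.mem_nhds (φ.map_source ht))
  rw [Matrix.mul_apply]
  have h := pd_comp (f := fun y => φ.symm y j) (differentiableAt_pi.1 hs j)
    (hφ.differentiableAt (φ.open_source.mem_nhds ht)) i
  refine h.symm.trans ?_
  rw [pd_congr_of_eqOn φ.open_source (g := fun x => x j)
    (fun x hx => by simp only [φ.left_inv hx]) ht, pd_coord, Matrix.one_apply]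

/-- As dQ = Qθ, the term Q d(Q⁻¹) equals −QθQ⁻¹ and removes θ for every h, leaving (1/h) QωQ⁻¹.
Conjugation by Q turns closedness with respect to d + θ into ordinary closedness and preserves
commutation. -/
theorem isMirrorGauge_gaugedForm (hC : IsFlatConnection K ω θ k₀ κ)
    (hV : ∀ t ∈ φ.source, expMap t ∈ K.V) (hφ : DifferentiableOn ℂ φ φ.source)
    (hJ : ∀ t ∈ φ.source, (jac φ t).det ≠ 0) (hQ : HolMatOn Q φ.source)
    (hdet : ∀ t ∈ φ.source, (Q t).det ≠ 0)
    (hpd : ∀ t ∈ φ.source, ∀ i, matPd i Q t = Q t * evalMat K (θ i) (expMap t))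
    (hone : ∀ t ∈ φ.source, ∀ k, Q t k k₀ = if k = k₀ then 1 else 0)
    (hdel : ∀ t ∈ φ.source, ∀ i k, Q t k (κ i) = ∑ j, if k = κ j then jac φ t j i else 0) :
    IsMirrorGauge K ω θ k₀ κ φ Q (gaugedForm K ω φ Q) := by
  have hopen := φ.open_source
  have hsymm := differentiableOn_symm hφ hJ
  have hinv := hQ.inv hdet
  have hu : ∀ x ∈ φ.source, IsUnit (Q x).det := fun x hx => (hdet x hx).isUnit
  have hω : ∀ M : Matrix (Fin (s + 1)) (Fin (s + 1)) K.Elem,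
      HolMatOn (fun t => evalMat K M (expMap t)) φ.source := fun M =>
    (holMatOn_evalMat_expMap M).mono hV
  set Ω : Fin r → (Fin r → ℂ) → Matrix (Fin (s + 1)) (Fin (s + 1)) ℂ := fun i t =>
    Q t * evalMat K (ω i) (expMap t) * (Q t)⁻¹ with hΩ
  have hΩh : ∀ i, HolMatOn (Ω i) φ.source := fun i => (hQ.mul (hω _)).mul hinv
  have hinvpd : ∀ t ∈ φ.source, ∀ i, matPd i (fun x => (Q x)⁻¹) t =
      -(evalMat K (θ i) (expMap t) * (Q t)⁻¹) := fun t ht i => by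
    rw [matPd_inv hopen hQ hdet ht, hpd t ht i, ← mul_assoc (Q t)⁻¹,
      Matrix.nonsing_inv_mul _ (hu t ht), one_mul]
  have hΩpd : ∀ t ∈ φ.source, ∀ i j, matPd i (Ω j) t = matPd j (Ω i) t := fun t ht i j => by
    -- ∂ᵢ(QωⱼQ⁻¹) = Q(∂ᵢωⱼ + [θᵢ, ωⱼ])Q⁻¹, where the middle factor is symmetric in i and j by
    -- `closed`.
    have h1 : ∀ i j, matPd i (Ω j) t = Q t * (evalMat K ((ω j).map (K.del i)) (expMap t) +
        evalMat K (θ i) (expMap t) * evalMat K (ω j) (expMap t) -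
        evalMat K (ω j) (expMap t) * evalMat K (θ i) (expMap t)) * (Q t)⁻¹ := fun i j => by
      rw [hΩ, matPd_mul hopen (hQ.mul (hω _)) hinv ht, matPd_mul hopen hQ (hω _) ht, hpd t ht i,
        hinvpd t ht, matPd_evalMat_expMap _ (hV t ht)]
      simp only [mul_add, add_mul, mul_sub, sub_mul, mul_assoc, mul_neg]
      abel
    have h2 := congrArg (fun M => evalMat K M (expMap t)) (hC.closed i j)
    simp only [evalMat_add _ _ (hV t ht), evalMat_mul _ _ (hV t ht)] at h2
    rw [h1, h1]
    congr 2
    rw [sub_eq_sub_iff_add_eq_add, add_assoc, add_assoc]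
    rw [add_comm (_ * _) (_ * _), h2, add_comm (_ * _) (_ * _)]
  refine ⟨hV, hφ, hsymm, hQ, hdet, hone, hdel, fun j => ?_, fun h hh t ht i => ?_,
    fun τ hτ i j => ?_, fun τ hτ i j => ?_⟩
  · refine HolMatOn.sum_smul (c := fun i τ => jac φ.symm τ i j) (M := fun i τ => Ω i (φ.symm τ))
      (fun i => ?_) fun i => (hΩh i).comp hsymm φ.mapsTo_symm
    exact differentiableOn_pd φ.open_target (differentiableOn_pi.1 hsymm i) j
  · have hJJ := jac_symm_mul_jac hφ hJ ht
    have h1 : ∑ j, jac φ t j i • gaugedForm K ω φ Q j (φ t) = Ω i t := by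
      simp only [gaugedForm, φ.left_inv ht, Finset.smul_sum, smul_smul]
      rw [Finset.sum_comm]
      have h2 : ∀ l, ∑ j, jac φ t j i * jac φ.symm (φ t) l j =
          (1 : Matrix (Fin r) (Fin r) ℂ) l i := fun l => by
        rw [← hJJ, Matrix.mul_apply]
        exact Finset.sum_congr rfl fun j _ => mul_comm _ _
      simp only [← Finset.sum_smul, h2, Matrix.one_apply, ite_smul, one_smul, zero_smul]
      rw [Finset.sum_ite_eq' Finset.univ i, if_pos (Finset.mem_univ i)]
    rw [h1, gauge, hinvpd t ht, connForm, mul_neg, ← mul_assoc, mul_add, add_mul,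
      add_neg_cancel_right, Matrix.mul_smul, Matrix.smul_mul]
  · have hs := φ.map_target hτ
    ext a b
    -- Pullback of a closed form by φ.symm: the first part is symmetric in i, j because the form is
    -- closed, the second because second derivatives are symmetric.
    have hent : ∀ i j, matPd i (gaugedForm K ω φ Q j) τ a b = ∑ l, ((∑ m,
        pd m (fun x => Ω l x a b) (φ.symm τ) * jac φ.symm τ m i) * jac φ.symm τ l j +
          Ω l (φ.symm τ) a b * pd i (pd j fun y => φ.symm y l) τ) := fun i j => by
      have hdl : ∀ l, DifferentiableAt ℂ (fun y => Ω l (φ.symm y) a b) τ := fun l =>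
        ((hΩh l).comp hsymm φ.mapsTo_symm a b).differentiableAt (φ.open_target.mem_nhds hτ)
      have hds : ∀ l, DifferentiableAt ℂ (pd j fun y => φ.symm y l) τ := fun l =>
        (differentiableOn_pd φ.open_target (differentiableOn_pi.1 hsymm l) j).differentiableAt
          (φ.open_target.mem_nhds hτ)
      have h1 : ∀ y, gaugedForm K ω φ Q j y a b =
          ∑ l, Ω l (φ.symm y) a b * pd j (fun y => φ.symm y l) y := fun y => by
        simp only [gaugedForm, Matrix.sum_apply, Matrix.smul_apply, smul_eq_mul]
        exact Finset.sum_congr rfl fun l _ => mul_comm _ _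
      simp only [matPd, Matrix.of_apply, h1]
      rw [pd_sum (f := fun l y => Ω l (φ.symm y) a b * pd j (fun y => φ.symm y l) y) _
        fun l _ => (hdl l).mul (hds l)]
      refine Finset.sum_congr rfl fun l _ => ?_
      rw [pd_mul (hdl l) (hds l), pd_comp (f := fun x => Ω l x a b)
        ((hΩh l a b).differentiableAt (hopen.mem_nhds hs))
        (hsymm.differentiableAt (φ.open_target.mem_nhds hτ))]
      rfl
    rw [hent, hent]
    simp only [Finset.sum_add_distrib, Finset.sum_mul]
    congr 1
    · rw [Finset.sum_comm]
      refine Finset.sum_congr rfl fun m _ => Finset.sum_congr rfl fun l _ => ?_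
      have h2 := congrFun (congrFun (hΩpd _ hs m l) a) b
      simp only [matPd, Matrix.of_apply] at h2
      rw [h2]; ring
    · refine Finset.sum_congr rfl fun l _ => ?_
      rw [pd_comm φ.open_target (differentiableOn_pi.1 hsymm l) hτ]
  · have hs := φ.map_target hτ
    have h1 : ∀ i j, Ω i (φ.symm τ) * Ω j (φ.symm τ) = Ω j (φ.symm τ) * Ω i (φ.symm τ) :=
      fun i j => by
        have h2 : ∀ i j, Ω i (φ.symm τ) * Ω j (φ.symm τ) = Q (φ.symm τ) *
            evalMat K (ω i * ω j) (expMap (φ.symm τ)) * (Q (φ.symm τ))⁻¹ := fun i j => by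
          simp only [hΩ]
          rw [evalMat_mul _ _ (hV _ hs)]
          simp only [mul_assoc]
          rw [← mul_assoc (Q (φ.symm τ))⁻¹ (Q (φ.symm τ)), Matrix.nonsing_inv_mul _ (hu _ hs),
            one_mul]
        rw [h2, h2, hC.comm]
    have hdef : ∀ i, gaugedForm K ω φ Q i τ = ∑ l, jac φ.symm τ l i • Ω l (φ.symm τ) :=
      fun i => rfl
    simp only [hdef, Finset.sum_mul, Finset.mul_sum, Matrix.smul_mul, Matrix.mul_smul, smul_smul]
    rw [Finset.sum_comm]
    refine Finset.sum_congr rfl fun m _ => Finset.sum_congr rfl fun l _ => ?_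
    rw [h1, mul_comm]

end Gauge
end

section
variable {r : ℕ}
open CoeffAlgebra Set Topology

/-! ### The isomorphism δ and the transported product. -/

section SubstHat

theorem substHat_X (J : Matrix (Fin r) (Fin r) ℂ) (i : Fin r) :
    substHat J (MvPolynomial.X i) = ∑ j, J j i • MvPolynomial.X j := by
  simp only [substHat, MvPolynomial.aeval_X, MvPolynomial.smul_eq_C_mul]

theorem substHat_substHat (J J' : Matrix (Fin r) (Fin r) ℂ) (p : MvPolynomial (Fin r) ℂ) :
    substHat J (substHat J' p) = substHat (J * J') p := by
  suffices h : (substHat J).comp (substHat J') = substHat (J * J') from DFunLike.congr_fun h p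
  refine MvPolynomial.algHom_ext fun i => ?_
  rw [AlgHom.comp_apply, substHat_X, map_sum, substHat_X]
  simp only [map_smul, substHat_X, Finset.smul_sum, smul_smul, Matrix.mul_apply, Finset.sum_smul]
  rw [Finset.sum_comm]
  simp only [mul_comm]

theorem substHat_one (p : MvPolynomial (Fin r) ℂ) : substHat 1 p = p := by
  have : (substHat 1 : MvPolynomial (Fin r) ℂ →ₐ[ℂ] _) = AlgHom.id ℂ _ := by
    refine MvPolynomial.algHom_ext fun i => ?_
    rw [substHat_X]
    simp [Matrix.one_apply]
  rw [this, AlgHom.id_apply]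

variable {K : CoeffAlgebra r} {u : ℕ} {R : Fin u → MvPolynomial (Fin r) K.Elem} {q : K.V}
  {J J' : Matrix (Fin r) (Fin r) ℂ}

/-- The substitution by J is an automorphism whose inverse is the substitution by J'. -/
theorem mem_relIdealHat_iff (hJ : J' * J = 1) {p : MvPolynomial (Fin r) ℂ} :
    p ∈ relIdealHat K R q J ↔ substHat J' p ∈ relIdealAt R q := by
  have hmap : relIdealHat K R q J = Ideal.map (substHat J) (relIdealAt R q) := by
    rw [relIdealHat, relIdealAt, relIdeal, Ideal.map_span, ← range_comp, Ideal.map_span,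
      ← range_comp]
    rfl
  rw [hmap]
  constructor
  · intro hp
    have : Ideal.map (substHat J) (relIdealAt R q) ≤
        Ideal.comap (substHat J') (relIdealAt R q) := by
      rw [Ideal.map_le_iff_le_comap]
      intro x hx
      rw [Ideal.mem_comap, Ideal.mem_comap, substHat_substHat, hJ, substHat_one]
      exact hx
    exact this hp
  · intro hp
    have := Ideal.mem_map_of_mem (substHat J) hp
    rwa [substHat_substHat, mul_eq_one_comm.1 hJ, substHat_one] at this

end SubstHat

section Product

variable {K : CoeffAlgebra r} {s u : ℕ} {R : Fin u → MvPolynomial (Fin r) K.Elem}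
  (bA : Module.Basis (Fin (s + 1)) K.Elem (AlgA K R))
  (B : Module.Basis (Fin (s + 1)) ℂ (AlgA₀ K R))

/-- The multiplication of the fibre of `𝒜` at the point `z`, in coordinates. -/
def fibreMul (z : Fin r → ℂ) (v v' : Fin (s + 1) → ℂ) : Fin (s + 1) → ℂ := fun k =>
  ∑ i, ∑ j, K.fn (bA.repr (bA i * bA j) k) z * (v i * v' j)

/-- The multiplication of the fibre at `z`, transported to `𝒜₀` by the matrix `Q`. -/
def transportedMul (z : Fin r → ℂ) (Q : Matrix (Fin (s + 1)) (Fin (s + 1)) ℂ) (x y : AlgA₀ K R) :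
    AlgA₀ K R :=
  B.equivFun.symm (Q.mulVec (fibreMul bA z (Q⁻¹.mulVec (B.equivFun x)) (Q⁻¹.mulVec (B.equivFun y))))

/-- The linear map from polynomials in the new variables to `𝒜₀` which is given by the coordinates
in the fibre of `𝒜` at `q` and the gauge transformation `Q`. -/
def hatLinear (q : K.V) (J : Matrix (Fin r) (Fin r) ℂ)
    (Q : Matrix (Fin (s + 1)) (Fin (s + 1)) ℂ) : MvPolynomial (Fin r) ℂ →ₗ[ℂ] AlgA₀ K R :=
  B.equivFun.symm.toLinearMap ∘ₗ Matrix.mulVecLin Q ∘ₗ coordAt bA q ∘ₗ (substHat J).toLinearMap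

theorem hatLinear_apply (q : K.V) (J : Matrix (Fin r) (Fin r) ℂ)
    (Q : Matrix (Fin (s + 1)) (Fin (s + 1)) ℂ) (p : MvPolynomial (Fin r) ℂ) :
    hatLinear bA B q J Q p = B.equivFun.symm (Q.mulVec (coordAt bA q (substHat J p))) := rfl

variable {bA B} {e : Fin (s + 1) → Fin r →₀ ℕ}

/-- The kernel of `coordAt` is the ideal of the fibre and Q is invertible, so `hatLinear` descends
to an isomorphism. This is δ. -/
theorem exists_hatEquiv
    (hb : ∀ j, bA j = Ideal.Quotient.mk (relIdeal K R) (MvPolynomial.monomial (e j) 1))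
    {q : K.V} {J J' : Matrix (Fin r) (Fin r) ℂ} (hJ : J' * J = 1)
    {Q : Matrix (Fin (s + 1)) (Fin (s + 1)) ℂ} (hQ : Q.det ≠ 0) :
    ∃ δ : AlgHat K R q J ≃ₗ[ℂ] AlgA₀ K R, ∀ p, δ (clsHat K R q J p) = hatLinear bA B q J' Q p := by
  have hu : IsUnit Q.det := hQ.isUnit
  have hker : ∀ p, hatLinear bA B q J' Q p = 0 ↔ p ∈ relIdealHat K R q J := fun p => by
    rw [mem_relIdealHat_iff hJ, ← coordAt_eq_zero_iff hb, hatLinear_apply, LinearEquiv.map_eq_zero_iff]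
    refine ⟨fun h => ?_, fun h => by rw [h, Matrix.mulVec_zero]⟩
    have := congrArg (Q⁻¹.mulVec ·) h
    simpa [Matrix.mulVec_mulVec, Matrix.nonsing_inv_mul _ hu] using this
  have hle : (relIdealHat K R q J).restrictScalars ℂ ≤ LinearMap.ker (hatLinear bA B q J' Q) :=
    fun p hp => LinearMap.mem_ker.2 ((hker p).2 hp)
  let f : AlgHat K R q J →ₗ[ℂ] AlgA₀ K R :=
    ((relIdealHat K R q J).restrictScalars ℂ).liftQ (hatLinear bA B q J' Q) hle ∘ₗ
      (Submodule.Quotient.restrictScalarsEquiv ℂ (relIdealHat K R q J)).symm.toLinearMap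
  have hf : ∀ p, f (clsHat K R q J p) = hatLinear bA B q J' Q p := fun p => rfl
  refine ⟨LinearEquiv.ofBijective f ⟨?_, fun y => ?_⟩, hf⟩
  · rw [injective_iff_map_eq_zero]
    intro x hx
    obtain ⟨p, rfl⟩ := Ideal.Quotient.mk_surjective x
    exact Ideal.Quotient.eq_zero_iff_mem.2 ((hker p).1 ((hf p).symm.trans hx))
  · set v := Q⁻¹.mulVec (B.equivFun y) with hv
    refine ⟨clsHat K R q J (substHat J (∑ k, v k • MvPolynomial.monomial (e k) 1)), ?_⟩
    rw [hf, hatLinear_apply, substHat_substHat, hJ, substHat_one, map_sum]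
    simp only [map_smul, coordAt_monomial hb]
    have : ∑ k, v k • (Pi.single k 1 : Fin (s + 1) → ℂ) = v := by
      funext k; simp [Finset.sum_apply, Pi.single_apply]
    rw [this, hv, Matrix.mulVec_mulVec, Matrix.mul_nonsing_inv _ hu, Matrix.one_mulVec,
      LinearEquiv.symm_apply_apply]

theorem hatLinear_mul
    (hb : ∀ j, bA j = Ideal.Quotient.mk (relIdeal K R) (MvPolynomial.monomial (e j) 1))
    {q : K.V} {J' : Matrix (Fin r) (Fin r) ℂ}
    {Q : Matrix (Fin (s + 1)) (Fin (s + 1)) ℂ} (hQ : Q.det ≠ 0) (p p' : MvPolynomial (Fin r) ℂ) :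
    hatLinear bA B q J' Q (p * p') =
      transportedMul bA B q.1 Q (hatLinear bA B q J' Q p) (hatLinear bA B q J' Q p') := by
  have hu : IsUnit Q.det := hQ.isUnit
  simp only [transportedMul, hatLinear_apply, LinearEquiv.apply_symm_apply, Matrix.mulVec_mulVec,
    Matrix.nonsing_inv_mul _ hu, Matrix.one_mulVec, map_mul]
  congr 2
  funext k
  rw [coordAt_mul hb, fibreMul]
  simp only [fn_eq_eval]

variable {ω θ : Fin r → Matrix (Fin (s + 1)) (Fin (s + 1)) K.Elem}
  {k₀ : Fin (s + 1)} {κ : Fin r → Fin (s + 1)}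
  {φ : OpenPartialHomeomorph (Fin r → ℂ) (Fin r → ℂ)}
  {Q : (Fin r → ℂ) → Matrix (Fin (s + 1)) (Fin (s + 1)) ℂ}

/-- The column of 1 in Q gives δ(1) = 1. Since b̂ᵢ = ∑ⱼ (∂tⱼ/∂t̂ᵢ) bⱼ, the Jacobian block of Q
cancels these coefficients and gives δ(b̂ᵢ) = [[bᵢ]]. Multiplication by b̂ᵢ is conjugated by Q into
ω̂ᵢ. -/
theorem isQuantumProduct_transportedMul
    (hb : ∀ j, bA j = Ideal.Quotient.mk (relIdeal K R) (MvPolynomial.monomial (e j) 1))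
    
    (hω : ∀ i j, MvPolynomial.X i * MvPolynomial.monomial (e j) 1 -
      ∑ k, ω i k j • MvPolynomial.monomial (e k) 1 ∈ relIdeal K R)
    (hB : ∀ j, B j = cls₀ K R (MvPolynomial.monomial (e j) 1))
    (hk₀ : e k₀ = 0) (hκ : ∀ i, e (κ i) = Finsupp.single i 1)
    (hJ : ∀ t ∈ φ.source, (jac φ t).det ≠ 0)
    (hmg : IsMirrorGauge K ω θ k₀ κ φ Q (gaugedForm K ω φ Q)) :
    IsQuantumProduct K R e φ Q (gaugedForm K ω φ Q) fun τ =>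
      transportedMul bA B (expMap (φ.symm τ)) (Q (φ.symm τ)) := by
  intro t ht
  have hJJ := jac_symm_mul_jac hmg.holo hJ ht
  have hu : IsUnit (Q t).det := (hmg.det_Q t ht).isUnit
  set q : K.V := ⟨expMap t, hmg.mem_V t ht⟩ with hq
  obtain ⟨δ, hδ⟩ := exists_hatEquiv (B := B) hb (q := q) hJJ (hmg.det_Q t ht)
  have hsymm : ∀ p, δ.symm (hatLinear bA B q (jac φ.symm (φ t)) (Q t) p) =
      clsHat K R q (jac φ t) p := fun p => by rw [← hδ, LinearEquiv.symm_apply_apply]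
  have hBv : ∀ v : Fin (s + 1) → ℂ, B.equivFun.symm v =
      ∑ k, v k • cls₀ K R (MvPolynomial.monomial (e k) 1) := fun v => by
    rw [Module.Basis.equivFun_symm_apply]
    simp only [hB]
  have hBs : ∀ k, B.equivFun.symm (Pi.single k 1) = cls₀ K R (MvPolynomial.monomial (e k) 1) :=
    fun k => by
      rw [hBv]
      simp [Pi.single_apply]
  have hX : ∀ i, coordAt bA q (MvPolynomial.X i) = Pi.single (κ i) 1 := fun i => by
    rw [← coordAt_monomial hb, hκ]; rfl
  have hLX : ∀ i, hatLinear bA B q (jac φ.symm (φ t)) (Q t) (MvPolynomial.X i) =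
      cls₀ K R (MvPolynomial.X i) := fun i => by
    have h1 : (MvPolynomial.X i : MvPolynomial (Fin r) ℂ) = MvPolynomial.monomial (e (κ i)) 1 := by
      rw [hκ]; rfl
    rw [h1, ← hBs, ← h1, hatLinear_apply, substHat_X, map_sum]
    simp only [map_smul, hX]
    congr 1
    funext k
    simp only [Matrix.mulVec, dotProduct, Finset.sum_apply, Pi.smul_apply, Pi.single_apply,
      smul_eq_mul, mul_ite, mul_one, mul_zero, Finset.mul_sum]
    rw [Finset.sum_comm]
    simp only [Finset.sum_ite_eq', Finset.mem_univ, if_true, hmg.col_del t ht, Finset.sum_mul,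
      ite_mul, zero_mul]
    rw [Finset.sum_comm]
    have h2 : ∀ l, ∑ j, (if k = κ l then jac φ t l j * jac φ.symm (φ t) j i else 0) =
        if k = κ l then (1 : Matrix (Fin r) (Fin r) ℂ) l i else 0 := fun l => by
      rw [← mul_eq_one_comm.1 hJJ, Matrix.mul_apply]
      split_ifs <;> simp
    simp only [h2, Matrix.one_apply]
    rw [Finset.sum_eq_single i (fun l _ hl => by simp [hl]) (by simp)]
    simp
  have hcol : ∀ j, hatLinear bA B q (jac φ.symm (φ t)) (Q t) (∑ k, (Q t)⁻¹ k j •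
      substHat (jac φ t) (MvPolynomial.monomial (e k) 1)) =
        cls₀ K R (MvPolynomial.monomial (e j) 1) := fun j => by
    rw [← hBs, hatLinear_apply, map_sum, map_sum]
    simp only [map_smul, substHat_substHat, hJJ, substHat_one, coordAt_monomial hb]
    have : ∑ k, (Q t)⁻¹ k j • (Pi.single k 1 : Fin (s + 1) → ℂ) = (Q t)⁻¹.mulVec (Pi.single j 1) := by
      funext k
      simp [Pi.single_apply]
    rw [this, Matrix.mulVec_mulVec, Matrix.mul_nonsing_inv _ hu, Matrix.one_mulVec]
  have hprod : ∀ x y, transportedMul bA B (expMap (φ.symm (φ t))) (Q (φ.symm (φ t))) x y =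
      δ (δ.symm x * δ.symm y) := fun x y => by
    obtain ⟨p, hp⟩ := Ideal.Quotient.mk_surjective (δ.symm x)
    obtain ⟨p', hp'⟩ := Ideal.Quotient.mk_surjective (δ.symm y)
    have h1 : x = hatLinear bA B q (jac φ.symm (φ t)) (Q t) p := by
      rw [← hδ]; exact (δ.symm_apply_eq.1 hp.symm)
    have h2 : y = hatLinear bA B q (jac φ.symm (φ t)) (Q t) p' := by
      rw [← hδ]; exact (δ.symm_apply_eq.1 hp'.symm)
    rw [φ.left_inv ht, ← hp, ← hp', ← map_mul]
    refine Eq.trans ?_ (hδ (p * p')).symm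
    rw [hatLinear_mul hb (hmg.det_Q t ht), ← h1, ← h2]
  refine ⟨q, rfl, δ, hprod, ?_, fun i => (hδ _).trans (hLX i), fun j => ?_, fun i j => ?_⟩
  · have h1 : (1 : MvPolynomial (Fin r) ℂ) = MvPolynomial.monomial (e k₀) 1 := by rw [hk₀]; rfl
    have h2 : (1 : AlgA₀ K R) = cls₀ K R (MvPolynomial.monomial (e k₀) 1) := by
      rw [← h1]; exact (map_one (Ideal.Quotient.mk (relIdeal₀ K R))).symm
    have h3 := hδ 1
    have h4 : clsHat K R q (jac φ t) 1 = 1 := map_one (Ideal.Quotient.mk _)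
    rw [h4] at h3
    rw [h3, h2, ← hBs, hatLinear_apply, map_one, h1, coordAt_monomial hb]
    congr 1
    funext k
    rw [Matrix.mulVec_single_one, Matrix.col_apply, hmg.col_one t ht, Pi.single_apply]
  · have h5 : ∑ k, (Q t)⁻¹ k j • clsHat K R q (jac φ t)
        (substHat (jac φ t) (MvPolynomial.monomial (e k) 1)) = clsHat K R q (jac φ t)
          (∑ k, (Q t)⁻¹ k j • substHat (jac φ t) (MvPolynomial.monomial (e k) 1)) := by
      simp only [clsHat]
      rw [← Ideal.Quotient.mkₐ_eq_mk ℂ, map_sum]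
      simp only [map_smul]
    rw [h5, hδ, hcol]
  · beta_reduce
    rw [φ.left_inv ht]
    conv_lhs => rw [← hLX i, ← hcol j]
    refine (hatLinear_mul hb (q := q) (hmg.det_Q t ht) _ _).symm.trans ?_
    rw [hatLinear_apply, map_mul, substHat_X, Finset.sum_mul,
      map_sum, hBv]
    refine Finset.sum_congr rfl fun k _ => ?_
    congr 1
    -- The coordinates of ĉ_j are column j of Q⁻¹; together with the factors ω and Q this produces
    -- QωQ⁻¹.
    have h6 : coordAt bA q (substHat (jac φ.symm (φ t)) (∑ k, (Q t)⁻¹ k j •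
        substHat (jac φ t) (MvPolynomial.monomial (e k) 1))) = fun l => (Q t)⁻¹ l j := by
      rw [map_sum, map_sum]
      simp only [map_smul, substHat_substHat, hJJ, substHat_one, coordAt_monomial hb]
      funext l
      simp [Pi.single_apply]
    simp only [smul_mul_assoc, map_smul, coordAt_X_mul hb hω, h6]
    simp only [gaugedForm, Matrix.sum_apply, Matrix.smul_apply, φ.left_inv ht, Matrix.mulVec_sum,
      Matrix.mulVec_smul, Finset.sum_apply, Pi.smul_apply]
    refine Finset.sum_congr rfl fun l _ => ?_
    congr 1
    have h7 : ((ω l).map (K.eval q)) = evalMat K (ω l) (expMap t) := by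
      ext a b
      rw [Matrix.map_apply, evalMat_apply, ← fn_eq_eval]
    rw [h7, Matrix.mulVec_mulVec]
    rfl

end Product
end

section
variable {r : ℕ}
open CoeffAlgebra Set Topology Metric

/-! ### The columns of Q, and flat coordinates near an arbitrary point. -/

section Block

variable {n : ℕ} {U : Set (Fin r → ℂ)} {Q : (Fin r → ℂ) → Matrix (Fin n) (Fin n) ℂ}
  {η : Fin r → (Fin r → ℂ) → Matrix (Fin n) (Fin n) ℂ} {k₀ : Fin n} {κ : Fin r → Fin n}

theorem pd_entry {x : Fin r → ℂ} {i : Fin r} {A : Matrix (Fin n) (Fin n) ℂ}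
    (h : matPd i Q x = Q x * A) (k j : Fin n) :
    pd i (fun y => Q y k j) x = ∑ b, Q x k b * A b j :=
  (congrFun (congrFun h k) j).trans (Matrix.mul_apply)

/-- The column with index `k₀` of a solution of `∂ᵢ Q = Q ηᵢ` is constant if that of each `ηᵢ` is
zero. -/
theorem column_one_of_flat (hU : IsOpen U) (hconv : Convex ℝ U) (hQ : HolMatOn Q U)
    (hpd : ∀ x ∈ U, ∀ i, matPd i Q x = Q x * η i x) {x₀ : Fin r → ℂ} (hx₀ : x₀ ∈ U)
    (h1 : Q x₀ = 1) (hone : ∀ x ∈ U, ∀ i k, η i x k k₀ = 0) {x : Fin r → ℂ} (hx : x ∈ U)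
    (k : Fin n) : Q x k k₀ = if k = k₀ then 1 else 0 := by
  have h := eq_zero_of_linear_system (ι := Unit) (y := fun _ x => Q x k k₀ - if k = k₀ then 1 else 0)
    (M := fun _ _ => 0) hU hconv (fun _ => (hQ k k₀).sub (differentiableOn_const _))
    (fun _ _ _ => continuousOn_const) (fun x hx i _ => ?_) hx₀ (fun _ => ?_) hx ()
  · exact sub_eq_zero.1 h
  · rw [pd_sub ((hQ k k₀).differentiableAt (hU.mem_nhds hx)) (differentiableAt_const _), pd_const,
      pd_entry (hpd x hx i)]
    simp [hone x hx]
  · rw [h1, Matrix.one_apply, sub_self]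

/-- The columns with indices in the range of `κ` of a solution of `∂ᵢ Q = Q ηᵢ` are supported on
the range of `κ` if those of each `ηᵢ` are. -/
theorem column_eq_zero_of_flat (hU : IsOpen U) (hconv : Convex ℝ U) (hQ : HolMatOn Q U)
    (hη : ∀ i, HolMatOn (η i) U) (hκ : Function.Injective κ)
    (hpd : ∀ x ∈ U, ∀ i, matPd i Q x = Q x * η i x) {x₀ : Fin r → ℂ} (hx₀ : x₀ ∈ U)
    (h1 : Q x₀ = 1) (hrow : ∀ x ∈ U, ∀ i j k, (∀ l, k ≠ κ l) → η i x k (κ j) = 0)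
    {x : Fin r → ℂ} (hx : x ∈ U) {k : Fin n} (hk : ∀ l, k ≠ κ l) (j : Fin r) :
    Q x k (κ j) = 0 := by
  -- The entries of row k in these columns satisfy a closed linear system, as the columns of η
  -- involved have no entries outside the range of κ; the initial values vanish because k is not in
  -- that range.
  refine eq_zero_of_linear_system (ι := Fin r) (y := fun a x => Q x k (κ a))
    (M := fun i x => Matrix.of fun b a => η i x (κ b) (κ a)) hU hconv (fun a => hQ k (κ a))
    (fun i a b => (hη i (κ a) (κ b)).continuousOn) (fun x hx i a => ?_) hx₀ (fun a => ?_) hx j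
  · rw [pd_entry (hpd x hx i)]
    refine (Fintype.sum_of_injective κ hκ _ _ (fun b hb => ?_) fun b => rfl).symm
    rw [hrow x hx i a b (fun l hl => hb ⟨l, hl.symm⟩), mul_zero]
  · rw [h1, Matrix.one_apply, if_neg (hk a)]

theorem column_eq_sum {A : Matrix (Fin n) (Fin n) ℂ} {J : Matrix (Fin r) (Fin r) ℂ}
    (hκ : Function.Injective κ) (hA : ∀ k, (∀ l, k ≠ κ l) → ∀ j, A k (κ j) = 0)
    (hJ : ∀ l j, J l j = A (κ l) (κ j)) (i : Fin r) (k : Fin n) :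
    A k (κ i) = ∑ j, if k = κ j then J j i else 0 := by
  by_cases hk : ∃ l, k = κ l
  · obtain ⟨l, rfl⟩ := hk
    simp [hκ.eq_iff, hJ]
  · push Not at hk
    rw [hA k hk, Finset.sum_eq_zero fun j _ => if_neg (hk j)]

theorem isOpen_inter_ne_zero {f : (Fin r → ℂ) → ℂ} (hU : IsOpen U) (hf : DifferentiableOn ℂ f U) :
    IsOpen (U ∩ {x | f x ≠ 0}) :=
  hf.continuousOn.isOpen_inter_preimage hU isOpen_ne

end Block

section Local

variable {K : CoeffAlgebra r} {s u : ℕ} {R : Fin u → MvPolynomial (Fin r) K.Elem}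
  {bA : Module.Basis (Fin (s + 1)) K.Elem (AlgA K R)}
  {B : Module.Basis (Fin (s + 1)) ℂ (AlgA₀ K R)} {e : Fin (s + 1) → Fin r →₀ ℕ}
  {ω θ : Fin r → Matrix (Fin (s + 1)) (Fin (s + 1)) K.Elem}
  {k₀ : Fin (s + 1)} {κ : Fin r → Fin (s + 1)}

theorem evalMat_θ_one (hC : IsFlatConnection K ω θ k₀ κ) {z : Fin r → ℂ} (hz : z ∈ K.V) (i k) :
    evalMat K (θ i) z k k₀ = 0 := by
  rw [evalMat_apply, hC.θ_one, fn_zero hz]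

theorem evalMat_θ_row (hC : IsFlatConnection K ω θ k₀ κ) {z : Fin r → ℂ} (hz : z ∈ K.V) (i j k)
    (hk : ∀ l, k ≠ κ l) : evalMat K (θ i) z k (κ j) = 0 := by
  rw [evalMat_apply, hC.θ_row i j k hk, fn_zero hz]

/-- Near every point there are flat coordinates and a gauge transformation. -/
theorem exists_mirrorGauge (hC : IsFlatConnection K ω θ k₀ κ) {t₀ : Fin r → ℂ}
    (ht₀ : expMap t₀ ∈ K.V) : ∃ (φ : OpenPartialHomeomorph (Fin r → ℂ) (Fin r → ℂ))
      (Q : (Fin r → ℂ) → Matrix (Fin (s + 1)) (Fin (s + 1)) ℂ), t₀ ∈ φ.source ∧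
      (∀ t ∈ φ.source, (jac φ t).det ≠ 0) ∧
      IsMirrorGauge K ω θ k₀ κ φ Q (gaugedForm K ω φ Q) := by
  obtain ⟨ρ, hρ, hball, Q, hQ1, hQ, hpd⟩ := exists_flat_frame
    (isOpen_preimage_expMap (isOpen_V (K := K))) (θ := fun i t => evalMat K (θ i) (expMap t))
    (fun i => holMatOn_evalMat_expMap _) (fun x hx i j => by
      have h := congrArg (fun M => evalMat K M (expMap x)) (hC.flat i j)
      simp only [evalMat_add _ _ hx, evalMat_mul _ _ hx] at h
      rw [matPd_evalMat_expMap _ hx, matPd_evalMat_expMap _ hx, h]) ht₀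
  have hV : ∀ x ∈ ball t₀ ρ, expMap x ∈ K.V := fun x hx => hball hx
  have hconv : Convex ℝ (ball t₀ ρ) := convex_ball _ _
  have hmem : t₀ ∈ ball t₀ ρ := mem_ball_self hρ
  -- By `θ_symm` each row of the block of Q is a closed 1-form; its primitive will be the coordinate
  -- t̂_l.
  have hcl : ∀ l, ∀ x ∈ ball t₀ ρ, ∀ i j, pd i (fun x => Q x (κ l) (κ j)) x =
      pd j (fun x => Q x (κ l) (κ i)) x := fun l x hx i j => by
    rw [pd_entry (hpd x hx i), pd_entry (hpd x hx j)]
    simp only [evalMat_apply, hC.θ_symm i j]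
  choose g _ hg hgpd using fun l => exists_primitive_of_pd_symm isOpen_ball hconv
    (F := fun j x => Q x (κ l) (κ j)) (fun j => hQ _ _) (hcl l) t₀ 0
  set φ : (Fin r → ℂ) → Fin r → ℂ := fun x l => g l x with hφ
  have hjac : ∀ x ∈ ball t₀ ρ, ∀ l j, jac φ x l j = Q x (κ l) (κ j) := fun x hx l j =>
    hgpd l x hx j
  have hφd : DifferentiableOn ℂ φ (ball t₀ ρ) := differentiableOn_pi.2 hg
  have hjach : HolMatOn (jac φ) (ball t₀ ρ) := fun l j => differentiableOn_pd isOpen_ball (hg l) j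
  have hU1 := isOpen_inter_ne_zero isOpen_ball hQ.det
  have hU2 := isOpen_inter_ne_zero isOpen_ball hjach.det
  have hjac0 : jac φ t₀ = 1 := by
    ext l j
    rw [hjac t₀ hmem, hQ1, Matrix.one_apply, Matrix.one_apply]
    exact if_congr hC.κ_injective.eq_iff rfl rfl
  obtain ⟨Φ, hΦt, hΦs, hΦ⟩ := exists_openPartialHomeomorph (hU1.inter hU2)
    (hφd.mono fun x hx => hx.1.1) (t := t₀)
    ⟨⟨hmem, by simp [hQ1]⟩, hmem, by simp [hjac0]⟩ (by simp [hjac0])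
  have hs : Φ.source ⊆ ball t₀ ρ := fun x hx => (hΦs hx).1.1
  have hJ : ∀ t ∈ Φ.source, (jac Φ t).det ≠ 0 := fun t ht => by rw [hΦ]; exact (hΦs ht).2.2
  have hθ : ∀ i, HolMatOn (fun t => evalMat K (θ i) (expMap t)) (ball t₀ ρ) := fun i =>
    (holMatOn_evalMat_expMap (θ i)).mono hball
  refine ⟨Φ, Q, hΦt, hJ, isMirrorGauge_gaugedForm hC (fun t ht => hV t (hs ht))
    (by rw [hΦ]; exact hφd.mono hs) hJ (hQ.mono hs) (fun t ht => (hΦs ht).1.2)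
    (fun t ht => hpd t (hs ht)) (fun t ht k => ?_) (fun t ht i k => ?_)⟩
  · exact column_one_of_flat isOpen_ball hconv hQ hpd hmem hQ1
      (fun x hx i k => evalMat_θ_one hC (hV x hx) i k) (hs ht) k
  · refine column_eq_sum hC.κ_injective (fun k hk j => ?_) (fun l j => ?_) i k
    · exact column_eq_zero_of_flat isOpen_ball hconv hQ hθ hC.κ_injective hpd hmem hQ1
        (fun x hx i j k hk => evalMat_θ_row hC (hV x hx) i j k hk) (hs ht) hk j
    · rw [hΦ, hjac t (hs ht)]

end Local
end

section
variable {r : ℕ}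
open CoeffAlgebra Set Topology Metric

/-! ### The fibre over q = 0, and holomorphy of the product. -/

section SpecialFibre

variable {K : CoeffAlgebra r} {s u : ℕ} {R : Fin u → MvPolynomial (Fin r) K.Elem}
  {bA : Module.Basis (Fin (s + 1)) K.Elem (AlgA K R)} {e : Fin (s + 1) → Fin r →₀ ℕ}

theorem cls₀_eq_sum
    (hb : ∀ j, bA j = Ideal.Quotient.mk (relIdeal K R) (MvPolynomial.monomial (e j) 1))
    (p : MvPolynomial (Fin r) ℂ) : cls₀ K R p =
    ∑ k, coordAt bA K.origin p k • cls₀ K R (MvPolynomial.monomial (e k) 1) := by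
  have h := sub_sum_coordAt_mem hb K.origin p
  rw [relIdealAt, ← relIdeal₀_eq_map, ← Ideal.Quotient.eq_zero_iff_mem,
    ← Ideal.Quotient.mkₐ_eq_mk ℂ, map_sub, map_sum, sub_eq_zero] at h
  simp only [map_smul] at h
  exact h

/-- The classes of the standard monomials form a basis of `𝒜₀`. -/
theorem exists_basis_cls₀
    (hb : ∀ j, bA j = Ideal.Quotient.mk (relIdeal K R) (MvPolynomial.monomial (e j) 1))
    : ∃ B : Module.Basis (Fin (s + 1)) ℂ (AlgA₀ K R),
    (∀ j, B j = cls₀ K R (MvPolynomial.monomial (e j) 1)) ∧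
    ∀ p, B.equivFun (cls₀ K R p) = coordAt bA K.origin p := by
  have hli : LinearIndependent ℂ fun j => cls₀ K R (MvPolynomial.monomial (e j) 1) := by
    rw [Fintype.linearIndependent_iff]
    intro a ha j
    have h1 : cls₀ K R (∑ j, a j • MvPolynomial.monomial (e j) 1) = 0 := by
      rw [← ha]
      simp only [cls₀]
      rw [← Ideal.Quotient.mkₐ_eq_mk ℂ, map_sum]
      simp only [map_smul]
    have h2 := Ideal.Quotient.eq_zero_iff_mem.1 h1
    rw [relIdeal₀_eq_map] at h2
    have h3 := congrFun (coordAt_eq_zero_of_mem bA h2) j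
    rw [map_sum] at h3
    simp only [map_smul, coordAt_monomial hb] at h3
    simpa [Finset.sum_apply, Pi.single_apply] using h3
  have hsp : ⊤ ≤ Submodule.span ℂ
      (range fun j => cls₀ K R (MvPolynomial.monomial (e j) 1)) := by
    rintro x -
    obtain ⟨p, rfl⟩ := Ideal.Quotient.mk_surjective x
    change cls₀ K R p ∈ _
    rw [cls₀_eq_sum hb]
    exact Submodule.sum_mem _ fun k _ => Submodule.smul_mem _ _ (Submodule.subset_span ⟨k, rfl⟩)
  have hB : ∀ j, Module.Basis.mk hli hsp j = cls₀ K R (MvPolynomial.monomial (e j) 1) :=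
    fun j => Module.Basis.mk_apply hli hsp j
  refine ⟨Module.Basis.mk hli hsp, hB, fun p => ?_⟩
  rw [← LinearEquiv.eq_symm_apply, Module.Basis.equivFun_symm_apply, cls₀_eq_sum hb]
  simp only [hB]

/-- The fibre of 𝒜 over q = 0 is 𝒜₀, and Q = 1 leaves its multiplication as it is. -/
theorem transportedMul_origin
    (hb : ∀ j, bA j = Ideal.Quotient.mk (relIdeal K R) (MvPolynomial.monomial (e j) 1))
    {B : Module.Basis (Fin (s + 1)) ℂ (AlgA₀ K R)}
    (hB : ∀ p, B.equivFun (cls₀ K R p) = coordAt bA K.origin p) (x y : AlgA₀ K R) :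
    transportedMul bA B 0 1 x y = x * y := by
  obtain ⟨p, rfl⟩ := Ideal.Quotient.mk_surjective x
  obtain ⟨p', rfl⟩ := Ideal.Quotient.mk_surjective y
  rw [← map_mul]
  change transportedMul bA B 0 1 (cls₀ K R p) (cls₀ K R p') = cls₀ K R (p * p')
  rw [transportedMul, LinearEquiv.symm_apply_eq, hB, hB, hB, inv_one, Matrix.one_mulVec,
    Matrix.one_mulVec, Matrix.one_mulVec]
  funext k
  rw [coordAt_mul hb, fibreMul]
  simp only [← fn_eq_eval]
  rfl

end SpecialFibre

section Holomorphic

variable {K : CoeffAlgebra r} {s u : ℕ} {R : Fin u → MvPolynomial (Fin r) K.Elem}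

/-- Stated in the variable q and not in t, so that it can be used at q = 0. -/
theorem differentiableOn_transportedMul (bA : Module.Basis (Fin (s + 1)) K.Elem (AlgA K R))
    (B : Module.Basis (Fin (s + 1)) ℂ (AlgA₀ K R))
    {Q : (Fin r → ℂ) → Matrix (Fin (s + 1)) (Fin (s + 1)) ℂ} {U : Set (Fin r → ℂ)}
    (hU : U ⊆ K.V) (hQ : HolMatOn Q U) (hdet : ∀ z ∈ U, (Q z).det ≠ 0) (x y : AlgA₀ K R)
    (k : Fin (s + 1)) :
    DifferentiableOn ℂ (fun z => B.repr (transportedMul bA B z (Q z) x y) k) U := by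
  have h1 : ∀ z, B.repr (transportedMul bA B z (Q z) x y) k =
      (Q z).mulVec (fibreMul bA z ((Q z)⁻¹.mulVec (B.equivFun x))
        ((Q z)⁻¹.mulVec (B.equivFun y))) k := fun z => by
    rw [← Module.Basis.equivFun_apply, transportedMul, LinearEquiv.apply_symm_apply]
  have hmv : ∀ {M : (Fin r → ℂ) → Matrix (Fin (s + 1)) (Fin (s + 1)) ℂ}, HolMatOn M U →
      ∀ {c : (Fin r → ℂ) → Fin (s + 1) → ℂ}, (∀ j, DifferentiableOn ℂ (fun z => c z j) U) →
      ∀ j, DifferentiableOn ℂ (fun z => (M z).mulVec (c z) j) U := fun hM c hc j => by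
    simp only [Matrix.mulVec, dotProduct]
    exact DifferentiableOn.fun_sum fun b _ => (hM j b).mul (hc b)
  have hinv := fun v : Fin (s + 1) → ℂ => hmv (hQ.inv hdet) (c := fun _ => v)
    fun _ => differentiableOn_const _
  simp only [h1]
  refine hmv hQ (fun b => ?_) k
  exact DifferentiableOn.fun_sum fun i _ => DifferentiableOn.fun_sum fun j _ =>
    ((differentiableOn_fn _).mono hU).mul ((hinv _ i).mul (hinv _ j))

end Holomorphic

/-! ### Logarithmic primitives near q = 0. -/

section Logarithmic

theorem norm_fderiv_expMap_le (t : Fin r → ℂ) :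
    ‖fderiv ℂ (expMap : (Fin r → ℂ) → Fin r → ℂ) t‖ ≤ ‖expMap t‖ := by
  refine ContinuousLinearMap.opNorm_le_bound _ (norm_nonneg _) fun v => ?_
  refine (pi_norm_le_iff_of_nonneg (by positivity)).2 fun i => ?_
  have h1 : fderiv ℂ expMap t v i = expMap t i * v i := by
    have h : HasFDerivAt (fun x : Fin r → ℂ => Complex.exp (x i)) (Complex.exp (t i) •
        (ContinuousLinearMap.proj i : (Fin r → ℂ) →L[ℂ] ℂ)) t := (hasFDerivAt_apply i t).cexp
    have h2 := hasFDerivAt_pi'.1 (differentiable_expMap t).hasFDerivAt i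
    have h3 := congrArg (fun L => L v) (h2.unique h)
    exact h3
  rw [h1, norm_mul]
  exact mul_le_mul (norm_le_pi_norm _ i) (norm_le_pi_norm _ i) (norm_nonneg _) (norm_nonneg _)

/-- In the sup norm this is a product of half planes Re tᵢ < log ρ. Convexity is what the mean value
inequality needs on this domain. -/
theorem convex_preimage_expMap_ball {ρ : ℝ} (hρ : 0 < ρ) :
    Convex ℝ (expMap ⁻¹' ball (0 : Fin r → ℂ) ρ) := by
  have h : expMap ⁻¹' ball (0 : Fin r → ℂ) ρ = ⋂ i, {t : Fin r → ℂ | (t i).re < Real.log ρ} := by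
    ext t
    simp only [mem_preimage, mem_ball_zero_iff, pi_norm_lt_iff hρ, mem_iInter, mem_ofPred_eq]
    refine forall_congr' fun i => ?_
    rw [expMap, Complex.norm_exp, Real.lt_log_iff_exp_lt hρ]
  rw [h]
  refine convex_iInter fun i => ?_
  refine convex_halfSpace_lt (f := fun t : Fin r → ℂ => (t i).re) ⟨fun x y => ?_, fun c x => ?_⟩ _
  · simp
  · simp

/-- Coordinates with logarithmic derivatives `T` on a ball around `q = 0`. -/
theorem exists_log_primitive {ρ : ℝ} {T : Fin r → Fin r → (Fin r → ℂ) → ℂ}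
    (hT : ∀ l j, DifferentiableOn ℂ (T l j) (ball 0 ρ))
    (hT0 : ∀ l j, T l j 0 = if l = j then 1 else 0)
    (hsym : ∀ q ∈ ball (0 : Fin r → ℂ) ρ, ∀ l i j, q i * pd i (T l j) q = q j * pd j (T l i) q) :
    ∃ g : (Fin r → ℂ) → Fin r → ℂ, g 0 = 0 ∧ DifferentiableOn ℂ g (ball 0 ρ) ∧
      ∀ q ∈ ball (0 : Fin r → ℂ) ρ, ∀ l j,
        T l j q = (if l = j then 1 else 0) + q j * pd j (fun x => g x l) q := by
  -- Where q_j = 0, symmetry gives qᵢ∂T_lj/∂qᵢ = q_j∂T_li/∂q_j = 0 along the ray from 0, so T_lj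
  -- keeps its value at 0.
  have hzero : ∀ l j, ∀ q ∈ ball (0 : Fin r → ℂ) ρ, q j = 0 →
      T l j q - (if l = j then 1 else 0) = 0 := fun l j q hq hj => by
    rw [eq_of_radial_deriv_eq_zero (hT l j) hq fun σ hσ => ?_, hT0, sub_self]
    have hm := smul_mem_ball_zero hq ⟨hσ.1.le, hσ.2.le⟩
    refine Finset.sum_eq_zero fun i _ => ?_
    rw [hsym _ hm, Pi.smul_apply, hj, smul_zero, zero_mul]
  choose S hS hTS using fun l j => exists_eq_coord_mul ((hT l j).sub (differentiableOn_const _)) j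
    (hzero l j)
  have hTS' : ∀ l j, ∀ q ∈ ball (0 : Fin r → ℂ) ρ,
      T l j q = (if l = j then 1 else 0) + q j * S l j q := fun l j q hq => by
    rw [← hTS l j q hq]
    simp only [Pi.sub_apply, add_sub_cancel]
  have hcd : ∀ (j : Fin r) (q : Fin r → ℂ), DifferentiableAt ℂ (fun x : Fin r → ℂ => x j) q :=
    fun j q => differentiableAt_apply j q
  have hSd : ∀ l j, ∀ q ∈ ball (0 : Fin r → ℂ) ρ, DifferentiableAt ℂ (S l j) q := fun l j q hq =>
    (hS l j).differentiableAt (isOpen_ball.mem_nhds hq)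
  have hpdT : ∀ q ∈ ball (0 : Fin r → ℂ) ρ, ∀ l i j, i ≠ j →
      pd i (T l j) q = q j * pd i (S l j) q := fun q hq l i j hij => by
    have hm : DifferentiableAt ℂ (fun x => x j * S l j x) q := (hcd j q).mul (hSd l j q hq)
    rw [pd_congr_of_eqOn isOpen_ball (hTS' l j) hq, pd_add (differentiableAt_const _) hm, pd_const, pd_mul (hcd j q) (hSd l j q hq), pd_coord,
      if_neg (Ne.symm hij), zero_mul, zero_add, zero_add]
  -- For i ≠ j the symmetry of T becomes an equality after multiplication by qᵢq_j, a factor that is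
  -- cancelled by density.
  have hclosed : ∀ l, ∀ q ∈ ball (0 : Fin r → ℂ) ρ, ∀ i j, pd i (S l j) q = pd j (S l i) q :=
    fun l q hq i j => by
      by_cases hij : i = j
      · rw [hij]
      · refine eqOn_of_mul_coord_eq isOpen_ball (differentiableOn_pd isOpen_ball (hS l j) i).continuousOn
          (differentiableOn_pd isOpen_ball (hS l i) j).continuousOn i j (fun q hq => ?_) q hq
        have h := hsym q hq l i j
        rw [hpdT q hq l i j hij, hpdT q hq l j i (Ne.symm hij)] at h
        rw [mul_assoc, h]; ring
  choose g hg0 hg hgpd using fun l => exists_primitive_of_pd_symm isOpen_ball (convex_ball _ _)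
    (F := fun j => S l j) (hS l) (hclosed l) 0 0
  refine ⟨fun q l => g l q, funext hg0, differentiableOn_pi.2 hg, fun q hq l j => ?_⟩
  rw [hTS' l j q hq, ← hgpd l q hq j]

end Logarithmic
end

section
variable {r : ℕ}
open CoeffAlgebra Set Topology Metric

/-! ### The coordinates t + g(exp t) and q exp(g(q)). -/

section Exponential

variable {g : (Fin r → ℂ) → Fin r → ℂ}

theorem expMap_add (t t' : Fin r → ℂ) : expMap (t + t') = expMap t * expMap t' :=
  funext fun _ => Complex.exp_add _ _

theorem jac_add_comp_expMap {U : Set (Fin r → ℂ)} (hU : IsOpen U) (hg : DifferentiableOn ℂ g U)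
    {t : Fin r → ℂ} (ht : expMap t ∈ U) (l j : Fin r) :
    jac (fun t => t + g (expMap t)) t l j =
      (if l = j then 1 else 0) + expMap t j * pd j (fun x => g x l) (expMap t) := by
  have hgl : DifferentiableAt ℂ (fun x => g x l) (expMap t) :=
    (differentiableOn_pi.1 hg l).differentiableAt (hU.mem_nhds ht)
  have hc : DifferentiableAt ℂ (fun x => g (expMap x) l) t :=
    DifferentiableAt.comp (g := fun x => g x l) t hgl (differentiable_expMap t)
  change pd j (fun x => x l + g (expMap x) l) t = _
  rw [pd_add (differentiableAt_apply l t) hc, pd_coord, pd_comp_expMap hgl]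

/-- If `g` is holomorphic near `0` and `g 0 = 0`, then `q ↦ q exp (g q)` is a local coordinate
system at `0`. -/
theorem exists_openPartialHomeomorph_mul_exp {ρ : ℝ} (hρ : 0 < ρ)
    (hg : DifferentiableOn ℂ g (ball 0 ρ)) (hg0 : g 0 = 0) :
    ∃ Ψ : OpenPartialHomeomorph (Fin r → ℂ) (Fin r → ℂ), 0 ∈ Ψ.source ∧ Ψ.source ⊆ ball 0 ρ ∧
      (∀ q, Ψ q = q * expMap (g q)) ∧ DifferentiableOn ℂ Ψ.symm Ψ.target := by
  set ψ : (Fin r → ℂ) → Fin r → ℂ := fun q => q * expMap (g q) with hψ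
  have hexp : ∀ l, DifferentiableOn ℂ (fun q => expMap (g q) l) (ball 0 ρ) := fun l =>
    differentiableOn_pi.1 (differentiable_expMap.comp_differentiableOn hg) l
  have hψl : ∀ l, DifferentiableOn ℂ (fun q => ψ q l) (ball 0 ρ) := fun l =>
    (differentiable_apply l).differentiableOn.mul (hexp l)
  have hψd : DifferentiableOn ℂ ψ (ball 0 ρ) := differentiableOn_pi.2 hψl
  have h0 : (0 : Fin r → ℂ) ∈ ball (0 : Fin r → ℂ) ρ := mem_ball_self hρ
  have hjac0 : jac ψ 0 = 1 := by
    ext l j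
    change pd j (fun q => q l * expMap (g q) l) 0 = _
    rw [pd_mul (differentiableAt_apply l 0) ((hexp l).differentiableAt (isOpen_ball.mem_nhds h0)),
      pd_coord, hg0, Matrix.one_apply]
    simp [expMap]
  have hU := isOpen_inter_ne_zero isOpen_ball
    (HolMatOn.det fun l j => differentiableOn_pd isOpen_ball (hψl l) j)
  obtain ⟨Ψ, hΨ0, hΨs, hΨ⟩ := exists_openPartialHomeomorph (φ := ψ) hU
    (hψd.mono inter_subset_left) (t := 0) ⟨h0, by change (jac ψ 0).det ≠ 0; simp [hjac0]⟩
    (by simp [hjac0])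
  refine ⟨Ψ, hΨ0, fun q hq => (hΨs hq).1, fun q => by rw [hΨ], differentiableOn_symm ?_ ?_⟩
  · rw [hΨ]; exact hψd.mono fun q hq => (hΨs hq).1
  · rw [hΨ]; exact fun q hq => (hΨs hq).2

/-- If `g` is holomorphic near `0`, then `t ↦ t + g (exp t)` is a coordinate system on the domain
where all the `exp tᵢ` are small. -/
theorem exists_openPartialHomeomorph_add_comp_expMap {ρ : ℝ} (hρ : 0 < ρ)
    (hg : DifferentiableOn ℂ g (ball 0 ρ)) : ∃ ρ' > 0, ρ' ≤ ρ ∧ ∀ ρ'' > 0, ρ'' ≤ ρ' →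
      ∃ Φ : OpenPartialHomeomorph (Fin r → ℂ) (Fin r → ℂ),
        Φ.source = expMap ⁻¹' ball 0 ρ'' ∧ ∀ t, Φ t = t + g (expMap t) := by
  have h0 : (0 : Fin r → ℂ) ∈ ball (0 : Fin r → ℂ) ρ := mem_ball_self hρ
  have hc : ContinuousAt (fun q => ‖fderiv ℂ g q‖) 0 :=
    ((differentiableOn_fderiv isOpen_ball hg).continuousOn.continuousAt
      (isOpen_ball.mem_nhds h0)).norm
  set C := ‖fderiv ℂ g 0‖ + 1 with hC
  have hCpos : 0 < C := by positivity
  obtain ⟨σ, hσ, hσC⟩ := Metric.eventually_nhds_iff_ball.1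
    (hc.eventually_lt_const (show ‖fderiv ℂ g 0‖ < C by rw [hC]; linarith))
  -- C bounds the derivative of g and 1/(2C) that of exp, so g ∘ exp has derivative of norm at most
  -- 1/2. All smaller radii are admitted, since the domain is to be shrunk further.
  refine ⟨min ρ (min σ (1 / (2 * C))), by positivity, min_le_left _ _, fun ρ'' hρ'' hle => ?_⟩
  have h1 : ρ'' ≤ ρ := hle.trans (min_le_left _ _)
  have h2 : ρ'' ≤ σ := hle.trans ((min_le_right _ _).trans (min_le_left _ _))
  have h3 : ρ'' ≤ 1 / (2 * C) := hle.trans ((min_le_right _ _).trans (min_le_right _ _))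
  have hgd : ∀ t ∈ expMap ⁻¹' ball (0 : Fin r → ℂ) ρ'', DifferentiableAt ℂ g (expMap t) :=
    fun t ht => hg.differentiableAt (isOpen_ball.mem_nhds (ball_subset_ball h1 ht))
  refine exists_openPartialHomeomorph_of_norm_fderiv_le
    (isOpen_preimage_expMap isOpen_ball) (convex_preimage_expMap_ball hρ'')
    (ε := fun t => g (expMap t)) (fun t ht =>
      ((hgd t ht).comp t (differentiable_expMap t)).differentiableWithinAt) fun t ht => ?_
  have h4 : fderiv ℂ (fun t => g (expMap t)) t =
      (fderiv ℂ g (expMap t)).comp (fderiv ℂ expMap t) :=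
    ((hgd t ht).hasFDerivAt.comp t (differentiable_expMap t).hasFDerivAt).fderiv
  rw [h4]
  refine (ContinuousLinearMap.opNorm_comp_le _ _).trans ?_
  have h5 : ‖fderiv ℂ g (expMap t)‖ ≤ C := (hσC _ (ball_subset_ball h2 ht)).le
  have h6 : ‖fderiv ℂ (expMap : (Fin r → ℂ) → Fin r → ℂ) t‖ ≤ 1 / (2 * C) :=
    (norm_fderiv_expMap_le t).trans ((mem_ball_zero_iff.1 ht).le.trans h3)
  calc _ ≤ C * (1 / (2 * C)) := mul_le_mul h5 h6 (norm_nonneg _) hCpos.le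
    _ = 1 / 2 := by field_simp

end Exponential

section NearOrigin

variable {K : CoeffAlgebra r} {s u : ℕ} {R : Fin u → MvPolynomial (Fin r) K.Elem}
  {ω θ : Fin r → Matrix (Fin (s + 1)) (Fin (s + 1)) K.Elem}
  {k₀ : Fin (s + 1)} {κ : Fin r → Fin (s + 1)}

/-- The flat coordinates near `q = 0` given by a normalized gauge transformation. -/
theorem exists_log_coordinates (hC : IsFlatConnection K ω θ k₀ κ) {N : Set (Fin r → ℂ)}
    {Q : (Fin r → ℂ) → Matrix (Fin (s + 1)) (Fin (s + 1)) ℂ} (hN : IsOpen N) (h0 : 0 ∈ N)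
    (hNV : N ⊆ K.V) (hQ : HolMatOn Q N) (hQ0 : Q 0 = 1)
    (hQθ : ∀ q ∈ N, ∀ i, q i • matPd i Q q = Q q * evalMat K (θ i) q) :
    ∃ ρ > 0, ball 0 ρ ⊆ N ∧ (∀ q ∈ ball (0 : Fin r → ℂ) ρ, (Q q).det ≠ 0) ∧
      ∃ g : (Fin r → ℂ) → Fin r → ℂ, g 0 = 0 ∧ DifferentiableOn ℂ g (ball 0 ρ) ∧
        (∀ q ∈ ball (0 : Fin r → ℂ) ρ, ∀ k, Q q k k₀ = if k = k₀ then 1 else 0) ∧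
        (∀ q ∈ ball (0 : Fin r → ℂ) ρ, ∀ k, (∀ l, k ≠ κ l) → ∀ j, Q q k (κ j) = 0) ∧
        (∀ q ∈ ball (0 : Fin r → ℂ) ρ,
          (Matrix.of fun l j => Q q (κ l) (κ j) : Matrix (Fin r) (Fin r) ℂ).det ≠ 0) ∧
        ∀ q ∈ ball (0 : Fin r → ℂ) ρ, ∀ l j, Q q (κ l) (κ j) =
          (if l = j then 1 else 0) + q j * pd j (fun x => g x l) q := by
  set T : (Fin r → ℂ) → Matrix (Fin r) (Fin r) ℂ := fun q =>
    Matrix.of fun l j => Q q (κ l) (κ j) with hT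
  have hTh : HolMatOn T N := fun l j => hQ (κ l) (κ j)
  have hδ : ∀ l j, Q 0 (κ l) (κ j) = if l = j then 1 else 0 := fun l j => by
    rw [hQ0, Matrix.one_apply]
    exact if_congr hC.κ_injective.eq_iff rfl rfl
  have hT0 : T 0 = 1 := by
    ext l j
    rw [Matrix.one_apply, ← hδ]; rfl
  have hU := (isOpen_inter_ne_zero hN hQ.det).inter (isOpen_inter_ne_zero hN hTh.det)
  obtain ⟨ρ, hρ, hball⟩ := Metric.isOpen_iff.1 hU 0
    ⟨⟨h0, by simp [hQ0]⟩, h0, by simp [hT0]⟩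
  have hbN : ball 0 ρ ⊆ N := fun q hq => (hball hq).1.1
  have hdet : ∀ q ∈ ball (0 : Fin r → ℂ) ρ, (Q q).det ≠ 0 := fun q hq => (hball hq).1.2
  have hQb := hQ.mono hbN
  have hmem : (0 : Fin r → ℂ) ∈ ball (0 : Fin r → ℂ) ρ := mem_ball_self hρ
  -- θᵢ/qᵢ is not visibly holomorphic at 0, but Q⁻¹ ∂Q/∂qᵢ is, and qᵢηᵢ = θᵢ. By density,
  -- identically zero entries of θᵢ are zero in ηᵢ, so uniqueness for an ordinary system starting at
  -- q = 0 applies.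
  set η : Fin r → (Fin r → ℂ) → Matrix (Fin (s + 1)) (Fin (s + 1)) ℂ := fun i q =>
    (Q q)⁻¹ * matPd i Q q with hη
  have hηh : ∀ i, HolMatOn (η i) (ball 0 ρ) := fun i =>
    (hQb.inv hdet).mul (hQb.matPd isOpen_ball i)
  have hpd : ∀ q ∈ ball (0 : Fin r → ℂ) ρ, ∀ i, matPd i Q q = Q q * η i q := fun q hq i => by
    rw [hη, ← mul_assoc, Matrix.mul_nonsing_inv _ (hdet q hq).isUnit, one_mul]
  have hηθ : ∀ q ∈ ball (0 : Fin r → ℂ) ρ, ∀ i, q i • η i q = evalMat K (θ i) q := fun q hq i => by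
    rw [hη, ← Matrix.mul_smul, hQθ q (hbN hq), ← mul_assoc,
      Matrix.nonsing_inv_mul _ (hdet q hq).isUnit, one_mul]
  have hηzero : ∀ i k j, (∀ q ∈ ball (0 : Fin r → ℂ) ρ, evalMat K (θ i) q k j = 0) →
      ∀ q ∈ ball (0 : Fin r → ℂ) ρ, η i q k j = 0 := fun i k j h =>
    eqOn_zero_of_coord_ne_zero isOpen_ball (hηh i k j).continuousOn fun q hq hne => by
      have h1 := congrFun (congrFun (hηθ q hq i) k) j
      rw [h q hq, Matrix.smul_apply, smul_eq_mul] at h1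
      exact (mul_eq_zero.1 h1).resolve_left (hne i)
  have hV : ∀ q ∈ ball (0 : Fin r → ℂ) ρ, q ∈ K.V := fun q hq => hNV (hbN hq)
  have hsym : ∀ q ∈ ball (0 : Fin r → ℂ) ρ, ∀ l i j,
      q i * pd i (fun q => Q q (κ l) (κ j)) q = q j * pd j (fun q => Q q (κ l) (κ i)) q :=
    fun q hq l i j => by
      have h1 : ∀ i j, q i * pd i (fun q => Q q (κ l) (κ j)) q =
          ∑ b, Q q (κ l) b * evalMat K (θ i) q b (κ j) := fun i j => by
        rw [← Matrix.mul_apply, ← hQθ q (hbN hq)]; rfl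
      rw [h1, h1]
      simp only [evalMat_apply, hC.θ_symm i j]
  obtain ⟨g, hg0, hg, hgT⟩ := exists_log_primitive (T := fun l j q => Q q (κ l) (κ j))
    (fun l j => hQb _ _) hδ hsym
  refine ⟨ρ, hρ, hbN, hdet, g, hg0, hg, fun q hq k => ?_, fun q hq k hk j => ?_,
    fun q hq => (hball hq).2.2, hgT⟩
  · exact column_one_of_flat isOpen_ball (convex_ball _ _) hQb hpd hmem hQ0
      (fun x hx i k => hηzero i k k₀ (fun q hq => evalMat_θ_one hC (hV q hq) i k) x hx) hq k
  · exact column_eq_zero_of_flat isOpen_ball (convex_ball _ _) hQb hηh hC.κ_injective hpd hmem hQ0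
      (fun x hx i j k hk => hηzero i k (κ j)
        (fun q hq => evalMat_θ_row hC (hV q hq) i j k hk) x hx) hq hk j

/-- Near `q = 0`, a normalized gauge transformation gives flat coordinates of the form
`t + g (exp t)`, and the transported product is holomorphic in the corresponding `q̂`. -/
theorem exists_mirrorGauge_near_zero (hC : IsFlatConnection K ω θ k₀ κ) {N : Set (Fin r → ℂ)}
    {Q : (Fin r → ℂ) → Matrix (Fin (s + 1)) (Fin (s + 1)) ℂ} (hN : IsOpen N) (h0 : 0 ∈ N)
    (hNV : N ⊆ K.V) (hQ : HolMatOn Q N) (hQ0 : Q 0 = 1)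
    (hQθ : ∀ q ∈ N, ∀ i, q i • matPd i Q q = Q q * evalMat K (θ i) q) :
    ∃ ρ : ℝ, 0 < ρ ∧ ball 0 ρ ⊆ N ∧ (∀ q ∈ ball (0 : Fin r → ℂ) ρ, (Q q).det ≠ 0) ∧
      ∃ (φ : OpenPartialHomeomorph (Fin r → ℂ) (Fin r → ℂ)) (g : (Fin r → ℂ) → Fin r → ℂ),
        φ.source = expMap ⁻¹' ball 0 ρ ∧ DifferentiableOn ℂ g (ball 0 ρ) ∧ g 0 = 0 ∧
        (∀ t, φ t = t + g (expMap t)) ∧ (∀ t ∈ φ.source, (jac φ t).det ≠ 0) ∧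
        IsMirrorGauge K ω θ k₀ κ φ (fun t => Q (expMap t))
          (gaugedForm K ω φ fun t => Q (expMap t)) ∧
        ∃ Ψ : OpenPartialHomeomorph (Fin r → ℂ) (Fin r → ℂ), ball 0 ρ ⊆ Ψ.source ∧ Ψ 0 = 0 ∧
          (∀ t, Ψ (expMap t) = expMap (φ t)) ∧ DifferentiableOn ℂ Ψ.symm Ψ.target := by
  obtain ⟨ρ₁, hρ₁, hball, hdet, g, hg0, hg, hone, hrow, hTdet, hgT⟩ :=
    exists_log_coordinates hC hN h0 hNV hQ hQ0 hQθ
  obtain ⟨ρ₂, hρ₂, hρ₂', hΦ⟩ := exists_openPartialHomeomorph_add_comp_expMap hρ₁ hg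
  -- Ψ is the map q ↦ q̂. It satisfies Ψ ∘ exp = exp ∘ φ and is also defined at q = 0.
  obtain ⟨Ψ, hΨ0, hΨs, hΨ, hΨd⟩ := exists_openPartialHomeomorph_mul_exp hρ₁ hg hg0
  obtain ⟨ρ₃, hρ₃, hΨball⟩ := Metric.isOpen_iff.1 Ψ.open_source 0 hΨ0
  have hρ : 0 < min ρ₂ ρ₃ := lt_min hρ₂ hρ₃
  obtain ⟨φ, hφs, hφ⟩ := hΦ (min ρ₂ ρ₃) hρ (min_le_left _ _)
  have hsub : ball (0 : Fin r → ℂ) (min ρ₂ ρ₃) ⊆ ball 0 ρ₁ :=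
    ball_subset_ball ((min_le_left _ _).trans hρ₂')
  have hmem : ∀ t ∈ φ.source, expMap t ∈ ball (0 : Fin r → ℂ) ρ₁ := fun t ht => by
    rw [hφs] at ht; exact hsub ht
  have hφf : ⇑φ = fun t => t + g (expMap t) := funext hφ
  have hjac : ∀ t ∈ φ.source, ∀ l j, jac φ t l j = Q (expMap t) (κ l) (κ j) := fun t ht l j => by
    rw [hφf, jac_add_comp_expMap isOpen_ball hg (hmem t ht), hgT _ (hmem t ht)]
  have hJ : ∀ t ∈ φ.source, (jac φ t).det ≠ 0 := fun t ht => by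
    have : jac φ t = Matrix.of fun l j => Q (expMap t) (κ l) (κ j) := by
      ext l j; exact hjac t ht l j
    rw [this]; exact hTdet _ (hmem t ht)
  refine ⟨min ρ₂ ρ₃, hρ, hsub.trans hball, fun q hq => hdet q (hsub hq), φ, g, hφs, hg.mono hsub,
    hg0, hφ, hJ, ?_, Ψ, (ball_subset_ball (min_le_right _ _)).trans hΨball, ?_, fun t => ?_, hΨd⟩
  · refine isMirrorGauge_gaugedForm hC (fun t ht => hNV (hball (hmem t ht))) ?_ hJ ?_
      (fun t ht => hdet _ (hmem t ht)) (fun t ht i => ?_) (fun t ht => hone _ (hmem t ht))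
      (fun t ht i k => ?_)
    · rw [hφf]
      exact differentiableOn_id.add (hg.comp differentiable_expMap.differentiableOn hmem)
    · exact hQ.comp differentiable_expMap.differentiableOn fun t ht => hball (hmem t ht)
    · rw [matPd_comp_expMap hN hQ (hball (hmem t ht)), hQθ _ (hball (hmem t ht))]
    · exact column_eq_sum hC.κ_injective (hrow _ (hmem t ht)) (hjac t ht) i k
  · rw [hΨ, hg0, zero_mul]
  · rw [hΨ, hφ, expMap_add]

end NearOrigin
end


end QDM

end


/-! ### Assembly of the theorem. -/

theorem theorem5p3 {r s u : ℕ} (K : QDM.CoeffAlgebra r) (w : Fin r → ℕ)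
    (R : Fin u → MvPolynomial (Fin r) K.Elem) (hA : QDM.IsDeformation K w s R)
    (d : Fin u → QDM.Sym K) (hM : QDM.IsQuantization K s R d)
    (hd : ∀ l, QDM.IsHomogOp K w (d l))
    (G : Set (QDM.Sym K)) (hG : QDM.IsGroebner K (QDM.leftIdeal K d) G)
    (hG2 : QDM.ZerothTermsConstant K G)
    (e : Fin (s + 1) → Fin r →₀ ℕ) (he : Function.Injective e)
    (he' : Set.range e = QDM.standardExps K G)
    (ω θ : Fin r → Matrix (Fin (s + 1)) (Fin (s + 1)) K.Elem)
    (hΩ : QDM.HasConnectionForm K d e ω θ) :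
    ∃ (k₀ : Fin (s + 1)) (κ : Fin r → Fin (s + 1))
      (B : Module.Basis (Fin (s + 1)) ℂ (QDM.AlgA₀ K R)),
      e k₀ = 0 ∧ (∀ i, e (κ i) = Finsupp.single i 1) ∧
      (∀ j, B j = QDM.cls₀ K R (MvPolynomial.monomial (e j) 1)) ∧
      -- near every point of the domain of the connection
      (∀ t₀ : Fin r → ℂ, QDM.expMap t₀ ∈ K.V →
        ∃ (φ : OpenPartialHomeomorph (Fin r → ℂ) (Fin r → ℂ))
          (Q : (Fin r → ℂ) → Matrix (Fin (s + 1)) (Fin (s + 1)) ℂ)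
          (ωhat : Fin r → (Fin r → ℂ) → Matrix (Fin (s + 1)) (Fin (s + 1)) ℂ)
          (prod : (Fin r → ℂ) → QDM.AlgA₀ K R → QDM.AlgA₀ K R → QDM.AlgA₀ K R),
          t₀ ∈ φ.source ∧ QDM.IsMirrorGauge K ω θ k₀ κ φ Q ωhat ∧
          QDM.IsQuantumProduct K R e φ Q ωhat prod) ∧
      -- near `q = 0`, when the gauge transformation can be normalized to be `1` at `q = 0`
      (∀ (N : Set (Fin r → ℂ)) (Q₀ : (Fin r → ℂ) → Matrix (Fin (s + 1)) (Fin (s + 1)) ℂ),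
        IsOpen N → 0 ∈ N → N ⊆ K.V → QDM.HolMatOn Q₀ N → Q₀ 0 = 1 →
        (∀ q ∈ N, ∀ i, q i • QDM.matPd i Q₀ q = Q₀ q * QDM.evalMat K (θ i) q) →
        ∃ ρ : ℝ, 0 < ρ ∧ Metric.ball 0 ρ ⊆ N ∧
        ∃ (φ : OpenPartialHomeomorph (Fin r → ℂ) (Fin r → ℂ))
          (ωhat : Fin r → (Fin r → ℂ) → Matrix (Fin (s + 1)) (Fin (s + 1)) ℂ)
          (prod : (Fin r → ℂ) → QDM.AlgA₀ K R → QDM.AlgA₀ K R → QDM.AlgA₀ K R)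
          (g : (Fin r → ℂ) → Fin r → ℂ),
          φ.source = QDM.expMap ⁻¹' Metric.ball 0 ρ ∧
          DifferentiableOn ℂ g (Metric.ball 0 ρ) ∧ g 0 = 0 ∧
          (∀ t ∈ φ.source, φ t = t + g (QDM.expMap t)) ∧
          QDM.IsMirrorGauge K ω θ k₀ κ φ (fun t => Q₀ (QDM.expMap t)) ωhat ∧
          QDM.IsQuantumProduct K R e φ (fun t => Q₀ (QDM.expMap t)) ωhat prod ∧
          ∃ Nhat : Set (Fin r → ℂ), IsOpen Nhat ∧ 0 ∈ Nhat ∧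
            (∀ t ∈ φ.source, QDM.expMap (φ t) ∈ Nhat) ∧
            ∀ x y k, ∃ F : (Fin r → ℂ) → ℂ, DifferentiableOn ℂ F Nhat ∧
              F 0 = B.repr (x * y) k ∧
              ∀ t ∈ φ.source, B.repr (prod (φ t) x y) k = F (QDM.expMap (φ t))) := by
  obtain ⟨k₀, hk₀⟩ := QDM.exists_of_degree_le_one hA hM hG he' (n := 0) (by simp)
  choose κ hκ using fun i : Fin r =>
    QDM.exists_of_degree_le_one hA hM hG he' (n := Finsupp.single i 1) (by simp)
  have hC := QDM.isFlatConnection hA hM hd hG hG2 he he' hΩ hk₀ hκ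
  have hb := QDM.classicalBasis_apply hA hM hG he'
  have hω := QDM.X_mul_monomial_sub_mem hM hΩ
  obtain ⟨B, hB, hBc⟩ := QDM.exists_basis_cls₀ hb
  refine ⟨k₀, κ, B, hk₀, hκ, hB, fun t₀ ht₀ => ?_, fun N Q₀ hN h0 hNV hQ hQ0 hQθ => ?_⟩
  · obtain ⟨φ, Q, ht, hJ, hmg⟩ := QDM.exists_mirrorGauge hC ht₀
    exact ⟨φ, Q, _, _, ht, hmg, QDM.isQuantumProduct_transportedMul hb hω hB hk₀ hκ hJ hmg⟩
  · obtain ⟨ρ, hρ, hρN, hdet, φ, g, hφs, hg, hg0, hφ, hJ, hmg, Ψ, hΨs, hΨ0, hΨφ, hΨd⟩ :=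
      QDM.exists_mirrorGauge_near_zero hC hN h0 hNV hQ hQ0 hQθ
    -- The neighbourhood of q̂ = 0 is the image of the polydisc under Ψ; it contains 0 besides all
    -- the points exp t̂.
    refine ⟨ρ, hρ, hρN, φ, _, _, g, hφs, hg, hg0, fun t _ => hφ t, hmg,
      QDM.isQuantumProduct_transportedMul hb hω hB hk₀ hκ hJ hmg, Ψ '' Metric.ball 0 ρ,
      Ψ.isOpen_image_of_subset_source Metric.isOpen_ball hΨs,
      ⟨0, Metric.mem_ball_self hρ, hΨ0⟩, fun t ht => ?_, fun x y k => ?_⟩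
    · rw [hφs] at ht
      exact ⟨_, ht, hΨφ t⟩
    -- F is the product transported from the fibre at q = Ψ⁻¹(q̂) by Q₀(q); since Q₀ = 1 at q = 0,
    -- its value there comes from the product of 𝒜₀.
    · refine ⟨fun z => B.repr (QDM.transportedMul (QDM.classicalBasis hA hM hG he') B (Ψ.symm z)
        (Q₀ (Ψ.symm z)) x y) k, ?_, ?_, fun t ht => ?_⟩
      · refine (QDM.differentiableOn_transportedMul _ B (hρN.trans hNV) (hQ.mono hρN) hdet
          x y k).comp (hΨd.mono ?_) ?_
        · rintro _ ⟨q, hq, rfl⟩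
          exact Ψ.map_source (hΨs hq)
        · rintro _ ⟨q, hq, rfl⟩
          rwa [Ψ.left_inv (hΨs hq)]
      · have h1 : Ψ.symm 0 = 0 := by
          conv_lhs => rw [← hΨ0]
          exact Ψ.left_inv (hΨs (Metric.mem_ball_self hρ))
        beta_reduce
        rw [h1, hQ0, QDM.transportedMul_origin hb hBc]
      · have ht' := ht
        rw [hφs] at ht'
        beta_reduce
        rw [← hΨφ, Ψ.left_inv (hΨs ht'), φ.left_inv ht]
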